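/- A tournament $T$ has a finite vertex set $V(T)$, with exactly one of $(x,y),(y,x)$ an arc for each pair of distinct vertices. A set $M\subseteq V(T)$ is a module of $T$ if, for every $v\in V(T)\setminus M$ and all $x,y\in M$, $(v,x)$ is an arc if and only if $(v,y)$ is; $T$ is indecomposable if its only modules are $\varnothing$, the singletons and $V(T)$. For a tournament $T$ with at least five vertices, $\delta(T)$ is the least number of arcs of $T$ whose reversal makes $T$ indecomposable, and for $m\ge 5$, $\delta(m)$ is the maximum of $\delta(T)$ over the $m$-vertex tournaments $T$. The dual of a tournament is obtained by reversing all its arcs. Let $\underline{m}$ be the transitive tournament on $\{0,\dots,m-1\}$ (arcs $(i,j)$ with $i<j$) and $C_3$ the $3$-cycle on $\{0,1,2\}$ with arcs $(0,1),(1,2),(2,0)$. Let $U_5,V_5,W_5$ be the following tournaments on $\{0,\dots,4\}$: $U_5$ has the arcs $(0,1),(0,2),(1,2),(3,0),(1,3),(2,3),(4,0),(4,1),(2,4),(3,4)$; $V_5$ is obtained from $U_5$ by reversing $(3,4)$; $W_5$ has the arcs $(i,j)$ with $0\le i<j\le 3$ together with $(4,0),(4,2),(1,4),(3,4)$. For a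 tournament $R$ on $\{0,\dots,k-1\}$ and tournaments $S_0,\dots,S_{k-1}$, the lexicographic sum $R(S_0,\dots,S_{k-1})$ is the tournament on the disjoint union of the $V(S_i)$ in which the arcs inside $V(S_i)$ are those of $S_i$ and, for $i\ne j$, $x\in V(S_i)$, $y\in V(S_j)$, $(x,y)$ is an arc if and only if $(i,j)$ is an arc of $R$. **Theorem.** Let $n\ge 1$. Then $\delta(4n+3)=n+1$, and a tournament $T$ has $4n+3$ vertices and satisfies $\delta(T)=\delta(4n+3)$ if and only if it is isomorphic to a tournament of one of the following forms, where $T_k$ denotes an arbitrary tournament on $\{0,\dots,k-1\}$ and the dots stand for copies of $\underline{2}$, one for each remaining vertex of $T_k$: - F11. $T_{2n+2}(\underline{1},\underline{2},\ldots,\underline{2})$; - F12. $T_{2n+1}(C_3,\underline{2},\ldots,\underline{2})$; - F13. $C_3(\underline{1},\underline{1},T_{2n}(C_3,\underline{2},\ldots,\underline{2}))$; - F14. $C_3(\underline{1},\underline{1},T_{2n+1}(\underline{1},\underline{2},\ldots,\underline{2}))$; - F15. $\underline{2}(\underline{1},T_{2n+2}(\underline{1},\underline{1},\underline{2},\ldots,\underline{2}))$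 or its dual; - F16. $\underline{2}(\underline{1},T_{2n+1}(C_3,\underline{1},\underline{2},\ldots,\underline{2}))$ or its dual; - F17. $\underline{2}(\underline{1},T_{2n}(C_3,C_3,\underline{2},\ldots,\underline{2}))$ or its dual; - F18. $\underline{3}(\underline{1},T_{2n-1}(S_5,\underline{2},\ldots,\underline{2}),\underline{1})$, where $S_5$ is $U_5$, $V_5$ or $W_5$; - F19. $\underline{3}(\underline{1},T_{2n+2}(\underline{1},\underline{1},\underline{1},\underline{2},\ldots,\underline{2}),\underline{1})$; - F20. $\underline{3}(\underline{1},T_{2n}(C_3,C_3,\underline{1},\underline{2},\ldots,\underline{2}),\underline{1})$ when $n\ge 2$; - F21. $\underline{3}(\underline{1},T_{2n+1}(\underline{1},\underline{1},C_3,\underline{2},\ldots,\underline{2}),\underline{1})$; - F22. $\underline{3}(\underline{1},T_{2n-1}(C_3,C_3,C_3,\underline{2},\ldots,\underline{2}),\underline{1})$ when $n\ge 2$. -/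

import Mathlib

universe u

/-- A tournament on the vertex set `V`: `T.arc x y` says that `(x, y)` is an arc. -/
@[ext]
structure Tournament (V : Type u) where
  arc : V → V → Prop
  irrefl : ∀ x, ¬ arc x x
  arc_iff : ∀ x y, x ≠ y → (arc x y ↔ ¬ arc y x)

namespace Tournament

/-- The dual tournament: all arcs are reversed. -/
def dual {V : Type u} (T : Tournament V) : Tournament V where
  arc x y := T.arc y x
  irrefl := T.irrefl
  arc_iff x y h := T.arc_iff y x h.symm

/-- `M` is a module: every vertex outside `M` relates in the same way to all vertices of `M`. -/
def IsModule {V : Type u} (T : Tournament V) (M : Set V) : Prop :=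
  ∀ x ∈ M, ∀ y ∈ M, ∀ v, v ∉ M → (T.arc v x ↔ T.arc v y)

/-- A tournament is indecomposable if all its modules are trivial. -/
def Indecomposable {V : Type u} (T : Tournament V) : Prop :=
  ∀ M : Set V, T.IsModule M → M = ∅ ∨ (∃ x, M = {x}) ∨ M = Set.univ

/-- `T.inv B` is obtained from `T` by reversing the arcs of `T` that belong to `B`. Only sets `B`
consisting of arcs of `T` are used below. -/
def inv {V : Type u} (T : Tournament V) (B : Finset (V × V)) : Tournament V where
  arc x y := (T.arc x y ∧ (x, y) ∉ B) ∨ (T.arc y x ∧ (y, x) ∈ B)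
  irrefl x h := by
    rcases h with h | h
    · exact T.irrefl x h.1
    · exact T.irrefl x h.1
  arc_iff x y h := by
    have := T.arc_iff x y h
    tauto

/-- The decomposability index `δ(T)`: the least number of arcs whose reversal makes `T`
indecomposable. It is meant for tournaments with at least five vertices, for which such a set of
arcs always exists. -/
noncomputable def decompIndex {V : Type u} (T : Tournament V) : ℕ :=
  sInf {m : ℕ | ∃ B : Finset (V × V),
    (∀ a ∈ B, T.arc a.1 a.2) ∧ B.card = m ∧ (T.inv B).Indecomposable}

/-- The transitive tournament on `{0, …, n - 1}`. -/
def transitive (n : ℕ) : Tournament (Fin n) where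
  arc i j := i < j
  irrefl i := lt_irrefl i
  arc_iff i j h := by
    rw [not_lt]
    exact ⟨le_of_lt, fun h' => lt_of_le_of_ne h' h⟩

/-- The tournament on `{0, …, n - 1}` with the listed arcs. -/
def ofArcs {n : ℕ} (L : List (Fin n × Fin n)) (h₁ : ∀ x, (x, x) ∉ L)
    (h₂ : ∀ x y, x ≠ y → ((x, y) ∈ L ↔ (y, x) ∉ L)) : Tournament (Fin n) where
  arc x y := (x, y) ∈ L
  irrefl := h₁
  arc_iff := h₂

end Tournament

/-- The maximum `δ(n)` of `δ(T)` over the tournaments `T` with `n` vertices. -/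
noncomputable def maxDecompIndex (n : ℕ) : ℕ :=
  sSup (Set.range (fun T : Tournament (Fin n) => T.decompIndex))

/-- The supremum defining `δ(n)` is an attained maximum. -/
theorem maxDecompIndex_isGreatest (n : ℕ) :
    IsGreatest (Set.range (fun T : Tournament (Fin n) => T.decompIndex)) (maxDecompIndex n) := by
  have hfin : Finite (Tournament (Fin n)) :=
    Finite.of_injective (fun T : Tournament (Fin n) => T.arc)
      (fun S T h => Tournament.ext h)
  have hb : BddAbove (Set.range (fun T : Tournament (Fin n) => T.decompIndex)) :=
    (Set.finite_range _).bddAbove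
  exact ⟨Nat.sSup_mem ⟨_, ⟨Tournament.transitive n, rfl⟩⟩ hb, fun _ h => le_csSup hb h⟩

/-- A tournament bundled with its vertex set. -/
structure BTournament where
  V : Type
  tour : Tournament V

namespace BTournament

/-- The transitive tournament with `n` vertices. -/
def lin (n : ℕ) : BTournament := ⟨Fin n, Tournament.transitive n⟩

/-- The 3-cycle. -/
def C₃ : BTournament :=
  ⟨Fin 3, Tournament.ofArcs [(0, 1), (1, 2), (2, 0)] (by decide) (by decide)⟩

def U₅ : BTournament :=
  ⟨Fin 5, Tournament.ofArcs
    [(0, 1), (0, 2), (1, 2), (3, 0), (1, 3), (2, 3), (4, 0), (4, 1), (2, 4), (3, 4)]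
    (by decide) (by decide)⟩

def V₅ : BTournament :=
  ⟨Fin 5, Tournament.ofArcs
    [(0, 1), (0, 2), (1, 2), (3, 0), (1, 3), (2, 3), (4, 0), (4, 1), (2, 4), (4, 3)]
    (by decide) (by decide)⟩

def W₅ : BTournament :=
  ⟨Fin 5, Tournament.ofArcs
    [(0, 1), (0, 2), (0, 3), (1, 2), (1, 3), (2, 3), (4, 0), (4, 2), (1, 4), (3, 4)]
    (by decide) (by decide)⟩

/-- The dual tournament. -/
def dual (S : BTournament) : BTournament := ⟨S.V, S.tour.dual⟩

/-- The lexicographic sum of the tournaments `F i` over the tournament `T`: inside each summand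
the arcs are those of the summand, between distinct summands they follow `T`. -/
def lexSum {I : Type} (T : Tournament I) (F : I → BTournament) : BTournament where
  V := Σ i, (F i).V
  tour :=
    { arc := Sigma.Lex T.arc (fun i => (F i).tour.arc)
      irrefl := by
        rintro ⟨i, a⟩ (⟨_, _, h⟩ | ⟨_, _, h⟩)
        · exact T.irrefl i h
        · exact (F i).tour.irrefl a h
      arc_iff := by
        rintro ⟨i, a⟩ ⟨j, b⟩ h
        by_cases hij : i = j
        · subst hij
          have hab : a ≠ b := fun e => h (by rw [e])
          simpa [Sigma.lex_iff, T.irrefl] using (F i).tour.arc_iff a b hab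
        · simpa [Sigma.lex_iff, hij, Ne.symm hij] using T.arc_iff i j hij }

/-- `subst R [S₀, …, Sₘ₋₁]` is the lexicographic sum `R(S₀, …, Sₘ₋₁, 2, …, 2)`: the first `m`
vertices of `R` are replaced by the listed tournaments, and each of the remaining `k - m` vertices
by the 2-vertex tournament. It is used with `m ≤ k` only. -/
def subst {k : ℕ} (R : Tournament (Fin k)) (L : List BTournament) : BTournament :=
  lexSum R (fun i => L.getD i (lin 2))

/-- The lexicographic sum `2(1, X)`. -/
def twoOne (X : BTournament) : BTournament :=
  lexSum (Tournament.transitive 2) ![lin 1, X]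

/-- The lexicographic sum `3(1, X, 1)`, over the transitive 3-vertex tournament. -/
def threeOne (X : BTournament) : BTournament :=
  lexSum (Tournament.transitive 3) ![lin 1, X, lin 1]

/-- The lexicographic sum `C₃(1, 1, X)`, over the 3-cycle. -/
def cycOne (X : BTournament) : BTournament :=
  lexSum (I := Fin 3) C₃.tour ![lin 1, lin 1, X]

end BTournament

/-- `T` is isomorphic to `S`. -/
def Tournament.IsoTo {V : Type u} (T : Tournament V) (S : BTournament) : Prop :=
  Nonempty (T.arc ≃r S.tour.arc)

open BTournament

/-!
Call a set of vertices a *co-module* of a tournament if it or its complement is a nontrivial module;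
a tournament is indecomposable exactly when it has no co-module. A co-module survives unless an end
of a reversed arc lies in it, so if `T` has `m` disjoint co-modules, then `m ≤ 2 δ(T)`
(`HasPacking.le_two_mul_decompIndex`).

The converse is that `k` reversals suffice when `2 k` vertices meet all co-modules (`near_of_hits`).
Take a smallest set `H` that meets all of them. Each vertex of `H` lies in a minimal co-module that
contains no other vertex of `H`, and a minimal co-module is of one of three kinds: a source or a
sink, a nontrivial module that is indecomposable, or a set whose complement is a module, such that
contracting this complement leaves an indecomposable tournament. The kinds are restrictive enough to
determine when reversing an arc between two such co-modules creates a new module (`Bad`). If none is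
created, the co-modules that remain are those that contain both ends of the arc or neither of them.
When `H` has at least four vertices, two of them can be chosen such that no module is created and
such that no co-module meets `H` in exactly these two (`MinHits.exists_pair`), and then the rest of
`H` meets all co-modules that remain. Hitting sets with three vertices lose one of them in this way,
and those with two vertices can be moved so that a single reversal is enough
(`MinHits.exists_of_ncard_two`).

Minimal co-modules that meet are two-element modules, and these form paths; a greedy choice hence
gives disjoint minimal co-modules, as many as there are vertices in some hitting set
(`exists_hitting_packing`). So `δ(T)` is half the largest number of disjoint minimal co-modules,
rounded up. All of them have at least two vertices, except a source and a sink, whence there are at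
most `2 n + 2` of them in a tournament with `4 n + 3` vertices, and `δ(T) ≤ n + 1`; the transitive
tournament shows that this is attained.

Finally `δ(T) = n + 1` means that there are `2 n + 1` disjoint minimal co-modules. They cover nearly
all vertices, and the listed tournaments describe the ways in which this can happen: with or without
a source and a sink, or with a pair `a → b` such that all other vertices lie between `b` and `a`,
the other co-modules are disjoint modules on the remaining vertices, most of them with two vertices.
At most three vertices are left over to enlarge some of these modules or to form singletons. Since an
indecomposable tournament with at most five vertices has one, two, three or five vertices and is a
`3`-cycle or one of `U₅`, `V₅`, `W₅` in the last two cases (`PrimeIn.isoOn_five`), this gives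
the list.
-/

namespace Tournament

variable {V : Type u} {T : Tournament V}

/-! ### Modules, co-modules and relative modules -/

theorem not_arc_of_arc {x y : V} (h : T.arc x y) : ¬ T.arc y x := by
  have hne : x ≠ y := fun e => T.irrefl x (by rw [← e] at h; exact h)
  exact (T.arc_iff x y hne).1 h

theorem ne_of_arc {x y : V} (h : T.arc x y) : x ≠ y := fun e =>
  T.irrefl x (by rw [← e] at h; exact h)

theorem arc_of_not_arc {x y : V} (hne : x ≠ y) (h : ¬ T.arc x y) : T.arc y x :=
  (T.arc_iff y x hne.symm).2 h

/-- A module is also seen uniformly when arcs leaving it are considered. -/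
theorem IsModule.arc_to_iff {M : Set V} (h : T.IsModule M) {x y v : V} (hx : x ∈ M) (hy : y ∈ M)
    (hv : v ∉ M) : T.arc x v ↔ T.arc y v := by
  have hxv : x ≠ v := fun e => hv (e ▸ hx)
  have hyv : y ≠ v := fun e => hv (e ▸ hy)
  rw [T.arc_iff x v hxv, T.arc_iff y v hyv, h x hx y hy v hv]

theorem isModule_dual {M : Set V} : T.dual.IsModule M ↔ T.IsModule M := by
  constructor
  · intro h x hx y hy v hv
    exact h.arc_to_iff (T := T.dual) hx hy hv
  · intro h x hx y hy v hv
    exact h.arc_to_iff hx hy hv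

theorem isModule_of_subsingleton {M : Set V} (h : M.Subsingleton) : T.IsModule M := by
  intro x hx y hy v _
  rw [h hx hy]

theorem IsModule.union {A B : Set V} (hA : T.IsModule A) (hB : T.IsModule B) {w : V}
    (hwA : w ∈ A) (hwB : w ∈ B) : T.IsModule (A ∪ B) := by
  have key : ∀ x ∈ A ∪ B, ∀ v, v ∉ A ∪ B → (T.arc v x ↔ T.arc v w) := by
    intro x hx v hv
    rcases hx with hx | hx
    · exact hA x hx w hwA v fun h => hv (Or.inl h)
    · exact hB x hx w hwB v fun h => hv (Or.inr h)
  intro x hx y hy v hv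
  rw [key x hx v hv, key y hy v hv]

theorem IsModule.inter {A B : Set V} (hA : T.IsModule A) (hB : T.IsModule B) :
    T.IsModule (A ∩ B) := by
  intro x hx y hy v hv
  by_cases h : v ∈ A
  · exact hB x hx.2 y hy.2 v fun h' => hv ⟨h, h'⟩
  · exact hA x hx.1 y hy.1 v h

/-- The difference of two modules is a module if the subtracted one sticks out. -/
theorem IsModule.diff {A B : Set V} (hA : T.IsModule A) (hB : T.IsModule B) {w : V}
    (hwB : w ∈ B) (hwA : w ∉ A) : T.IsModule (A \ B) := by
  intro x hx y hy v hv
  by_cases h : v ∈ A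
  · have hvB : v ∈ B := by
      by_contra h'
      exact hv ⟨h, h'⟩
    rw [hB.arc_to_iff hvB hwB hx.2, hB.arc_to_iff hvB hwB hy.2]
    exact hA x hx.1 y hy.1 w hwA
  · exact hA x hx.1 y hy.1 v h

/-- A co-module: the set or its complement is a nontrivial module. -/
def Comod (T : Tournament V) (C : Set V) : Prop :=
  (T.IsModule C ∧ C.Nontrivial ∧ C ≠ Set.univ) ∨
    (T.IsModule Cᶜ ∧ Cᶜ.Nontrivial ∧ Cᶜ ≠ Set.univ)

theorem Comod.compl {C : Set V} (h : T.Comod C) : T.Comod Cᶜ := by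
  unfold Comod at *
  rw [compl_compl]
  exact h.symm

theorem Comod.nonempty {C : Set V} (h : T.Comod C) : C.Nonempty := by
  rcases h with h | h
  · exact h.2.1.nonempty
  · rw [Set.nonempty_iff_ne_empty]
    rintro rfl
    exact h.2.2 Set.compl_empty

theorem Comod.ne_univ {C : Set V} (h : T.Comod C) : C ≠ Set.univ := by
  rintro rfl
  simpa using h.compl.nonempty

theorem comod_dual {C : Set V} : T.dual.Comod C ↔ T.Comod C := by
  simp only [Comod, isModule_dual]

theorem indecomposable_iff : T.Indecomposable ↔ ∀ C, ¬ T.Comod C := by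
  constructor
  · intro h C hC
    have key : ∀ M, T.IsModule M → M.Nontrivial → M ≠ Set.univ → False := by
      intro M h1 h2 h3
      rcases h M h1 with rfl | ⟨x, rfl⟩ | rfl
      · exact Set.not_nontrivial_empty h2
      · exact Set.not_nontrivial_singleton h2
      · exact h3 rfl
    rcases hC with hC | hC
    · exact key _ hC.1 hC.2.1 hC.2.2
    · exact key _ hC.1 hC.2.1 hC.2.2
  · intro h M hM
    by_cases h1 : M.Subsingleton
    · rcases h1.eq_empty_or_singleton with h1 | ⟨x, h1⟩
      · exact Or.inl h1
      · exact Or.inr (Or.inl ⟨x, h1⟩)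
    · right; right
      by_contra h2
      exact h M (Or.inl ⟨hM, Set.not_subsingleton_iff.1 h1, h2⟩)

/-- `M` is a module of the subtournament of `T` induced on `S` (for `M ⊆ S`). -/
def ModIn (T : Tournament V) (S M : Set V) : Prop :=
  ∀ x ∈ M, ∀ y ∈ M, ∀ v ∈ S, v ∉ M → (T.arc v x ↔ T.arc v y)

/-- The subtournament of `T` induced on `S` is indecomposable. -/
def PrimeIn (T : Tournament V) (S : Set V) : Prop :=
  ∀ M ⊆ S, T.ModIn S M → M.Subsingleton ∨ M = S

theorem modIn_dual {S M : Set V} : T.dual.ModIn S M ↔ T.ModIn S M := by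
  constructor
  · intro h x hx y hy v hv hvM
    have := h x hx y hy v hv hvM
    have hxv : v ≠ x := fun e => hvM (e ▸ hx)
    have hyv : v ≠ y := fun e => hvM (e ▸ hy)
    rw [T.arc_iff v x hxv, T.arc_iff v y hyv]
    exact not_congr this
  · intro h x hx y hy v hv hvM
    have := h x hx y hy v hv hvM
    have hxv : x ≠ v := fun e => hvM (e ▸ hx)
    have hyv : y ≠ v := fun e => hvM (e ▸ hy)
    change T.arc x v ↔ T.arc y v
    rw [T.arc_iff x v hxv, T.arc_iff y v hyv]
    exact not_congr this

theorem primeIn_dual {S : Set V} : T.dual.PrimeIn S ↔ T.PrimeIn S := by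
  constructor
  · intro h M hM hm
    exact h M hM (modIn_dual.2 hm)
  · intro h M hM hm
    exact h M hM (modIn_dual.1 hm)

/-! ### Minimal co-modules -/

/-- A co-module that contains no smaller co-module. -/
def MinComod (T : Tournament V) (C : Set V) : Prop :=
  T.Comod C ∧ ∀ D, T.Comod D → D ⊆ C → D = C

theorem minComod_dual {C : Set V} : T.dual.MinComod C ↔ T.MinComod C := by
  simp only [MinComod, comod_dual]

theorem Comod.exists_minComod [Finite V] {C : Set V} (h : T.Comod C) :
    ∃ D ⊆ C, T.MinComod D := by
  obtain ⟨D, hDC, hD⟩ := exists_minimal_le_of_wellFoundedLT T.Comod C h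
  exact ⟨D, hDC, hD.1, fun E hE hED => le_antisymm hED (hD.2 hE hED)⟩

/-- A minimal co-module contains no nontrivial module other than itself. -/
theorem MinComod.subsingleton_or_eq {C M : Set V} (hC : T.MinComod C) (hM : T.IsModule M)
    (hMC : M ⊆ C) : M.Subsingleton ∨ M = C := by
  by_cases h : M.Subsingleton
  · exact Or.inl h
  · right
    refine hC.2 M (Or.inl ⟨hM, Set.not_subsingleton_iff.1 h, ?_⟩) hMC
    rintro rfl
    exact hC.1.ne_univ (Set.univ_subset_iff.1 hMC)

theorem MinComod.primeIn {C : Set V} (hC : T.MinComod C) (hm : T.IsModule C) :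
    T.PrimeIn C := by
  intro M hMC hM
  refine hC.subsingleton_or_eq (fun x hx y hy v hv => ?_) hMC
  by_cases hvC : v ∈ C
  · exact hM x hx y hy v hvC hv
  · exact hm x (hMC hx) y (hMC hy) v hvC

/-- If a minimal co-module `C` is not a module, then its complement is one, and contracting the
complement to any of its vertices leaves an indecomposable tournament. -/
theorem MinComod.of_not_isModule {C : Set V} (hC : T.MinComod C) (hm : ¬ T.IsModule C) :
    T.IsModule Cᶜ ∧ Cᶜ.Nontrivial ∧ C.Nontrivial ∧ ∀ z ∉ C, T.PrimeIn (insert z C) := by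
  have hc : T.IsModule Cᶜ ∧ Cᶜ.Nontrivial ∧ Cᶜ ≠ Set.univ := by
    rcases hC.1 with h | h
    · exact absurd h.1 hm
    · exact h
  refine ⟨hc.1, hc.2.1, ?_, ?_⟩
  · rw [← Set.not_subsingleton_iff]
    exact fun h => hm (isModule_of_subsingleton h)
  intro z hz M hMS hM
  by_cases hzM : z ∈ M
  · by_cases hu : M ∪ Cᶜ = Set.univ
    · right
      refine Set.Subset.antisymm hMS fun w hw => ?_
      rcases hw with rfl | hw
      · exact hzM
      · have : w ∈ M ∪ Cᶜ := hu ▸ Set.mem_univ w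
        exact this.resolve_right fun h => h hw
    · left
      have hmod : T.IsModule (M ∪ Cᶜ) := by
        have key : ∀ x ∈ M ∪ Cᶜ, ∀ v, v ∉ M ∪ Cᶜ → (T.arc v x ↔ T.arc v z) := by
          intro x hx v hv
          have hvC : v ∈ C := by
            by_contra h
            exact hv (Or.inr h)
          rcases hx with hx | hx
          · exact hM x hx z hzM v (Set.mem_insert_of_mem _ hvC) fun h => hv (Or.inl h)
          · exact hc.1 x hx z hz v fun h => h hvC
        intro x hx y hy v hv
        rw [key x hx v hv, key y hy v hv]
      have h1 := hC.2 (M ∪ Cᶜ)ᶜ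
        (Comod.compl (Or.inl ⟨hmod, hc.2.1.mono Set.subset_union_right, hu⟩))
        (by rw [Set.compl_union, compl_compl]; exact Set.inter_subset_right)
      have h2 : ∀ w ∈ M, w = z := by
        intro w hw
        rcases hMS hw with h | h
        · exact h
        · rw [← h1] at h
          exact absurd (Or.inl hw) h
      exact fun a ha b hb => (h2 a ha).trans (h2 b hb).symm
  · left
    have hMC : M ⊆ C := fun w hw => (hMS hw).resolve_left fun e => hzM (e ▸ hw)
    have hmod : T.IsModule M := by
      intro x hx y hy v hv
      by_cases hvC : v ∈ C
      · exact hM x hx y hy v (Set.mem_insert_of_mem _ hvC) hv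
      · have hx' : x ∉ Cᶜ := fun h => h (hMC hx)
        have hy' : y ∉ Cᶜ := fun h => h (hMC hy)
        have h1 := hM x hx y hy z (Set.mem_insert _ _) hzM
        rw [hc.1.arc_to_iff (x := v) (y := z) hvC hz hx',
          hc.1.arc_to_iff (x := v) (y := z) hvC hz hy', h1]
    exact (hC.subsingleton_or_eq hmod hMC).resolve_right fun e => hm (e ▸ hmod)

/-- Distinct minimal co-modules that meet are two-element modules. -/
theorem MinComod.twins_of_meet {C D : Set V} (hC : T.MinComod C) (hD : T.MinComod D)
    (hne : C ≠ D) {w : V} (hwC : w ∈ C) (hwD : w ∈ D) :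
    T.IsModule C ∧ T.IsModule D ∧ (∃ a, a ≠ w ∧ C = {a, w}) ∧ ∃ a, a ≠ w ∧ D = {a, w} := by
  have hCD : ¬ C ⊆ D := fun h => hne (hD.2 C hC.1 h)
  have hDC : ¬ D ⊆ C := fun h => hne (hC.2 D hD.1 h).symm
  obtain ⟨c, hcC, hcD⟩ := Set.not_subset.1 hCD
  obtain ⟨d, hdD, hdC⟩ := Set.not_subset.1 hDC
  by_cases hmC : T.IsModule C
  · by_cases hmD : T.IsModule D
    · have key : ∀ A B : Set V, T.MinComod A → T.MinComod B → T.IsModule A → T.IsModule B →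
          ∀ a b, a ∈ A → a ∉ B → b ∈ B → b ∉ A → w ∈ A → w ∈ B → ∃ a, a ≠ w ∧ A = {a, w} := by
        intro A B hA _ hmA hmB a b haA haB hbB hbA hwA hwB
        refine ⟨a, fun e => haB (e ▸ hwB), ?_⟩
        have h1 : (A ∩ B).Subsingleton :=
          (hA.subsingleton_or_eq (hmA.inter hmB) Set.inter_subset_left).resolve_right
            fun e => haB (e.ge haA).2
        have h2 : (A \ B).Subsingleton :=
          (hA.subsingleton_or_eq (hmA.diff hmB hbB hbA) Set.sdiff_subset).resolve_right
            fun e => (e.ge hwA).2 hwB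
        refine Set.Subset.antisymm (fun x hx => ?_) ?_
        · by_cases hxB : x ∈ B
          · exact Or.inr (h1 ⟨hx, hxB⟩ ⟨hwA, hwB⟩)
          · exact Or.inl (h2 ⟨hx, hxB⟩ ⟨haA, haB⟩)
        · rintro x (rfl | rfl)
          · exact haA
          · exact hwA
      exact ⟨hmC, hmD, key C D hC hD hmC hmD c d hcC hcD hdD hdC hwC hwD,
        key D C hD hC hmD hmC d c hdD hdC hcC hcD hwD hwC⟩
    · exfalso
      obtain ⟨h1, h2, -, -⟩ := hD.of_not_isModule hmD
      have hu : T.IsModule (C ∪ Dᶜ) := hmC.union h1 hcC hcD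
      have := hD.2 (C ∪ Dᶜ)ᶜ
        (Comod.compl (Or.inl ⟨hu, h2.mono Set.subset_union_right, fun e => by
          have : d ∈ C ∪ Dᶜ := e ▸ Set.mem_univ d
          exact this.elim hdC fun h => h hdD⟩))
        (by rw [Set.compl_union, compl_compl]; exact Set.inter_subset_right)
      rw [← this] at hwD
      exact hwD (Or.inl hwC)
  · obtain ⟨h1, h2, -, -⟩ := hC.of_not_isModule hmC
    exfalso
    by_cases hmD : T.IsModule D
    · have hu : T.IsModule (D ∪ Cᶜ) := hmD.union h1 hdD hdC
      have := hC.2 (D ∪ Cᶜ)ᶜ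
        (Comod.compl (Or.inl ⟨hu, h2.mono Set.subset_union_right, fun e => by
          have : c ∈ D ∪ Cᶜ := e ▸ Set.mem_univ c
          exact this.elim hcD fun h => h hcC⟩))
        (by rw [Set.compl_union, compl_compl]; exact Set.inter_subset_right)
      rw [← this] at hwC
      exact hwC (Or.inl hwD)
    · obtain ⟨h3, h4, -, -⟩ := hD.of_not_isModule hmD
      by_cases hcov : ∃ v, v ∈ Cᶜ ∧ v ∈ Dᶜ
      · obtain ⟨v, hvC, hvD⟩ := hcov
        have hu : T.IsModule (Cᶜ ∪ Dᶜ) := h1.union h3 hvC hvD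
        have := hC.2 (Cᶜ ∪ Dᶜ)ᶜ
          (Comod.compl (Or.inl ⟨hu, h2.mono Set.subset_union_left, fun e => by
            have : w ∈ Cᶜ ∪ Dᶜ := e ▸ Set.mem_univ w
            exact this.elim (fun h => h hwC) fun h => h hwD⟩))
          (by rw [Set.compl_union, compl_compl]; exact Set.inter_subset_left)
        rw [← this] at hcC
        exact hcC (Or.inr hcD)
      · have hsub : Cᶜ ⊆ D := fun v hv => by
          by_contra h
          exact hcov ⟨v, hv, h⟩
        have := hD.2 Cᶜ hC.1.compl hsub
        rw [← this] at hwD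
        exact hwD hwC

/-- Next to a minimal co-module that is not a module, the complement of another one is never
a module. -/
theorem MinComod.not_isModule_compl {C D : Set V} (hC : T.MinComod C) (hD : T.MinComod D)
    (hne : C ≠ D) (hmD : ¬ T.IsModule D) : ¬ T.IsModule Cᶜ := by
  intro hm
  have hdisj : ∀ w ∈ C, w ∉ D := fun w h1 h2 => hmD (hC.twins_of_meet hD hne h1 h2).2.1
  obtain ⟨h1, -, -, -⟩ := hD.of_not_isModule hmD
  obtain ⟨c, hc⟩ := hC.1.nonempty
  have := hm.diff h1 (w := c) (hdisj c hc) fun h => h hc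
  have e : Cᶜ \ Dᶜ = D := by
    ext v
    simp only [Set.mem_sdiff, Set.mem_compl_iff, not_not]
    exact ⟨fun h => h.2, fun h => ⟨fun h' => hdisj v h' h, h⟩⟩
  rw [e] at this
  exact hmD this

theorem MinComod.isModule_of_ne {C D : Set V} (hC : T.MinComod C) (hD : T.MinComod D)
    (hne : C ≠ D) (hmD : ¬ T.IsModule D) : T.IsModule C ∧ C.Nontrivial := by
  have h := hC.not_isModule_compl hD hne hmD
  rcases hC.1 with h' | h'
  · exact ⟨h'.1, h'.2.1⟩
  · exact absurd h'.1 h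

/-- `s` is a source of `T`. -/
def IsSource (T : Tournament V) (s : V) : Prop := ∀ v, v ≠ s → T.arc s v

/-- A co-module with a single vertex is a source or a sink. -/
theorem Comod.source_or_sink {s : V} (h : T.Comod {s}) : T.IsSource s ∨ T.dual.IsSource s := by
  have hm : T.IsModule {s}ᶜ ∧ ({s}ᶜ : Set V).Nontrivial := by
    rcases h with h | h
    · exact absurd h.2.1 Set.not_nontrivial_singleton
    · exact ⟨h.1, h.2.1⟩
  obtain ⟨w, hw⟩ := hm.2.nonempty
  by_cases hs : T.arc s w
  · exact Or.inl fun v hv => (hm.1 v hv w hw s fun h => h rfl).2 hs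
  · exact Or.inr fun v hv => arc_of_not_arc (T := T) (Ne.symm hv)
      fun h => hs ((hm.1 v hv w hw s fun h => h rfl).1 h)

theorem IsSource.unique {s t : V} (hs : T.IsSource s) (ht : T.IsSource t) : s = t := by
  by_contra h
  exact not_arc_of_arc (hs t (Ne.symm h)) (ht s h)

/-- A proper nonempty set all of whose vertices dominate the remaining ones is a co-module. -/
theorem comod_of_dominates [Finite V] (hV : 3 ≤ Nat.card V) {A : Set V} (hA : A.Nonempty)
    (hA' : A ≠ Set.univ) (h : ∀ a ∈ A, ∀ v, v ∉ A → T.arc a v) : T.Comod A := by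
  by_cases hn : A.Nontrivial
  · left
    refine ⟨fun x hx y hy v hv => ?_, hn, hA'⟩
    exact iff_of_false (not_arc_of_arc (h x hx v hv)) (not_arc_of_arc (h y hy v hv))
  · right
    obtain ⟨a, rfl⟩ := Set.not_nontrivial_iff.1 hn |>.eq_empty_or_singleton.resolve_left
      hA.ne_empty
    refine ⟨fun x hx y hy v hv => ?_, ?_, ?_⟩
    · have : v = a := by simpa using hv
      subst this
      exact iff_of_true (h v rfl x hx) (h v rfl y hy)
    · rw [← Set.one_lt_ncard_iff_nontrivial]
      have := Set.ncard_add_ncard_compl ({a} : Set V)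
      rw [Set.ncard_singleton] at this
      omega
    · intro e
      have : a ∈ ({a} : Set V)ᶜ := e ▸ Set.mem_univ a
      exact this rfl

/-! ### Reversing one arc -/

/-- The tournament obtained by reversing the arc between `x` and `y`, whichever its direction. -/
def flip (T : Tournament V) (x y : V) : Tournament V where
  arc a b := (((a = x ∧ b = y) ∨ (a = y ∧ b = x)) ∧ T.arc b a) ∨
    (¬ ((a = x ∧ b = y) ∨ (a = y ∧ b = x)) ∧ T.arc a b)
  irrefl a h := by
    rcases h with h | h
    · exact T.irrefl a h.2
    · exact T.irrefl a h.2
  arc_iff a b h := by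
    have := T.arc_iff a b h
    tauto

theorem flip_comm (x y : V) : T.flip x y = T.flip y x := by
  ext a b
  simp only [flip]
  tauto

theorem flip_arc_of_ne {x y a b : V} (h : a ≠ x ∧ b ≠ x ∨ a ≠ y ∧ b ≠ y) :
    (T.flip x y).arc a b ↔ T.arc a b := by
  simp only [flip]
  tauto

theorem flip_arc_of_ne_left {x y a b : V} (hx : a ≠ x) (hy : a ≠ y) :
    (T.flip x y).arc a b ↔ T.arc a b := by
  simp only [flip]
  tauto

theorem flip_arc_of_ne_right {x y a b : V} (hx : b ≠ x) (hy : b ≠ y) :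
    (T.flip x y).arc a b ↔ T.arc a b := by
  simp only [flip]
  tauto

theorem flip_arc_right {x y : V} : (T.flip x y).arc y x ↔ T.arc x y := by
  simp only [flip]
  tauto

/-- Reversing the arc between `x` and `y` creates a nontrivial module that contains `x` but not
`y`. The set `N` is that module without `x`, and the condition is expressed in `T`. -/
def Bad (T : Tournament V) (x y : V) : Prop :=
  ∃ N : Set V, N.Nonempty ∧ x ∉ N ∧ y ∉ N ∧
    (∀ v, v ∉ N → v ≠ x → v ≠ y → ∀ n ∈ N, (T.arc v n ↔ T.arc v x)) ∧
    ∀ n ∈ N, (T.arc y n ↔ T.arc x y)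

theorem bad_of_isModule_flip {x y : V} {M : Set V} (hM : (T.flip x y).IsModule M)
    (hn : M.Nontrivial) (hx : x ∈ M) (hy : y ∉ M) : T.Bad x y := by
  obtain ⟨m, hm, hmx⟩ := hn.exists_ne x
  refine ⟨M \ {x}, ⟨m, hm, hmx⟩, fun h => h.2 rfl, fun h => hy h.1, ?_, ?_⟩
  · intro v hv hvx hvy n hn
    have := hM n hn.1 x hx v fun h => hv ⟨h, hvx⟩
    rwa [flip_arc_of_ne_left hvx hvy, flip_arc_of_ne_left hvx hvy] at this
  · intro n hn
    have := hM n hn.1 x hx y hy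
    have hyx : y ≠ x := fun e => hy (e ▸ hx)
    rwa [flip_arc_right, flip_arc_of_ne (Or.inl ⟨hyx, hn.2⟩)] at this

theorem isModule_of_isModule_flip {x y : V} {M : Set V} (hM : (T.flip x y).IsModule M)
    (h : x ∈ M ↔ y ∈ M) : T.IsModule M := by
  intro a ha b hb v hv
  have := hM a ha b hb v hv
  by_cases hx : x ∈ M
  · have hvx : v ≠ x := fun e => hv (e ▸ hx)
    have hvy : v ≠ y := fun e => hv (e ▸ h.1 hx)
    rwa [flip_arc_of_ne_left hvx hvy, flip_arc_of_ne_left hvx hvy] at this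
  · have hc : ∀ c ∈ M, c ≠ x ∧ c ≠ y := fun c hc =>
      ⟨fun e => hx (e ▸ hc), fun e => hx (h.2 (e ▸ hc))⟩
    rwa [flip_arc_of_ne_right (hc a ha).1 (hc a ha).2,
      flip_arc_of_ne_right (hc b hb).1 (hc b hb).2] at this

theorem bad_dual {x y : V} (hxy : x ≠ y) (h : T.Bad x y) : T.dual.Bad x y := by
  obtain ⟨N, h1, hx, hy, h2, h3⟩ := h
  refine ⟨N, h1, hx, hy, fun v hv hvx hvy n hn => ?_, fun n hn => ?_⟩
  · have hvn : n ≠ v := fun e => hv (e ▸ hn)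
    change T.arc n v ↔ T.arc x v
    rw [T.arc_iff n v hvn, T.arc_iff x v hvx.symm, h2 v hv hvx hvy n hn]
  · have hny : n ≠ y := fun e => hy (e ▸ hn)
    change T.arc n y ↔ T.arc y x
    rw [T.arc_iff n y hny, T.arc_iff y x hxy.symm, h3 n hn]

/-- If reversing the arc between `x` and `y` creates no module, then the co-modules that remain
are the co-modules of `T` that do not separate `x` from `y`. -/
theorem comod_of_comod_flip {x y : V} (hxy : ¬ T.Bad x y) (hyx : ¬ T.Bad y x) {C : Set V}
    (hC : (T.flip x y).Comod C) : T.Comod C ∧ (x ∈ C ↔ y ∈ C) := by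
  have key : ∀ M, (T.flip x y).IsModule M → M.Nontrivial → T.IsModule M ∧ (x ∈ M ↔ y ∈ M) := by
    intro M hM hn
    have : x ∈ M ↔ y ∈ M := by
      by_contra h
      by_cases hx : x ∈ M
      · exact hxy (bad_of_isModule_flip hM hn hx fun hy => h (iff_of_true hx hy))
      · have hy : y ∈ M := by tauto
        rw [flip_comm] at hM
        exact hyx (bad_of_isModule_flip hM hn hy hx)
    exact ⟨isModule_of_isModule_flip hM this, this⟩
  rcases hC with ⟨h1, h2, h3⟩ | ⟨h1, h2, h3⟩
  · exact ⟨Or.inl ⟨(key _ h1 h2).1, h2, h3⟩, (key _ h1 h2).2⟩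
  · exact ⟨Or.inr ⟨(key _ h1 h2).1, h2, h3⟩, not_iff_not.1 (key _ h1 h2).2⟩

/-- Let `X`, `Y` be disjoint minimal modules, `x ∈ X`, `y ∈ Y`, and let `x → y`. If reversing
this arc creates a module containing `x` but not `y`, then `X = {x', x}` with `x' → x`, and
`X ∪ Y` is a module. -/
theorem Bad.of_disjoint_modules {X Y : Set V} (hX : T.IsModule X) (hY : T.IsModule Y)
    (hXn : X.Nontrivial) (hYn : Y.Nontrivial) (hXp : T.PrimeIn X) (hd : Disjoint X Y)
    {x y : V} (hx : x ∈ X) (hy : y ∈ Y) (hxy : T.arc x y) (hbad : T.Bad x y) :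
    ∃ x', x' ≠ x ∧ X = {x', x} ∧ T.arc x' x ∧ T.IsModule (X ∪ Y) := by
  obtain ⟨N, ⟨n, hn⟩, hxN, hyN, h1, h2⟩ := hbad
  have hdXY : ∀ v ∈ X, v ∉ Y := fun v h h' => Set.disjoint_left.1 hd h h'
  have hdYX : ∀ v ∈ Y, v ∉ X := fun v h h' => Set.disjoint_left.1 hd h' h
  -- every arc between `X` and `Y` goes from `X` to `Y`
  have hXY : ∀ a ∈ X, ∀ b ∈ Y, T.arc a b := by
    intro a ha b hb
    rw [hX.arc_to_iff ha hx (hdYX b hb)]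
    exact (hY b hb y hy x (hdXY x hx)).2 hxy
  have hyn : ∀ n ∈ N, T.arc y n := fun n hn => (h2 n hn).2 hxy
  obtain ⟨x', hx', hx'x⟩ := hXn.exists_ne x
  have hmod : T.ModIn X ((N ∪ {x}) ∩ X) := by
    have key : ∀ a ∈ (N ∪ {x}) ∩ X, ∀ v ∈ X, v ∉ (N ∪ {x}) ∩ X → (T.arc v a ↔ T.arc v x) := by
      rintro a ⟨ha | ha, haX⟩ v hvX hv
      · exact h1 v (fun h => hv ⟨Or.inl h, hvX⟩) (fun h => hv ⟨Or.inr h, hvX⟩)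
          (fun h => hdXY v hvX (h ▸ hy)) a ha
      · rw [show a = x from ha]
    intro a ha b hb v hvX hv
    rw [key a ha v hvX hv, key b hb v hvX hv]
  have hXN : ∀ a ∈ X, a ∉ N := by
    rcases hXp _ Set.inter_subset_right hmod with h | h
    · intro a ha haN
      have := h ⟨Or.inl haN, ha⟩ ⟨Or.inr rfl, hx⟩
      exact hxN (this ▸ haN)
    · exfalso
      have : x' ∈ (N ∪ {x}) ∩ X := h.ge hx'
      have hx'N := this.1.resolve_right hx'x
      exact not_arc_of_arc (hXY x' hx' y hy) (hyn x' hx'N)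
  -- all vertices of `X` other than `x` see `x` as they see `n`
  have hX2 : X = {x', x} := by
    have : (X \ {x}).Subsingleton := by
      refine (hXp (X \ {x}) Set.sdiff_subset ?_).resolve_right fun e => (e.ge hx).2 rfl
      have key : ∀ a ∈ X \ {x}, T.arc a x ↔ T.arc a n := fun a ha =>
        (h1 a (hXN a ha.1) ha.2 (fun h => hdXY a ha.1 (h ▸ hy)) n hn).symm
      intro a ha b hb v hvX hv
      have hvx : v = x := by
        by_contra h
        exact hv ⟨hvX, h⟩
      subst hvx
      rw [T.arc_iff v a (Ne.symm ha.2), T.arc_iff v b (Ne.symm hb.2), key a ha, key b hb,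
        hX.arc_to_iff ha.1 hb.1 fun h => hXN n h hn]
    ext a
    constructor
    · intro ha
      by_cases hax : a = x
      · exact Or.inr hax
      · exact Or.inl (this ⟨ha, hax⟩ ⟨hx', hx'x⟩)
    · rintro (rfl | rfl)
      · exact hx'
      · exact hx
  have hNY : ∃ w ∈ N, w ∈ Y := by
    by_contra hcon
    obtain ⟨z, hz, hzy⟩ := hYn.exists_ne y
    have hzN : z ∉ N := fun h => hcon ⟨z, h, hz⟩
    have hzn : T.arc z n := hY.arc_to_iff hz hy (fun h => hcon ⟨n, hn, h⟩) |>.2 (hyn n hn)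
    exact not_arc_of_arc (hXY x hx z hz)
      ((h1 z hzN (fun h => hdXY x hx (h ▸ hz)) hzy n hn).1 hzn)
  obtain ⟨w, hwN, hwY⟩ := hNY
  have hx'N : ∀ m ∈ N, (T.arc x' m ↔ T.arc x' x) := fun m hm =>
    h1 x' (hXN x' hx') hx'x (fun h => hdXY x' hx' (h ▸ hy)) m hm
  have harc : T.arc x' x := (hx'N w hwN).1 (hXY x' hx' w hwY)
  refine ⟨x', hx'x, hX2, harc, ?_⟩
  have key : ∀ a ∈ X ∪ Y, ∀ v, v ∉ X ∪ Y → (T.arc v a ↔ T.arc v x) := by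
    intro a ha v hv
    have hvX : v ∉ X := fun h => hv (Or.inl h)
    have hvY : v ∉ Y := fun h => hv (Or.inr h)
    rcases ha with ha | ha
    · exact hX a ha x hx v hvX
    · by_cases hvN : v ∈ N
      · have e1 := not_arc_of_arc ((hx'N v hvN).2 harc)
        rw [hX x' hx' x hx v hvX] at e1
        have e2 := not_arc_of_arc (hyn v hvN)
        rw [hY y hy a ha v hvY] at e2
        exact iff_of_false e2 e1
      · rw [hY a ha w hwY v hvY]
        exact h1 v hvN (fun h => hvX (h ▸ hx)) (fun h => hvY (h ▸ hy)) w hwN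
  intro a ha b hb v hv
  rw [key a ha v hv, key b hb v hv]

/-- The same for two minimal co-modules that are modules, whatever the direction of the arc. -/
theorem Bad.of_modules {X Y : Set V} (hX : T.MinComod X) (hY : T.MinComod Y)
    (hXm : T.IsModule X) (hYm : T.IsModule Y)
    (hXn : X.Nontrivial) (hYn : Y.Nontrivial)
    {x y : V} (hx : x ∈ X) (hy : y ∈ Y) (hxY : x ∉ Y) (hyX : y ∉ X) (hbad : T.Bad x y) :
    Disjoint X Y ∧
    ∃ x', x' ≠ x ∧ X = {x', x} ∧ (T.arc x' x ↔ T.arc x y) ∧ T.IsModule (X ∪ Y) := by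
  have hne : x ≠ y := fun e => hxY (e ▸ hy)
  have hd : Disjoint X Y := by
    rw [Set.disjoint_left]
    intro z hzX hzY
    obtain ⟨-, -, ⟨a, haz, hXe⟩, ⟨b, hbz, hYe⟩⟩ :=
      hX.twins_of_meet hY (fun e => hxY (e ▸ hx)) hzX hzY
    have hxz : x ≠ z := fun e => hxY (e ▸ hzY)
    have hyz : y ≠ z := fun e => hyX (e ▸ hzX)
    -- here `X = {x, z}`, `Y = {y, z}`, and `x`, `z`, `y` are consecutive
    have e1 : T.arc y x ↔ T.arc y z := hXm x hx z hzX y hyX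
    have e2 : T.arc x y ↔ T.arc x z := hYm y hy z hzY x hxY
    obtain ⟨N, ⟨n, hn⟩, hxN, hyN, h1, h2⟩ := hbad
    have a1 := T.arc_iff x y hne
    have a2 := T.arc_iff x z hxz
    by_cases hz : z ∈ N
    · have := h2 z hz
      rw [a1, e1] at this
      exact iff_not_self this
    · have b1 := h1 z hz hxz.symm hyz.symm n hn
      have b2 := h2 n hn
      have hnY : n ∉ Y := by
        intro h
        rw [hYe] at h hy
        rcases h with rfl | rfl
        · rcases hy with rfl | rfl
          · exact hyN hn
          · exact hyz rfl
        · exact hz hn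
      have b3 := hYm.arc_to_iff hy hzY hnY
      exact iff_not_self (b1.symm.trans (b3.symm.trans (b2.trans (e2.trans a2))))
  refine ⟨hd, ?_⟩
  by_cases hxy : T.arc x y
  · obtain ⟨x', h1, h2, h3, h4⟩ :=
      Bad.of_disjoint_modules hXm hYm hXn hYn (hX.primeIn hXm) hd hx hy hxy hbad
    exact ⟨x', h1, h2, iff_of_true h3 hxy, h4⟩
  · have hyx : T.dual.arc x y := arc_of_not_arc (T := T) hne hxy
    obtain ⟨x', h1, h2, h3, h4⟩ :=
      Bad.of_disjoint_modules (T := T.dual) (isModule_dual.2 hXm) (isModule_dual.2 hYm) hXn hYn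
        (primeIn_dual.2 (hX.primeIn hXm)) hd hx hy hyx (bad_dual hne hbad)
    exact ⟨x', h1, h2, iff_of_false (not_arc_of_arc h3) hxy, isModule_dual.1 h4⟩

/-- Reversing an arc at a source `s` creates no module that avoids `s`. -/
theorem IsSource.not_bad_right {s : V} (hs : T.IsSource s) (y : V) (hys : y ≠ s) :
    ¬ T.Bad y s := by
  rintro ⟨N, ⟨n, hn⟩, -, hsN, -, h2⟩
  exact not_arc_of_arc (hs y hys) ((h2 n hn).1 (hs n fun e => hsN (e ▸ hn)))

/-- If reversing an arc from a source `s` to a module `Y` creates a module that contains `s` but not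
the end in `Y`, then the vertices of `Y` dominate all vertices other than `s`. -/
theorem IsSource.bad_module {s : V} (hs : T.IsSource s) {Y : Set V} (hY : T.IsModule Y)
    (hYn : Y.Nontrivial) (hsY : s ∉ Y) {y : V} (hy : y ∈ Y) (hbad : T.Bad s y) :
    ∀ a ∈ Y, ∀ r, r ∉ Y → r ≠ s → T.arc a r := by
  have hys : y ≠ s := fun e => hsY (e ▸ hy)
  intro a ha r hr hrs
  rw [hY.arc_to_iff ha hy hr]
  obtain ⟨N, ⟨n, hn⟩, hsN, hyN, h1, h2⟩ := hbad
  have hry : r ≠ y := fun e => hr (e ▸ hy)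
  by_contra hcon
  have hrN : r ∉ N := fun h => hcon ((h2 r h).2 (hs y hys))
  have hout : ∀ n ∈ N, ∀ v, v ∉ N → v ≠ s → v ≠ y → T.arc n v := fun n hn v hv hvs hvy =>
    arc_of_not_arc (fun e => hv (e ▸ hn))
      fun h => not_arc_of_arc (hs v hvs) ((h1 v hv hvs hvy n hn).1 h)
  have hnY : ∀ n ∈ N, n ∉ Y := fun n hn h =>
    hcon ((hY.arc_to_iff hy h hr).2 (hout n hn r hrN hrs hry))
  obtain ⟨z, hz, hzy⟩ := hYn.exists_ne y
  have := hout n hn z (fun h => hnY z h hz) (fun e => hsY (e ▸ hz)) hzy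
  rw [hY z hz y hy n (hnY n hn)] at this
  exact not_arc_of_arc ((h2 n hn).2 (hs y hys)) this

/-! ### Arcs that enter a minimal co-module which is not a module -/

/-- `x` is a source or a sink of the subtournament induced on `Z`. -/
def IsExtremal (T : Tournament V) (Z : Set V) (x : V) : Prop :=
  (∀ z ∈ Z, z ≠ x → T.arc x z) ∨ ∀ z ∈ Z, z ≠ x → T.arc z x

/-- `Y` is a set whose complement is a nontrivial module and such that contracting the complement
to any of its vertices leaves an indecomposable tournament. -/
structure IsPrimeCore (T : Tournament V) (Y : Set V) : Prop where
  isModule_compl : T.IsModule Yᶜ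
  compl_nontrivial : Yᶜ.Nontrivial
  nontrivial : Y.Nontrivial
  primeIn_insert : ∀ z ∉ Y, T.PrimeIn (insert z Y)

theorem MinComod.isPrimeCore {Y : Set V} (h : T.MinComod Y) (hm : ¬ T.IsModule Y) :
    T.IsPrimeCore Y := by
  obtain ⟨h1, h2, h3, h4⟩ := h.of_not_isModule hm
  exact ⟨h1, h2, h3, h4⟩

theorem IsPrimeCore.dual {Y : Set V} (h : T.IsPrimeCore Y) : T.dual.IsPrimeCore Y :=
  ⟨isModule_dual.2 h.1, h.2, h.3, fun z hz => primeIn_dual.2 (h.4 z hz)⟩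

/-- A module created by reversing an arc `y x`, with `y ∈ Y`, `x ∉ Y`, that contains `y` but not
`x`, contains all vertices but `x`. -/
theorem IsPrimeCore.bad_left {Y : Set V} (hY : T.IsPrimeCore Y) {x y : V} (hx : x ∉ Y)
    (hy : y ∈ Y) (hbad : T.Bad y x) : ∀ v, v ≠ x → v ≠ y → (T.arc x v ↔ T.arc y x) := by
  obtain ⟨N, ⟨n, hn⟩, hyN, hxN, h1, h2⟩ := hbad
  have hdich : ∀ z, z ∉ Y → z ≠ x → (∀ v ∈ insert z Y, v ∈ N → v = y) ∨
      (∀ v ∈ insert z Y, v ≠ y → v ∈ N) := by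
    intro z hz hzx
    have hxS : x ∉ insert z Y := fun h => h.elim (fun e => hzx e.symm) hx
    have hmod : T.ModIn (insert z Y) (insert y N ∩ insert z Y) := by
      have key : ∀ a ∈ insert y N ∩ insert z Y, ∀ v ∈ insert z Y,
          v ∉ insert y N ∩ insert z Y → (T.arc v a ↔ T.arc v y) := by
        rintro a ⟨rfl | ha, haS⟩ v hvS hv
        · rfl
        · exact h1 v (fun h => hv ⟨Or.inr h, hvS⟩) (fun h => hv ⟨Or.inl h, hvS⟩)
            (fun h => hxS (h ▸ hvS)) a ha
      intro a ha b hb v hvS hv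
      rw [key a ha v hvS hv, key b hb v hvS hv]
    rcases hY.primeIn_insert z hz _ Set.inter_subset_right hmod with h | h
    · exact Or.inl fun v hv hvN => h ⟨Or.inr hvN, hv⟩ ⟨Or.inl rfl, Or.inr hy⟩
    · exact Or.inr fun v hv hvy => (h.ge hv).1.resolve_left hvy
  obtain ⟨y₂, hy₂, hy₂y⟩ := hY.nontrivial.exists_ne y
  have hall : ∀ v, v ≠ x → v ≠ y → v ∈ N := by
    have hnx : n ≠ x := fun e => hxN (e ▸ hn)
    have hny : n ≠ y := fun e => hyN (e ▸ hn)
    have hy₂N : y₂ ∈ N := by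
      by_cases hnY : n ∈ Y
      · obtain ⟨z, hz, hzx⟩ := hY.compl_nontrivial.exists_ne x
        rcases hdich z hz hzx with h | h
        · exact absurd (h n (Or.inr hnY) hn) hny
        · exact h y₂ (Or.inr hy₂) hy₂y
      · rcases hdich n hnY hnx with h | h
        · exact absurd (h n (Or.inl rfl) hn) hny
        · exact h y₂ (Or.inr hy₂) hy₂y
    intro v hvx hvy
    by_cases hvY : v ∈ Y
    · obtain ⟨z, hz, hzx⟩ := hY.compl_nontrivial.exists_ne x
      exact ((hdich z hz hzx).resolve_left fun h => hy₂y (h y₂ (Or.inr hy₂) hy₂N)) v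
        (Or.inr hvY) hvy
    · exact ((hdich v hvY hvx).resolve_left fun h => hy₂y (h y₂ (Or.inr hy₂) hy₂N)) v
        (Or.inl rfl) hvy
  exact fun v hvx hvy => h2 v (hall v hvx hvy)

/-- A module created by reversing an arc `x y`, with `y ∈ Y`, `x ∉ Y`, that contains `x` but not
`y`, is a pair `{x, u}` with `u ∈ Y`. -/
theorem IsPrimeCore.bad_right {Y : Set V} (hY : T.IsPrimeCore Y) {x y : V} (hx : x ∉ Y)
    (hy : y ∈ Y) (hbad : T.Bad x y) : ∃ u ∈ Y, u ≠ y ∧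
      (∀ v, v ≠ u → v ≠ x → v ≠ y → (T.arc v u ↔ T.arc v x)) ∧ (T.arc y u ↔ T.arc x y) := by
  obtain ⟨N, ⟨n, hn⟩, hxN, hyN, h1, h2⟩ := hbad
  have hsub : ∀ z, z ∉ Y → z ≠ x → (N ∩ insert z Y).Subsingleton := by
    intro z hz hzx
    have hxS : x ∉ insert z Y := fun h => h.elim (fun e => hzx e.symm) hx
    refine (hY.primeIn_insert z hz _ Set.inter_subset_right ?_).resolve_right
      fun h => hyN (h.ge (Or.inr hy)).1
    intro a ha b hb v hvS hv
    by_cases hvy : v = y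
    · subst hvy
      rw [h2 a ha.1, h2 b hb.1]
    · have hvN : v ∉ N := fun h => hv ⟨h, hvS⟩
      have hvx : v ≠ x := fun e => hxS (e ▸ hvS)
      rw [h1 v hvN hvx hvy a ha.1, h1 v hvN hvx hvy b hb.1]
  have hxy : x ≠ y := fun e => hx (e ▸ hy)
  have hu : ∃ u ∈ N, u ∈ Y := by
    by_contra hcon
    have hnY : n ∉ Y := fun h => hcon ⟨n, hn, h⟩
    have := hY.isModule_compl n hnY x hx y fun h => h hy
    rw [h2 n hn, T.arc_iff y x hxy.symm] at this
    exact iff_not_self this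
  obtain ⟨u, huN, huY⟩ := hu
  refine ⟨u, huY, fun e => hyN (e ▸ huN), fun v hvu hvx hvy => ?_, h2 u huN⟩
  refine h1 v (fun hvN => hvu ?_) hvx hvy u huN
  by_cases hvY : v ∈ Y
  · obtain ⟨z, hz, hzx⟩ := hY.compl_nontrivial.exists_ne x
    exact hsub z hz hzx ⟨hvN, Or.inr hvY⟩ ⟨huN, Or.inr huY⟩
  · exact hsub v hvY hvx ⟨hvN, Or.inl rfl⟩ ⟨huN, Or.inr huY⟩

theorem IsPrimeCore.isExtremal_of_bad {Y : Set V} (hY : T.IsPrimeCore Y) {x y : V} (hx : x ∉ Y)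
    (hy : y ∈ Y) (hbad : T.Bad x y ∨ T.Bad y x) : T.IsExtremal Yᶜ x := by
  have hzy : ∀ z ∈ Yᶜ, z ≠ y := fun z hz e => hz (e ▸ hy)
  rcases hbad with hbad | hbad
  · obtain ⟨u, huY, -, h1, -⟩ := hY.bad_right hx hy hbad
    have hxu : x ≠ u := fun e => hx (e ▸ huY)
    have key : ∀ z ∈ Yᶜ, z ≠ x → (T.arc z x ↔ T.arc x u) := by
      intro z hz hzx
      rw [← h1 z (fun e => hz (e ▸ huY)) hzx (hzy z hz)]
      exact hY.isModule_compl.arc_to_iff hz hx fun h => h huY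
    by_cases h : T.arc x u
    · exact Or.inr fun z hz hzx => (key z hz hzx).2 h
    · exact Or.inl fun z hz hzx => arc_of_not_arc hzx fun h' => h ((key z hz hzx).1 h')
  · have h1 := hY.bad_left hx hy hbad
    by_cases h : T.arc y x
    · exact Or.inl fun z hz hzx => (h1 z hzx (hzy z hz)).2 h
    · exact Or.inr fun z hz hzx => arc_of_not_arc hzx.symm
        fun h' => h ((h1 z hzx (hzy z hz)).1 h')

theorem IsPrimeCore.exists_not_bad_of_arc [Finite V] {Y : Set V} (hY : T.IsPrimeCore Y)
    {x x' : V} (hYc : Yᶜ = {x, x'}) (hxx' : T.arc x x') (hcard : 3 ≤ Y.ncard) :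
    ∃ y ∈ Y, ¬ T.Bad x y ∧ ¬ T.Bad y x := by
  have hx : x ∉ Y := by
    have : x ∈ Yᶜ := by rw [hYc]; exact Or.inl rfl
    exact this
  have hx' : x' ∉ Y := by
    have : x' ∈ Yᶜ := by rw [hYc]; exact Or.inr rfl
    exact this
  have hne := ne_of_arc hxx'
  have hnx : ∀ y ∈ Y, y ≠ x := fun y hy e => hx (e ▸ hy)
  have hnx' : ∀ y ∈ Y, y ≠ x' := fun y hy e => hx' (e ▸ hy)
  have hmod : ∀ y ∈ Y, (T.arc y x ↔ T.arc y x') := fun y hy =>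
    hY.isModule_compl x hx x' hx' y fun h => h hy
  by_contra! hcon
  -- if `y x` is bad then `y` is the only vertex of `Y` that dominates `x`
  have hl : ∀ y ∈ Y, T.Bad y x → ∀ u ∈ Y, T.arc u x → u = y := by
    intro y hy hb u hu hux
    have h1 := hY.bad_left hx hy hb
    by_contra huy
    have h2 := (h1 x' hne.symm (hnx' y hy).symm).1 hxx'
    exact not_arc_of_arc hux ((h1 u (hnx u hu) huy).2 h2)
  have hr : ∀ y ∈ Y, T.Bad x y → ∃ u ∈ Y, u ≠ y ∧ T.arc u x ∧
      (∀ v ∈ Y, v ≠ u → v ≠ y → (T.arc v u ↔ T.arc v x)) ∧ (T.arc y u ↔ T.arc x y) := by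
    intro y hy hb
    obtain ⟨u, hu, huy, h1, h2⟩ := hY.bad_right hx hy hb
    refine ⟨u, hu, huy, ?_, fun v hv hvu hvy => h1 v hvu (hnx v hv) hvy, h2⟩
    rw [hmod u hu]
    refine arc_of_not_arc (hnx' u hu).symm fun h => ?_
    exact not_arc_of_arc hxx' ((h1 x' (hnx' u hu).symm hne.symm (hnx' y hy).symm).1 h)
  -- distinct vertices `y` have distinct partners `u`
  have hinj : ∀ u y₁ y₂, y₁ ∈ Y → y₁ ≠ u → y₁ ≠ y₂ → (T.arc y₁ u ↔ T.arc x y₁) →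
      (∀ v ∈ Y, v ≠ u → v ≠ y₂ → (T.arc v u ↔ T.arc v x)) → False := by
    intro u y₁ y₂ hy₁ hu₁ h12 h1 h2
    have := h2 y₁ hy₁ hu₁ h12
    rw [h1, T.arc_iff y₁ x (hnx y₁ hy₁)] at this
    exact iff_not_self this
  by_cases hex : ∃ y₀ ∈ Y, T.Bad y₀ x
  · obtain ⟨y₀, hy₀, hb⟩ := hex
    have hu := hl y₀ hy₀ hb
    have hbr : ∀ y ∈ Y, y ≠ y₀ →
        (∀ v ∈ Y, v ≠ y₀ → v ≠ y → (T.arc v y₀ ↔ T.arc v x)) ∧ (T.arc y y₀ ↔ T.arc x y) := by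
      intro y hy hyy₀
      have hb' : T.Bad x y := by
        by_contra h
        have h1 := hcon y hy h
        have h2 := hY.bad_left hx hy h1
        exact hyy₀ (hu y hy ((h2 x' hne.symm (hnx' y hy).symm).1 hxx'))
      obtain ⟨u, huY, huy, hux, h1, h2⟩ := hr y hy hb'
      obtain rfl := hu u huY hux
      exact ⟨h1, h2⟩
    obtain ⟨y₁, hy₁, hy₁₀⟩ : ∃ y ∈ Y, y ≠ y₀ := hY.nontrivial.exists_ne y₀
    obtain ⟨y₂, hy₂, hy₂'⟩ := Set.exists_mem_notMem_of_ncard_lt_ncard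
      (s := {y₀, y₁}) (t := Y) (lt_of_le_of_lt (Set.ncard_insert_le _ _) (by
        rw [Set.ncard_singleton]; omega))
    have hy₂₀ : y₂ ≠ y₀ := fun e => hy₂' (Or.inl e)
    have hy₂₁ : y₂ ≠ y₁ := fun e => hy₂' (Or.inr e)
    exact hinj y₀ y₁ y₂ hy₁ hy₁₀ hy₂₁.symm (hbr y₁ hy₁ hy₁₀).2 (hbr y₂ hy₂ hy₂₀).1
  · have hall : ∀ y : Y, T.Bad x y := fun y => by
      by_contra h
      exact hex ⟨y, y.2, hcon y y.2 h⟩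
    choose f hfY hfy hfx hf1 hf2 using fun y : Y => hr y y.2 (hall y)
    have hfinj : Function.Injective fun y : Y => (⟨f y, hfY y⟩ : Y) := by
      intro y₁ y₂ he
      have he' : f y₁ = f y₂ := congrArg Subtype.val he
      by_contra hne'
      have h3 : (y₁ : V) ≠ y₂ := fun e => hne' (Subtype.ext e)
      exact hinj (f y₁) y₁ y₂ y₁.2 (hfy y₁).symm h3 (hf2 y₁) (he' ▸ hf1 y₂)
    have hsurj := Finite.injective_iff_surjective.1 hfinj
    have hdom : ∀ u ∈ Y, T.arc u x' := by
      intro u hu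
      obtain ⟨y, hy⟩ := hsurj ⟨u, hu⟩
      have : f y = u := congrArg Subtype.val hy
      exact (hmod u hu).1 (this ▸ hfx y)
    rcases hY.primeIn_insert x' hx' Y (Set.subset_insert _ _) (fun a ha b hb v hv hvY => by
      obtain rfl := hv.resolve_right hvY
      exact iff_of_false (not_arc_of_arc (hdom a ha)) (not_arc_of_arc (hdom b hb))) with h | h
    · exact Set.not_nontrivial_iff.2 h hY.nontrivial
    · exact hx' (h.ge (Or.inl rfl))

theorem bad_dual_iff {x y : V} (hxy : x ≠ y) : T.dual.Bad x y ↔ T.Bad x y :=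
  ⟨bad_dual (T := T.dual) hxy, bad_dual hxy⟩

theorem IsPrimeCore.exists_not_bad [Finite V] {Y : Set V} (hY : T.IsPrimeCore Y)
    {x x' : V} (hne : x ≠ x') (hYc : Yᶜ = {x, x'}) (hcard : 3 ≤ Y.ncard) :
    ∃ y ∈ Y, ¬ T.Bad x y ∧ ¬ T.Bad y x := by
  by_cases h : T.arc x x'
  · exact hY.exists_not_bad_of_arc hYc h hcard
  · obtain ⟨y, hy, h1, h2⟩ := hY.dual.exists_not_bad_of_arc hYc
      (arc_of_not_arc (T := T) hne h) hcard
    have hx : x ∈ Yᶜ := by rw [hYc]; exact Or.inl rfl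
    have hxy : x ≠ y := fun e => hx (e ▸ hy)
    exact ⟨y, hy, fun h => h1 ((bad_dual_iff hxy).2 h), fun h => h2 ((bad_dual_iff hxy.symm).2 h)⟩

/-- If deleting a source `s` leaves an indecomposable tournament with at least four vertices, then
some arc at `s` can be reversed without creating a module. -/
theorem IsSource.exists_not_bad [Finite V] {s : V} (hs : T.IsSource s)
    (hp : T.PrimeIn {s}ᶜ) (hcard : 5 ≤ Nat.card V) : ∃ y, y ≠ s ∧ ¬ T.Bad s y := by
  by_contra! hcon
  have key : ∀ y, y ≠ s → ∃ w, w ≠ s ∧ w ≠ y ∧ T.arc y w ∧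
      ∀ v, v ≠ w → v ≠ s → v ≠ y → T.arc w v := by
    intro y hys
    obtain ⟨N, ⟨w, hw⟩, hsN, hyN, h1, h2⟩ := hcon y hys
    have hout : ∀ v, v ∉ N → v ≠ s → v ≠ y → ∀ n ∈ N, ¬ T.arc v n := fun v hv hvs hvy n hn h =>
      not_arc_of_arc (hs v hvs) ((h1 v hv hvs hvy n hn).1 h)
    have hyN' : ∀ n ∈ N, T.arc y n := fun n hn => (h2 n hn).2 (hs y hys)
    have hN : N.Subsingleton := by
      refine (hp N (fun n hn e => hsN ?_) ?_).resolve_right fun e => hyN (e.ge hys)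
      · rw [Set.mem_singleton_iff] at e
        exact e ▸ hn
      · intro a ha b hb v hvs hvN
        by_cases hvy : v = y
        · subst hvy
          exact iff_of_true (hyN' a ha) (hyN' b hb)
        · exact iff_of_false (hout v hvN hvs hvy a ha) (hout v hvN hvs hvy b hb)
    refine ⟨w, fun e => hsN (e ▸ hw), fun e => hyN (e ▸ hw), hyN' w hw, ?_⟩
    intro v hvw hvs hvy
    exact arc_of_not_arc hvw (hout v (fun h => hvw (hN h hw)) hvs hvy w hw)
  choose f hfs hfy hyf hf using fun y : {y // y ≠ s} => key y y.2
  have hinj : Function.Injective fun y : {y // y ≠ s} => (⟨f y, hfs y⟩ : {y // y ≠ s}) := by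
    intro y₁ y₂ he
    have he' : f y₁ = f y₂ := congrArg Subtype.val he
    by_contra hne
    have h3 : (y₂ : V) ≠ y₁ := fun e => hne (Subtype.ext e.symm)
    have h4 := hf y₁ y₂ (fun e => hfy y₂ (he' ▸ e.symm)) y₂.2 h3
    rw [he'] at h4
    exact not_arc_of_arc (hyf y₂) h4
  have hsurj := Finite.injective_iff_surjective.1 hinj
  -- every vertex other than `s` has exactly one in-neighbour other than `s`
  have hin : ∀ a, a ≠ s → ∃ p, ∀ v, v ≠ a → v ≠ s → v ≠ p → T.arc a v := by
    intro a ha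
    obtain ⟨y, hy⟩ := hsurj ⟨a, ha⟩
    have : f y = a := congrArg Subtype.val hy
    exact ⟨y, fun v h1 h2 h3 => this ▸ hf y v (this ▸ h1) h2 h3⟩
  have hpick : ∀ a b c d : V, ∃ v, v ≠ a ∧ v ≠ b ∧ v ≠ c ∧ v ≠ d := by
    classical
    intro a b c d
    have := Fintype.ofFinite V
    rw [Nat.card_eq_fintype_card] at hcard
    obtain ⟨v, hv⟩ : ∃ v, v ∉ ({a, b, c, d} : Finset V) := by
      by_contra! h
      have h1 : ({a, b, c, d} : Finset V) = Finset.univ := Finset.eq_univ_iff_forall.2 h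
      have h2 := Finset.card_le_four (a := a) (b := b) (c := c) (d := d)
      rw [h1, Finset.card_univ] at h2
      omega
    simp only [Finset.mem_insert, Finset.mem_singleton, not_or] at hv
    exact ⟨v, hv⟩
  obtain ⟨a, has, -⟩ := hpick s s s s
  obtain ⟨p, hp⟩ := hin a has
  obtain ⟨b, hbs, hba, hbp, -⟩ := hpick s a p s
  obtain ⟨c, hcs, hca, hcp, hcb⟩ := hpick s a p b
  obtain ⟨q, hq⟩ := hin b hbs
  obtain ⟨r, hr⟩ := hin c hcs
  have hab := hp b hba hbs hbp
  have hac := hp c hca hcs hcp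
  have hqa : q = a := by
    by_contra h
    exact not_arc_of_arc hab (hq a hba.symm has (Ne.symm h))
  have hra : r = a := by
    by_contra h
    exact not_arc_of_arc hac (hr a hca.symm has (Ne.symm h))
  exact not_arc_of_arc (hq c hcb hcs (hqa ▸ hca)) (hr b hcb.symm hbs (hra ▸ hba))

/-! ### Choosing the next arc -/

/-- If reversing the arc between vertices `p` and `q` of two minimal co-modules that are modules
creates a module, then `p` and `q` lie in a small co-module, outside of which no vertex
distinguishes them. -/
theorem Bad.exists_comod [Finite V] (hV : 3 ≤ Nat.card V) {X Y : Set V} (hX : T.MinComod X)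
    (hY : T.MinComod Y) (hXm : T.IsModule X) (hYm : T.IsModule Y) {p q : V} (hp : p ∈ X)
    (hq : q ∈ Y) (hpY : p ∉ Y) (hqX : q ∉ X) (hu : X ∪ Y ≠ Set.univ) (hbad : T.Bad p q) :
    ∃ Z ⊆ X ∪ Y, T.Comod Z ∧ p ∈ Z ∧ q ∈ Z ∧ ∀ r, r ∉ Z → (T.arc r p ↔ T.arc r q) := by
  have hpq : p ≠ q := fun e => hpY (e ▸ hq)
  have hsingle : ∀ {C : Set V} {c : V}, c ∈ C → ¬ C.Nontrivial → C = {c} := by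
    intro C c hc hn
    exact (Set.not_nontrivial_iff.1 hn).eq_singleton_of_mem hc
  by_cases hYn : Y.Nontrivial
  · by_cases hXn : X.Nontrivial
    · obtain ⟨-, -, -, -, -, hm⟩ := Bad.of_modules hX hY hXm hYm hXn hYn hp hq hpY hqX hbad
      exact ⟨X ∪ Y, subset_rfl, Or.inl ⟨hm, hXn.mono Set.subset_union_left, hu⟩, Or.inl hp,
        Or.inr hq, fun r hr => hm p (Or.inl hp) q (Or.inr hq) r hr⟩
    · obtain rfl := hsingle hp hXn
      have key : ∀ S : Tournament V, S.IsModule Y → S.IsSource p → S.Bad p q →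
          S.Comod ({p} ∪ Y) ∧ ∀ r, r ∉ {p} ∪ Y → S.arc p r ∧ S.arc q r := by
        intro S hm hs hb
        have h1 := hs.bad_module hm hYn hpY hq hb
        refine ⟨comod_of_dominates hV ⟨p, Or.inl rfl⟩ hu ?_, fun r hr =>
          ⟨hs r fun e => hr (Or.inl e), h1 q hq r (fun h => hr (Or.inr h))
            fun e => hr (Or.inl e)⟩⟩
        rintro a (rfl | ha) v hv
        · exact hs v fun e => hv (Or.inl e)
        · exact h1 a ha v (fun h => hv (Or.inr h)) fun e => hv (Or.inl e)
      rcases hX.1.source_or_sink with hs | hs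
      · obtain ⟨h1, h2⟩ := key T hYm hs hbad
        exact ⟨_, subset_rfl, h1, Or.inl rfl, Or.inr hq, fun r hr =>
          iff_of_false (not_arc_of_arc (h2 r hr).1) (not_arc_of_arc (h2 r hr).2)⟩
      · obtain ⟨h1, h2⟩ := key T.dual (isModule_dual.2 hYm) hs (bad_dual hpq hbad)
        exact ⟨_, subset_rfl, comod_dual.1 h1, Or.inl rfl, Or.inr hq, fun r hr =>
          iff_of_true (h2 r hr).1 (h2 r hr).2⟩
  · exfalso
    obtain rfl := hsingle hq hYn
    rcases hY.1.source_or_sink with hs | hs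
    · exact hs.not_bad_right p hpq hbad
    · exact hs.not_bad_right p hpq (bad_dual hpq hbad)

/-- `H` meets every co-module. -/
def Hits (T : Tournament V) (H : Set V) : Prop := ∀ C, T.Comod C → ∃ h ∈ H, h ∈ C

theorem hits_dual {H : Set V} : T.dual.Hits H ↔ T.Hits H := by
  simp only [Hits, comod_dual]

/-- `H` meets every co-module, and no smaller set does. -/
def MinHits (T : Tournament V) (H : Set V) : Prop :=
  T.Hits H ∧ ∀ H', T.Hits H' → H.ncard ≤ H'.ncard

/-- A vertex of a smallest hitting set is the only one in some minimal co-module. -/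
theorem MinHits.exists_private [Finite V] {H : Set V} (hH : T.MinHits H) {p : V} (hp : p ∈ H) :
    ∃ C, T.MinComod C ∧ p ∈ C ∧ ∀ r ∈ H, r ∈ C → r = p := by
  have h1 : ¬ T.Hits (H \ {p}) := fun h => by
    have h1 := hH.2 _ h
    have h2 := Set.ncard_sdiff_singleton_lt_of_mem hp
    omega
  simp only [Hits, not_forall, not_exists, not_and] at h1
  obtain ⟨C, hC, hCp⟩ := h1
  obtain ⟨D, hDC, hD⟩ := hC.exists_minComod
  have h2 : ∀ r ∈ H, r ∈ D → r = p := fun r hr hrD => by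
    by_contra h
    exact hCp r ⟨hr, h⟩ (hDC hrD)
  obtain ⟨r, hr, hrD⟩ := hH.1 D hD.1
  exact ⟨D, hD, h2 r hr hrD ▸ hrD, h2⟩

/-- Some co-module meets `H` exactly in `p` and `q`. -/
def Isolates (T : Tournament V) (H : Set V) (p q : V) : Prop :=
  ∃ Z, T.Comod Z ∧ p ∈ Z ∧ q ∈ Z ∧ ∀ r ∈ H, r ∈ Z → r = p ∨ r = q

/-- A vertex `p` of `H` is paired off in this way with at most two of the other vertices: in the
subtournament induced on `p` and three further vertices, the three ways of splitting it in halves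
cannot all come from co-modules. -/
theorem exists_not_isolates {H : Set V} {p q₁ q₂ q₃ : V} (h₁ : q₁ ∈ H)
    (h₂ : q₂ ∈ H) (h₃ : q₃ ∈ H) (hp₁ : p ≠ q₁) (hp₂ : p ≠ q₂) (hp₃ : p ≠ q₃) (h₁₂ : q₁ ≠ q₂)
    (h₁₃ : q₁ ≠ q₃) (h₂₃ : q₂ ≠ q₃) :
    ¬ T.Isolates H p q₁ ∨ ¬ T.Isolates H p q₂ ∨ ¬ T.Isolates H p q₃ := by
  have key : ∀ a b c, b ∈ H → c ∈ H → b ≠ p → b ≠ a → c ≠ p → c ≠ a → T.Isolates H p a →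
      ((T.arc b p ↔ T.arc b a) ∧ (T.arc c p ↔ T.arc c a)) ∨
      ((T.arc p b ↔ T.arc p c) ∧ (T.arc a b ↔ T.arc a c)) := by
    rintro a b c hb hc hbp hba hcp hca ⟨Z, hZ, hpZ, haZ, hr⟩
    have hbZ : b ∉ Z := fun h => (hr b hb h).elim hbp hba
    have hcZ : c ∉ Z := fun h => (hr c hc h).elim hcp hca
    rcases hZ with hZ | hZ
    · exact Or.inl ⟨hZ.1 p hpZ a haZ b hbZ, hZ.1 p hpZ a haZ c hcZ⟩
    · exact Or.inr ⟨hZ.1 b hbZ c hcZ p fun h => h hpZ, hZ.1 b hbZ c hcZ a fun h => h haZ⟩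
  by_contra! hcon
  obtain ⟨k₁, k₂, k₃⟩ := hcon
  have e₁ := key q₁ q₂ q₃ h₂ h₃ hp₂.symm h₁₂.symm hp₃.symm h₁₃.symm k₁
  have e₂ := key q₂ q₁ q₃ h₁ h₃ hp₁.symm h₁₂ hp₃.symm h₂₃.symm k₂
  have e₃ := key q₃ q₁ q₂ h₁ h₂ hp₁.symm h₁₃ hp₂.symm h₂₃ k₃
  rw [T.arc_iff q₂ p hp₂.symm, T.arc_iff q₃ p hp₃.symm, T.arc_iff q₂ q₁ h₁₂.symm,
    T.arc_iff q₃ q₁ h₁₃.symm] at e₁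
  rw [T.arc_iff q₁ p hp₁.symm, T.arc_iff q₃ p hp₃.symm, T.arc_iff q₃ q₂ h₂₃.symm,
    T.arc_iff q₂ q₁ h₁₂.symm] at e₂
  rw [T.arc_iff q₁ p hp₁.symm, T.arc_iff q₂ p hp₂.symm, T.arc_iff q₃ q₁ h₁₃.symm,
    T.arc_iff q₃ q₂ h₂₃.symm] at e₃
  by_cases a₁ : T.arc p q₁ <;> by_cases a₂ : T.arc p q₂ <;> by_cases a₃ : T.arc p q₃ <;>
    by_cases b₁ : T.arc q₁ q₂ <;> by_cases b₂ : T.arc q₁ q₃ <;> by_cases b₃ : T.arc q₂ q₃ <;>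
    simp [a₁, a₂, a₃, b₁, b₂, b₃] at e₁ e₂ e₃

/-- A set has at most two extremal vertices. -/
theorem exists_not_isExtremal {Z : Set V} {a b c : V} (ha : a ∈ Z) (hb : b ∈ Z) (hc : c ∈ Z)
    (hab : a ≠ b) (hac : a ≠ c) (hbc : b ≠ c) :
    ¬ T.IsExtremal Z a ∨ ¬ T.IsExtremal Z b ∨ ¬ T.IsExtremal Z c := by
  have key : ∀ x y, x ∈ Z → y ∈ Z → x ≠ y → (∀ z ∈ Z, z ≠ x → T.arc x z) →
      ¬ ∀ z ∈ Z, z ≠ y → T.arc y z := fun x y hx hy hxy h1 h2 =>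
    not_arc_of_arc (h1 y hy hxy.symm) (h2 x hx hxy)
  have key' : ∀ x y, x ∈ Z → y ∈ Z → x ≠ y → (∀ z ∈ Z, z ≠ x → T.arc z x) →
      ¬ ∀ z ∈ Z, z ≠ y → T.arc z y := fun x y hx hy hxy h1 h2 =>
    not_arc_of_arc (h1 y hy hxy.symm) (h2 x hx hxy)
  by_contra! hcon
  obtain ⟨h1 | h1, h2 | h2, h3 | h3⟩ := hcon
  · exact key a b ha hb hab h1 h2
  · exact key a b ha hb hab h1 h2
  · exact key a c ha hc hac h1 h3
  · exact key' b c hb hc hbc h2 h3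
  · exact key b c hb hc hbc h2 h3
  · exact key' a c ha hc hac h1 h3
  · exact key' a b ha hb hab h1 h2
  · exact key' a b ha hb hab h1 h2

/-- A smallest hitting set with two vertices can be chosen so that reversing the arc between them
creates no module. -/
theorem MinHits.exists_of_ncard_two [Finite V] (hV : 5 ≤ Nat.card V) {H : Set V}
    (hH : T.MinHits H) (h2 : H.ncard = 2) :
    ∃ a b, a ≠ b ∧ T.Hits {a, b} ∧ ¬ T.Bad a b ∧ ¬ T.Bad b a := by
  obtain ⟨x, y, hxy, rfl⟩ := Set.ncard_eq_two.1 h2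
  have hsep : ∀ C, T.Comod C → x ∈ C → y ∈ C → False := by
    intro C hC hx hy
    obtain ⟨h, rfl | rfl, hh'⟩ := hH.1 Cᶜ hC.compl
    · exact hh' hx
    · exact hh' hy
  obtain ⟨X, hX, hxX, hX'⟩ := hH.exists_private (p := x) (Or.inl rfl)
  obtain ⟨Y, hY, hyY, hY'⟩ := hH.exists_private (p := y) (Or.inr rfl)
  have hyX : y ∉ X := fun h => hxy (hX' y (Or.inr rfl) h).symm
  have hxY : x ∉ Y := fun h => hxy (hY' x (Or.inl rfl) h)
  have hV3 : 3 ≤ Nat.card V := by omega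
  -- the case of a minimal co-module that is not a module
  have hcore : ∀ (x y : V) (Y : Set V), T.Hits {x, y} → T.MinComod Y → y ∈ Y → x ∉ Y →
      ¬ T.IsModule Y → ∃ a b, a ≠ b ∧ T.Hits {a, b} ∧ ¬ T.Bad a b ∧ ¬ T.Bad b a := by
    intro x y Y hh hY hyY hxY hYm
    have hc := hY.isPrimeCore hYm
    by_cases he : T.IsExtremal Yᶜ x
    · have hmod : T.IsModule (Yᶜ \ {x}) := by
        intro a ha b hb v hv
        by_cases hvx : v = x
        · subst hvx
          rcases he with he | he
          · exact iff_of_true (he a ha.1 ha.2) (he b hb.1 hb.2)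
          · exact iff_of_false (not_arc_of_arc (he a ha.1 ha.2))
              (not_arc_of_arc (he b hb.1 hb.2))
        · exact hc.isModule_compl a ha.1 b hb.1 v fun h => hv ⟨h, hvx⟩
      have hs : (Yᶜ \ {x}).Subsingleton := by
        by_contra h
        obtain ⟨w, rfl | rfl, hw⟩ := hh (Yᶜ \ {x})
          (Or.inl ⟨hmod, Set.not_subsingleton_iff.1 h, fun e => (e.ge (Set.mem_univ x)).2 rfl⟩)
        · exact hw.2 rfl
        · exact hw.1 hyY
      obtain ⟨x', hx', hx'x⟩ := hc.compl_nontrivial.exists_ne x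
      have hYc : Yᶜ = {x, x'} := by
        ext v
        constructor
        · intro hv
          by_cases hvx : v = x
          · exact Or.inl hvx
          · exact Or.inr (hs ⟨hv, hvx⟩ ⟨hx', hx'x⟩)
        · rintro (rfl | rfl)
          · exact hxY
          · exact hx'
      have hcard : 3 ≤ Y.ncard := by
        have h1 := Set.ncard_add_ncard_compl Y
        rw [hYc, Set.ncard_pair hx'x.symm] at h1
        omega
      obtain ⟨y', hy', hb1, hb2⟩ := hc.exists_not_bad hx'x.symm hYc hcard
      refine ⟨x, y', fun e => hxY (e ▸ hy'), ?_, hb1, hb2⟩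
      intro C hC
      obtain ⟨D, hDC, hD⟩ := hC.exists_minComod
      obtain ⟨w, hw, hwD⟩ := hh D hD.1
      rcases hw with rfl | rfl
      · exact ⟨w, Or.inl rfl, hDC hwD⟩
      · by_cases hDY : D = Y
        · exact ⟨y', Or.inr rfl, hDC (hDY ▸ hy')⟩
        · exact absurd (hD.twins_of_meet hY hDY hwD hyY).2.1 hYm
    · exact ⟨x, y, fun e => hxY (e ▸ hyY), hh,
        fun h => he (hc.isExtremal_of_bad hxY hyY (Or.inl h)),
        fun h => he (hc.isExtremal_of_bad hxY hyY (Or.inr h))⟩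
  by_cases hYm : T.IsModule Y
  swap
  · exact hcore x y Y hH.1 hY hyY hxY hYm
  by_cases hXm : T.IsModule X
  swap
  · exact hcore y x X (by rw [Set.pair_comm]; exact hH.1) hX hxX hyX hXm
  by_cases hu : X ∪ Y = Set.univ
  swap
  · refine ⟨x, y, hxy, hH.1, fun h => ?_, fun h => ?_⟩
    · obtain ⟨Z, -, hZ, hx, hy, -⟩ := h.exists_comod hV3 hX hY hXm hYm hxX hyY hxY hyX hu
      exact hsep Z hZ hx hy
    · obtain ⟨Z, -, hZ, hy, hx, -⟩ := h.exists_comod hV3 hY hX hYm hXm hyY hxX hyX hxY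
        (by rwa [Set.union_comm])
      exact hsep Z hZ hx hy
  -- the case of a source or sink whose deletion leaves an indecomposable tournament
  have hone : ∀ (S : Tournament V) (s : V) (Y : Set V), S.MinComod Y → S.IsModule Y →
      Y = {s}ᶜ → S.IsSource s → ∃ a b, a ≠ b ∧ S.Hits {a, b} ∧ ¬ S.Bad a b ∧ ¬ S.Bad b a := by
    rintro S s Y hY hYm rfl hs
    obtain ⟨z, hz, hb⟩ := hs.exists_not_bad (hY.primeIn hYm) hV
    refine ⟨s, z, hz.symm, fun C hC => ?_, hb, hs.not_bad_right z hz⟩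
    by_cases hsC : s ∈ C
    · exact ⟨s, Or.inl rfl, hsC⟩
    · have := hY.2 C hC fun v hv e => hsC (by rw [Set.mem_singleton_iff] at e; exact e ▸ hv)
      exact ⟨z, Or.inr rfl, this.ge hz⟩
  have hone' : ∀ (s : V) (Y : Set V), T.MinComod Y → T.IsModule Y → Y = {s}ᶜ → T.Comod {s} →
      ∃ a b, a ≠ b ∧ T.Hits {a, b} ∧ ¬ T.Bad a b ∧ ¬ T.Bad b a := by
    intro s Y hY hYm hYs hs
    rcases hs.source_or_sink with hs | hs
    · exact hone T s Y hY hYm hYs hs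
    · obtain ⟨a, b, hab, h1, h2, h3⟩ :=
        hone T.dual s Y (minComod_dual.2 hY) (isModule_dual.2 hYm) hYs hs
      exact ⟨a, b, hab, hits_dual.1 h1, fun h => h2 (bad_dual hab h),
        fun h => h3 (bad_dual hab.symm h)⟩
  have hcompl : ∀ {A B : Set V} {a : V}, A ∪ B = Set.univ → A = {a} → a ∉ B → B = {a}ᶜ := by
    rintro A B a hAB rfl ha
    ext v
    constructor
    · rintro hv rfl
      exact ha hv
    · intro hv
      exact (hAB.ge (Set.mem_univ v)).resolve_left hv
  by_cases hXn : X.Nontrivial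
  swap
  · have hXe := (Set.not_nontrivial_iff.1 hXn).eq_singleton_of_mem hxX
    exact hone' x Y hY hYm (hcompl hu hXe hxY) (hXe ▸ hX.1)
  by_cases hYn : Y.Nontrivial
  swap
  · have hYe := (Set.not_nontrivial_iff.1 hYn).eq_singleton_of_mem hyY
    exact hone' y X hX hXm (hcompl (by rwa [Set.union_comm]) hYe hyX) (hYe ▸ hY.1)
  -- `V` is the disjoint union of two minimal modules: neither of them has two vertices
  have hpair : ∀ (x y : V) (X Y : Set V), T.MinComod X → T.MinComod Y → T.IsModule X →
      T.IsModule Y → X.Nontrivial → Y.Nontrivial → x ∈ X → y ∈ Y → x ∉ Y → y ∉ X →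
      X ∪ Y = Set.univ → ¬ T.Bad x y := by
    intro x y X Y hX hY hXm hYm hXn hYn hxX hyY hxY hyX hu hb
    obtain ⟨hd, x', hx'x, hXe, -, -⟩ := Bad.of_modules hX hY hXm hYm hXn hYn hxX hyY hxY hyX hb
    have hXY : ∀ v, v ∉ X → v ∈ Y := fun v hv => (hu.ge (Set.mem_univ v)).resolve_left hv
    have hYX : ∀ v ∈ Y, v ∉ X := fun v h h' => Set.disjoint_left.1 hd h' h
    have hab : ∃ a b, T.arc a b ∧ X = {a, b} := by
      by_cases h : T.arc x' x
      · exact ⟨x', x, h, hXe⟩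
      · exact ⟨x, x', arc_of_not_arc hx'x h, by rw [hXe, Set.pair_comm]⟩
    obtain ⟨a, b, hab, rfl⟩ := hab
    have hne := ne_of_arc hab
    have hsing : ∀ c ∈ ({a, b} : Set V), ¬ T.Comod {c} := by
      intro c hc h
      have := hX.2 {c} h (Set.singleton_subset_iff.2 hc)
      rw [← this] at hXn
      exact Set.not_nontrivial_singleton hXn
    have huniv : ∀ c : V, ({c} : Set V) ≠ Set.univ := by
      intro c e
      rw [Set.ext_iff] at e
      exact hne (((e a).2 trivial).trans ((e b).2 trivial).symm)
    have hmove : ∀ c ∈ ({a, b} : Set V), ∀ v ∈ Y, (T.arc c v ↔ T.arc a y) := by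
      intro c hc v hv
      rw [hXm.arc_to_iff hc (Or.inl rfl) (hYX v hv)]
      exact hYm v hv y hyY a fun h => hYX a h (Or.inl rfl)
    by_cases h : T.arc a y
    · refine hsing a (Or.inl rfl) (comod_of_dominates hV3 ⟨a, rfl⟩ (huniv a) ?_)
      rintro c rfl v hv
      by_cases hvX : v ∈ ({c, b} : Set V)
      · rcases hvX with h' | h'
        · exact absurd h' hv
        · rw [Set.mem_singleton_iff] at h'
          exact h' ▸ hab
      · exact (hmove c (Or.inl rfl) v (hXY v hvX)).2 h
    · refine hsing b (Or.inr rfl) (comod_dual.1 (comod_of_dominates hV3 ⟨b, rfl⟩ (huniv b) ?_))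
      rintro c rfl v hv
      by_cases hvX : v ∈ ({a, c} : Set V)
      · rcases hvX with h' | h'
        · exact h' ▸ hab
        · exact absurd h' hv
      · exact arc_of_not_arc (T := T) (fun e => hvX (Or.inr e.symm))
          fun h' => h ((hmove c (Or.inr rfl) v (hXY v hvX)).1 h')
  exact ⟨x, y, hxy, hH.1, hpair x y X Y hX hY hXm hYm hXn hYn hxX hyY hxY hyX hu,
    hpair y x Y X hY hX hYm hXm hYn hXn hyY hxX hyX hxY (by rwa [Set.union_comm])⟩

/-- In a smallest hitting set `H` with at least three vertices one can choose two vertices such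
that reversing the arc between them creates no module; if `H` has at least four vertices, one can
moreover achieve that the rest of `H` meets every co-module that contains both of them. -/
theorem MinHits.exists_pair [Finite V] (hV : 5 ≤ Nat.card V) {H : Set V} (hH : T.MinHits H)
    (h3 : 3 ≤ H.ncard) : ∃ p ∈ H, ∃ q ∈ H, p ≠ q ∧ ¬ T.Bad p q ∧ ¬ T.Bad q p ∧
      (4 ≤ H.ncard → ¬ T.Isolates H p q) := by
  choose! X hX hpX hpr using fun p (hp : p ∈ H) => hH.exists_private hp
  have hnm : ∀ p ∈ H, ∀ q ∈ H, p ≠ q → q ∉ X p := fun p hp q hq hpq h =>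
    hpq (hpr p hp q hq h).symm
  have hXne : ∀ p ∈ H, ∀ q ∈ H, p ≠ q → X p ≠ X q := fun p hp q hq hpq e =>
    hnm p hp q hq hpq (e ▸ hpX q hq)
  have hmm : ∀ p ∈ H, ∀ q ∈ H, p ≠ q → T.IsModule (X p) → T.IsModule (X q) →
      T.Bad p q ∨ T.Bad q p →
      T.Isolates H p q ∧ ∀ r ∈ H, r ≠ p → r ≠ q → (T.arc r p ↔ T.arc r q) := by
    intro p hp q hq hpq hmp hmq hb
    obtain ⟨r, hr, hrpq⟩ := Set.exists_mem_notMem_of_ncard_lt_ncard (s := {p, q}) (t := H)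
      (by rw [Set.ncard_pair hpq]; omega)
    have hrp : r ≠ p := fun e => hrpq (Or.inl e)
    have hrq : r ≠ q := fun e => hrpq (Or.inr e)
    have hout : ∀ r ∈ H, r ≠ p → r ≠ q → r ∉ X p ∪ X q := fun r hr h1 h2 h =>
      h.elim (hnm p hp r hr h1.symm) (hnm q hq r hr h2.symm)
    have hu : X p ∪ X q ≠ Set.univ := fun e => hout r hr hrp hrq (e ▸ Set.mem_univ r)
    have hZ : ∃ Z ⊆ X p ∪ X q, T.Comod Z ∧ p ∈ Z ∧ q ∈ Z ∧
        ∀ r, r ∉ Z → (T.arc r p ↔ T.arc r q) := by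
      rcases hb with hb | hb
      · exact hb.exists_comod (by omega) (hX p hp) (hX q hq) hmp hmq (hpX p hp) (hpX q hq)
          (hnm q hq p hp hpq.symm) (hnm p hp q hq hpq) hu
      · obtain ⟨Z, h1, h2, h3, h4, h5⟩ := hb.exists_comod (by omega) (hX q hq) (hX p hp) hmq hmp
          (hpX q hq) (hpX p hp) (hnm p hp q hq hpq) (hnm q hq p hp hpq.symm)
          (by rwa [Set.union_comm])
        exact ⟨Z, by rwa [Set.union_comm], h2, h4, h3, fun r hr => (h5 r hr).symm⟩
    obtain ⟨Z, hZs, hZc, hpZ, hqZ, hZr⟩ := hZ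
    refine ⟨⟨Z, hZc, hpZ, hqZ, fun r hr hrZ => ?_⟩, fun r hr h1 h2 =>
      hZr r fun h => hout r hr h1 h2 (hZs h)⟩
    by_contra! h
    exact hout r hr h.1 h.2 (hZs hrZ)
  -- facts about a vertex `y` of `H` whose minimal co-module is not a module
  have hother : ∀ y ∈ H, ¬ T.IsModule (X y) → ∀ p ∈ H, p ≠ y →
      T.IsModule (X p) ∧ (X p).Nontrivial ∧ ∀ v ∈ X p, v ∈ (X y)ᶜ := by
    intro y hy hmy p hp hpy
    have hne := hXne p hp y hy hpy
    obtain ⟨h1, h2⟩ := (hX p hp).isModule_of_ne (hX y hy) hne hmy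
    exact ⟨h1, h2, fun v hv hvy => hmy ((hX p hp).twins_of_meet (hX y hy) hne hv hvy).2.1⟩
  have hcore : ∀ y ∈ H, ¬ T.IsModule (X y) → ∀ p ∈ H, p ≠ y → ¬ T.IsExtremal (X y)ᶜ p →
      ¬ T.Bad p y ∧ ¬ T.Bad y p := by
    intro y hy hmy p hp hpy he
    have hc := (hX y hy).isPrimeCore hmy
    have hpXy := hnm y hy p hp hpy.symm
    exact ⟨fun h => he (hc.isExtremal_of_bad hpXy (hpX y hy) (Or.inl h)),
      fun h => he (hc.isExtremal_of_bad hpXy (hpX y hy) (Or.inr h))⟩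
  by_cases h4 : 4 ≤ H.ncard
  · have hp : ∃ p ∈ H, T.IsModule (X p) ∧
        ∀ y ∈ H, p ≠ y → ¬ T.IsModule (X y) → ¬ T.IsExtremal (X y)ᶜ p := by
      by_cases hex : ∃ y ∈ H, ¬ T.IsModule (X y)
      · obtain ⟨y, hy, hmy⟩ := hex
        have h1 := Set.ncard_sdiff_singleton_add_one hy
        obtain ⟨a, b, c, ha, hb, hc, hab, hac, hbc⟩ :=
          (Set.two_lt_ncard_iff (s := H \ {y})).1 (by omega)
        have hfin : ∀ p ∈ H \ {y}, ¬ T.IsExtremal (X y)ᶜ p → ∃ p ∈ H, T.IsModule (X p) ∧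
            ∀ y ∈ H, p ≠ y → ¬ T.IsModule (X y) → ¬ T.IsExtremal (X y)ᶜ p := by
          intro p hp he
          refine ⟨p, hp.1, (hother y hy hmy p hp.1 hp.2).1, fun y' hy' _ hmy' => ?_⟩
          obtain rfl : y' = y := by
            by_contra h
            exact hmy' (hother y hy hmy y' hy' h).1
          exact he
        have hmem : ∀ p ∈ H \ {y}, p ∈ (X y)ᶜ := fun p hp => hnm y hy p hp.1 (Ne.symm hp.2)
        rcases exists_not_isExtremal (T := T) (hmem a ha) (hmem b hb) (hmem c hc) hab hac hbc
          with h | h | h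
        · exact hfin a ha h
        · exact hfin b hb h
        · exact hfin c hc h
      · push Not at hex
        obtain ⟨p, hp⟩ : H.Nonempty := Set.nonempty_of_ncard_ne_zero (by omega)
        exact ⟨p, hp, hex p hp, fun y hy _ hmy => absurd (hex y hy) hmy⟩
    obtain ⟨p, hp, hmp, hpe⟩ := hp
    have h1 := Set.ncard_sdiff_singleton_add_one hp
    obtain ⟨a, b, c, ha, hb, hc, hab, hac, hbc⟩ :=
      (Set.two_lt_ncard_iff (s := H \ {p})).1 (by omega)
    have hq : ∃ q ∈ H, p ≠ q ∧ ¬ T.Isolates H p q := by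
      rcases exists_not_isolates (T := T) (p := p) ha.1 hb.1 hc.1 (Ne.symm ha.2) (Ne.symm hb.2)
        (Ne.symm hc.2) hab hac hbc with h | h | h
      · exact ⟨a, ha.1, Ne.symm ha.2, h⟩
      · exact ⟨b, hb.1, Ne.symm hb.2, h⟩
      · exact ⟨c, hc.1, Ne.symm hc.2, h⟩
    obtain ⟨q, hq, hpq, hiso⟩ := hq
    refine ⟨p, hp, q, hq, hpq, ?_⟩
    by_cases hmq : T.IsModule (X q)
    · exact ⟨fun h => hiso (hmm p hp q hq hpq hmp hmq (Or.inl h)).1,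
        fun h => hiso (hmm p hp q hq hpq hmp hmq (Or.inr h)).1, fun _ => hiso⟩
    · obtain ⟨h1, h2⟩ := hcore q hq hmq p hp hpq (hpe q hq hpq hmq)
      exact ⟨h1, h2, fun _ => hiso⟩
  · suffices h : ∃ p ∈ H, ∃ q ∈ H, p ≠ q ∧ ¬ T.Bad p q ∧ ¬ T.Bad q p by
      obtain ⟨p, hp, q, hq, h⟩ := h
      exact ⟨p, hp, q, hq, h.1, h.2.1, h.2.2, fun h => absurd h h4⟩
    by_cases hex : ∃ y ∈ H, ¬ T.IsModule (X y)
    · obtain ⟨y, hy, hmy⟩ := hex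
      obtain ⟨a, b, hab, hHy⟩ := Set.ncard_eq_two.1
        (show (H \ {y}).ncard = 2 by
          have h1 := Set.ncard_sdiff_singleton_add_one hy
          omega)
      have ha : a ∈ H \ {y} := hHy.ge (Or.inl rfl)
      have hb : b ∈ H \ {y} := hHy.ge (Or.inr rfl)
      by_cases hea : T.IsExtremal (X y)ᶜ a
      swap
      · obtain ⟨h1, h2⟩ := hcore y hy hmy a ha.1 ha.2 hea
        exact ⟨a, ha.1, y, hy, ha.2, h1, h2⟩
      by_cases heb : T.IsExtremal (X y)ᶜ b
      swap
      · obtain ⟨h1, h2⟩ := hcore y hy hmy b hb.1 hb.2 heb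
        exact ⟨b, hb.1, y, hy, hb.2, h1, h2⟩
      -- a bad arc from `p` would put a vertex of `X p` on the other side of `p` than `q`
      have key : ∀ p ∈ H \ {y}, ∀ q ∈ H \ {y}, p ≠ q → T.IsExtremal (X y)ᶜ p → ¬ T.Bad p q := by
        intro p hp q hq hpq he hbad
        obtain ⟨hmp, hnp, hpy⟩ := hother y hy hmy p hp.1 hp.2
        obtain ⟨hmq, hnq, hqy⟩ := hother y hy hmy q hq.1 hq.2
        obtain ⟨-, x', hx'p, hXe, hiff, -⟩ := Bad.of_modules (hX p hp.1) (hX q hq.1) hmp hmq hnp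
          hnq (hpX p hp.1) (hpX q hq.1) (hnm q hq.1 p hp.1 hpq.symm) (hnm p hp.1 q hq.1 hpq) hbad
        have hx' : x' ∈ (X y)ᶜ := hpy x' (hXe.ge (Or.inl rfl))
        have hq' : q ∈ (X y)ᶜ := hqy q (hpX q hq.1)
        rcases he with he | he
        · exact not_arc_of_arc (he x' hx' hx'p) (hiff.2 (he q hq' hpq.symm))
        · exact not_arc_of_arc (he q hq' hpq.symm) (hiff.1 (he x' hx' hx'p))
      exact ⟨a, ha.1, b, hb.1, hab, key a ha b hb hab hea, key b hb a ha hab.symm heb⟩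
    · push Not at hex
      obtain ⟨a, b, c, hab, hac, hbc, rfl⟩ := Set.ncard_eq_three.1 (show H.ncard = 3 by omega)
      have ha : a ∈ ({a, b, c} : Set V) := Or.inl rfl
      have hb : b ∈ ({a, b, c} : Set V) := Or.inr (Or.inl rfl)
      have hc : c ∈ ({a, b, c} : Set V) := Or.inr (Or.inr rfl)
      by_contra! hcon
      have key : ∀ p ∈ ({a, b, c} : Set V), ∀ q ∈ ({a, b, c} : Set V), p ≠ q →
          ∀ r ∈ ({a, b, c} : Set V), r ≠ p → r ≠ q → (T.arc r p ↔ T.arc r q) := by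
        intro p hp q hq hpq
        refine (hmm p hp q hq hpq (hex p hp) (hex q hq) ?_).2
        by_cases h : T.Bad p q
        · exact Or.inl h
        · exact Or.inr (hcon p hp q hq hpq h)
      have k₁ := key a ha b hb hab c hc hac.symm hbc.symm
      have k₂ := key a ha c hc hac b hb hab.symm hbc
      have k₃ := key b hb c hc hbc a ha hab hac
      rw [T.arc_iff c a hac.symm, T.arc_iff c b hbc.symm] at k₁
      rw [T.arc_iff b a hab.symm] at k₂
      tauto

/-! ### Reversing arcs one after the other -/

/-- `T` becomes indecomposable by reversing at most `k` arcs. -/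
def Near (T : Tournament V) (k : ℕ) : Prop :=
  ∃ S : Tournament V, S.Indecomposable ∧
    {a : V × V | T.arc a.1 a.2 ∧ ¬ S.arc a.1 a.2}.ncard ≤ k

theorem Near.mono {k l : ℕ} (h : T.Near k) (hkl : k ≤ l) : T.Near l := by
  obtain ⟨S, h1, h2⟩ := h
  exact ⟨S, h1, h2.trans hkl⟩

theorem near_of_indecomposable (h : T.Indecomposable) (k : ℕ) : T.Near k := by
  refine ⟨T, h, ?_⟩
  simp

theorem near_of_flip [Finite V] {x y : V} {k : ℕ} (h : (T.flip x y).Near k) :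
    T.Near (k + 1) := by
  obtain ⟨S, h1, h2⟩ := h
  refine ⟨S, h1, ?_⟩
  have hone : {a : V × V | T.arc a.1 a.2 ∧ ¬ (T.flip x y).arc a.1 a.2}.ncard ≤ 1 := by
    rw [Set.ncard_le_one]
    rintro ⟨a, b⟩ ⟨h1, h2⟩ ⟨c, d⟩ ⟨h3, h4⟩
    have key : ∀ a b, T.arc a b → ¬ (T.flip x y).arc a b → (a = x ∧ b = y) ∨ (a = y ∧ b = x) := by
      intro a b h1 h2
      by_contra h
      exact h2 (Or.inr ⟨h, h1⟩)
    rcases key a b h1 h2 with ⟨rfl, rfl⟩ | ⟨rfl, rfl⟩ <;>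
      rcases key c d h3 h4 with ⟨rfl, rfl⟩ | ⟨rfl, rfl⟩
    · rfl
    · exact absurd h1 (not_arc_of_arc h3)
    · exact absurd h1 (not_arc_of_arc h3)
    · rfl
  have hsub : {a : V × V | T.arc a.1 a.2 ∧ ¬ S.arc a.1 a.2} ⊆
      {a : V × V | (T.flip x y).arc a.1 a.2 ∧ ¬ S.arc a.1 a.2} ∪
      {a : V × V | T.arc a.1 a.2 ∧ ¬ (T.flip x y).arc a.1 a.2} := by
    intro a ha
    by_cases h : (T.flip x y).arc a.1 a.2
    · exact Or.inl ⟨h, ha.2⟩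
    · exact Or.inr ⟨ha.1, h⟩
  have h3 := Set.ncard_le_ncard hsub
  have h4 := Set.ncard_union_le {a : V × V | (T.flip x y).arc a.1 a.2 ∧ ¬ S.arc a.1 a.2}
      {a : V × V | T.arc a.1 a.2 ∧ ¬ (T.flip x y).arc a.1 a.2}
  omega

/-- The upper bound for the decomposability index: `k` reversals suffice if the co-modules can be
met by `2 k` vertices. -/
theorem near_of_hits [Finite V] (hV : 5 ≤ Nat.card V) (k : ℕ) :
    ∀ (T : Tournament V) (H : Set V), T.Hits H → H.ncard ≤ 2 * k → T.Near k := by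
  induction k with
  | zero =>
    intro T H hH hc
    have hH0 : H = ∅ := (Set.ncard_eq_zero).1 (by omega)
    refine near_of_indecomposable (indecomposable_iff.2 fun C hC => ?_) 0
    obtain ⟨h, hh, -⟩ := hH C hC
    rw [hH0] at hh
    exact hh
  | succ k ih =>
    intro T H hH hc
    obtain ⟨H₀, hH₀⟩ : ∃ H₀, T.MinHits H₀ := by
      obtain ⟨H₀, h1, h2⟩ := Set.exists_min_image {H | T.Hits H} Set.ncard (Set.toFinite _)
        ⟨H, hH⟩
      exact ⟨H₀, h1, h2⟩
    have hc₀ : H₀.ncard ≤ 2 * (k + 1) := (hH₀.2 H hH).trans hc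
    by_cases hsmall : H₀.ncard ≤ 2 * k
    · exact (ih T H₀ hH₀.1 hsmall).mono (Nat.le_succ k)
    by_cases h1 : H₀.ncard = 1
    · obtain ⟨x, rfl⟩ := Set.ncard_eq_one.1 h1
      refine near_of_indecomposable (indecomposable_iff.2 fun C hC => ?_) _
      obtain ⟨a, rfl, ha⟩ := hH₀.1 C hC
      obtain ⟨b, rfl, hb⟩ := hH₀.1 Cᶜ hC.compl
      exact hb ha
    by_cases h2 : H₀.ncard = 2
    · obtain ⟨a, b, hab, hh, hb1, hb2⟩ := hH₀.exists_of_ncard_two hV h2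
      refine near_of_flip (x := a) (y := b)
        (near_of_indecomposable (indecomposable_iff.2 fun C hC => ?_) k)
      obtain ⟨hC', hiff⟩ := comod_of_comod_flip hb1 hb2 hC
      obtain ⟨u, hu, huC⟩ := hh C hC'
      obtain ⟨v, hv, hvC⟩ := hh Cᶜ hC'.compl
      have hvC' : v ∉ C := hvC
      rcases hu with rfl | rfl <;> rcases hv with rfl | rfl <;> tauto
    obtain ⟨p, hp, q, hq, hpq, hb1, hb2, hiso⟩ := hH₀.exists_pair hV (by omega)
    have hcq := Set.ncard_sdiff_singleton_add_one hq
    refine near_of_flip (x := p) (y := q) ?_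
    by_cases h4 : 4 ≤ H₀.ncard
    · have hcp := Set.ncard_sdiff_singleton_add_one
        (show p ∈ H₀ \ {q} from ⟨hp, hpq⟩)
      refine ih _ ((H₀ \ {q}) \ {p}) (fun C hC => ?_) (by omega)
      obtain ⟨hC', hiff⟩ := comod_of_comod_flip hb1 hb2 hC
      by_contra! hcon
      have hr : ∀ r ∈ H₀, r ∈ C → r = p ∨ r = q := by
        intro r hr hrC
        by_contra! h
        exact hcon r ⟨⟨hr, h.2⟩, h.1⟩ hrC
      obtain ⟨r, hrH, hrC⟩ := hH₀.1 C hC'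
      rcases hr r hrH hrC with rfl | rfl
      · exact hiso h4 ⟨C, hC', hrC, hiff.1 hrC, hr⟩
      · exact hiso h4 ⟨C, hC', hiff.2 hrC, hrC, hr⟩
    · refine ih _ (H₀ \ {q}) (fun C hC => ?_) (by omega)
      obtain ⟨hC', hiff⟩ := comod_of_comod_flip hb1 hb2 hC
      obtain ⟨r, hrH, hrC⟩ := hH₀.1 C hC'
      by_cases hrq : r = q
      · exact ⟨p, ⟨hp, hpq⟩, hiff.2 (hrq ▸ hrC)⟩
      · exact ⟨r, ⟨hrH, hrq⟩, hrC⟩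

/-! ### Disjoint co-modules and the decomposability index -/

/-- `T` has `m` pairwise disjoint co-modules. -/
def HasPacking (T : Tournament V) (m : ℕ) : Prop :=
  ∃ c : Fin m → Set V, (∀ i, T.Comod (c i)) ∧ ∀ i j, i ≠ j → Disjoint (c i) (c j)

theorem comod_inv {B : Finset (V × V)} {C : Set V} (hC : T.Comod C)
    (h : ∀ a ∈ B, a.1 ∉ C ∧ a.2 ∉ C) : (T.inv B).Comod C := by
  have key : ∀ a b, a ∈ C ∨ b ∈ C → ((T.inv B).arc a b ↔ T.arc a b) := by
    intro a b hab
    have h1 : (a, b) ∉ B := fun hB => hab.elim (h _ hB).1 (h _ hB).2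
    have h2 : (b, a) ∉ B := fun hB => hab.elim (h _ hB).2 (h _ hB).1
    simp only [inv]
    tauto
  rcases hC with ⟨h1, h2⟩ | ⟨h1, h2⟩
  · refine Or.inl ⟨fun x hx y hy v hv => ?_, h2⟩
    rw [key v x (Or.inr hx), key v y (Or.inr hy)]
    exact h1 x hx y hy v hv
  · refine Or.inr ⟨fun x hx y hy v hv => ?_, h2⟩
    have hv' : v ∈ C := not_not.1 hv
    rw [key v x (Or.inl hv'), key v y (Or.inl hv')]
    exact h1 x hx y hy v hv

/-- Every co-module contains an end of a reversed arc if the result is indecomposable. -/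
theorem HasPacking.le_two_mul_card {m : ℕ} (hm : T.HasPacking m) {B : Finset (V × V)}
    (hB : (T.inv B).Indecomposable) : m ≤ 2 * B.card := by
  classical
  obtain ⟨c, hc, hd⟩ := hm
  have hex : ∀ i, ∃ v ∈ B.image Prod.fst ∪ B.image Prod.snd, v ∈ c i := by
    intro i
    by_contra! hcon
    refine indecomposable_iff.1 hB (c i) (comod_inv (hc i) fun a ha => ⟨hcon _ ?_, hcon _ ?_⟩)
    · exact Finset.mem_union_left _ (Finset.mem_image_of_mem _ ha)
    · exact Finset.mem_union_right _ (Finset.mem_image_of_mem _ ha)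
  choose f hf hfc using hex
  have hinj : Function.Injective f := by
    intro i j hij
    by_contra hne
    exact Set.disjoint_left.1 (hd i j hne) (hfc i) (hij ▸ hfc j)
  have h1 : (Finset.univ.image f).card = m := by
    rw [Finset.card_image_of_injective _ hinj, Finset.card_univ, Fintype.card_fin]
  have h2 : Finset.univ.image f ⊆ B.image Prod.fst ∪ B.image Prod.snd := by
    intro v hv
    obtain ⟨i, -, rfl⟩ := Finset.mem_image.1 hv
    exact hf i
  have h3 := Finset.card_le_card h2
  have h4 := Finset.card_union_le (B.image Prod.fst) (B.image Prod.snd)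
  have h5 := Finset.card_image_le (s := B) (f := Prod.fst)
  have h6 := Finset.card_image_le (s := B) (f := Prod.snd)
  omega

theorem Near.exists_finset [Finite V] {k : ℕ} (h : T.Near k) :
    ∃ B : Finset (V × V), (∀ a ∈ B, T.arc a.1 a.2) ∧ B.card ≤ k ∧ (T.inv B).Indecomposable := by
  obtain ⟨S, hS, hk⟩ := h
  have hfin : {a : V × V | T.arc a.1 a.2 ∧ ¬ S.arc a.1 a.2}.Finite := Set.toFinite _
  refine ⟨hfin.toFinset, fun a ha => (hfin.mem_toFinset.1 ha).1, ?_, ?_⟩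
  · rwa [← Set.ncard_eq_toFinset_card _ hfin]
  · have : T.inv hfin.toFinset = S := by
      ext x y
      simp only [inv, Set.Finite.mem_toFinset, Set.mem_ofPred_eq]
      by_cases hxy : x = y
      · subst hxy
        have := T.irrefl x
        have := S.irrefl x
        tauto
      · have h1 := T.arc_iff x y hxy
        have h2 := S.arc_iff x y hxy
        tauto
    rwa [this]

theorem Near.decompIndex_le [Finite V] {k : ℕ} (h : T.Near k) : T.decompIndex ≤ k := by
  obtain ⟨B, h1, h2, h3⟩ := h.exists_finset
  exact le_trans (Nat.sInf_le (m := B.card) ⟨B, h1, rfl, h3⟩) h2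

theorem HasPacking.le_two_mul_decompIndex [Finite V] (hV : 5 ≤ Nat.card V) {m : ℕ}
    (hm : T.HasPacking m) : m ≤ 2 * T.decompIndex := by
  have hne : {m : ℕ | ∃ B : Finset (V × V), (∀ a ∈ B, T.arc a.1 a.2) ∧ B.card = m ∧
      (T.inv B).Indecomposable}.Nonempty := by
    obtain ⟨B, h1, -, h3⟩ := (near_of_hits hV (Nat.card V) T Set.univ
      (fun C hC => by
        obtain ⟨v, hv⟩ := hC.nonempty
        exact ⟨v, trivial, hv⟩)
      (by rw [Set.ncard_univ]; omega)).exists_finset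
    exact ⟨_, B, h1, rfl, h3⟩
  obtain ⟨B, -, h2, h3⟩ := Nat.sInf_mem hne
  have := hm.le_two_mul_card h3
  unfold decompIndex
  rwa [h2] at this

/-! ### Minimal co-modules: hitting sets and packings -/

/-- A nonempty family of minimal co-modules has a member `S` and a vertex `h` of `S` that lies in
all members meeting `S`: the two-element modules that meet form paths, and `S` can be taken as the
first edge of such a path, with `h` its inner vertex. -/
theorem exists_simplicial [Finite V] {𝓢 : Finset (Set V)} (h𝓢 : ∀ S ∈ 𝓢, T.MinComod S)
    (hne : 𝓢.Nonempty) :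
    ∃ S ∈ 𝓢, ∃ h ∈ S, ∀ S' ∈ 𝓢, (∃ v ∈ S, v ∈ S') → h ∈ S' := by
  by_cases hiso : ∃ S ∈ 𝓢, ∀ S' ∈ 𝓢, (∃ v ∈ S, v ∈ S') → S' = S
  · obtain ⟨S, hS, hS'⟩ := hiso
    obtain ⟨h, hh⟩ := (h𝓢 S hS).1.nonempty
    exact ⟨S, hS, h, hh, fun S' h1 h2 => (hS' S' h1 h2) ▸ hh⟩
  push Not at hiso
  -- all members are twins; take one whose first vertex has the fewest in-neighbours
  have hpairs : ∀ S ∈ 𝓢, T.IsModule S ∧ ∃ a b, T.arc a b ∧ S = {a, b} := by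
    intro S hS
    obtain ⟨S', hS', ⟨w, hw, hw'⟩, hne'⟩ := hiso S hS
    obtain ⟨h1, -, ⟨a, haw, he⟩, -⟩ := (h𝓢 S hS).twins_of_meet (h𝓢 S' hS') hne'.symm hw hw'
    refine ⟨h1, ?_⟩
    by_cases h : T.arc a w
    · exact ⟨a, w, h, he⟩
    · exact ⟨w, a, arc_of_not_arc haw h, by rw [he, Set.pair_comm]⟩
  obtain ⟨S₀, hS₀⟩ := hne
  obtain ⟨-, a₀, b₀, hab₀, he₀⟩ := hpairs S₀ hS₀
  obtain ⟨a, ⟨b, hab, habS⟩, hmin⟩ := Set.exists_min_image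
    {a : V | ∃ b, T.arc a b ∧ ({a, b} : Set V) ∈ 𝓢} (fun a => {v | T.arc v a}.ncard)
    (Set.toFinite _) ⟨a₀, b₀, hab₀, he₀ ▸ hS₀⟩
  refine ⟨{a, b}, habS, b, Or.inr rfl, ?_⟩
  rintro S' hS' ⟨v, hv, hvS'⟩
  by_contra hb
  have hva : v = a := by
    rcases hv with hv | hv
    · exact hv
    · rw [Set.mem_singleton_iff] at hv
      exact absurd (hv ▸ hvS') hb
  subst hva
  have hmod := (hpairs _ habS).1
  obtain ⟨hmod', c, d, hcd, rfl⟩ := hpairs S' hS'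
  have hvb : v ≠ b := ne_of_arc hab
  rcases hvS' with rfl | hvd
  · -- two modules `{v, b}` and `{v, d}` with `v → b` and `v → d`
    have hbd : b ≠ d := fun e => hb (Or.inr e)
    have e1 : T.arc b d := (hmod.arc_to_iff (Or.inl rfl) (Or.inr rfl)
      (by rintro (h | h); exacts [ne_of_arc hcd h.symm, hbd h.symm])).1 hcd
    have e2 : T.arc d b := (hmod'.arc_to_iff (Or.inl rfl) (Or.inr rfl) hb).1 hab
    exact not_arc_of_arc e1 e2
  · rw [Set.mem_singleton_iff] at hvd
    subst hvd
    have hlt : {w | T.arc w c}.ncard < {w | T.arc w v}.ncard := by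
      refine Set.ncard_lt_ncard ⟨fun w hw => ?_, fun h => T.irrefl c (h hcd)⟩
      by_cases hwS : w ∈ ({c, v} : Set V)
      · rcases hwS with h | h
        · exact absurd h (ne_of_arc hw)
        · exact absurd hcd (not_arc_of_arc ((show w = v from h) ▸ hw))
      · exact (hmod' c (Or.inl rfl) v (Or.inr rfl) w hwS).1 hw
    exact absurd (hmin c ⟨v, hcd, hS'⟩) (not_le.2 hlt)

/-- For minimal co-modules, some hitting set is no larger than some disjoint family. -/
theorem exists_hitting_packing [Finite V] (N : ℕ) : ∀ 𝓢 : Finset (Set V), 𝓢.card ≤ N →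
    (∀ S ∈ 𝓢, T.MinComod S) → ∃ H : Set V, ∃ F ⊆ 𝓢,
      (∀ A ∈ F, ∀ B ∈ F, A ≠ B → Disjoint A B) ∧ H.ncard ≤ F.card ∧
      ∀ S ∈ 𝓢, ∃ h ∈ H, h ∈ S := by
  classical
  induction N with
  | zero =>
    intro 𝓢 hc _
    obtain rfl := Finset.card_eq_zero.1 (Nat.le_zero.1 hc)
    exact ⟨∅, ∅, subset_rfl, by simp, by simp, by simp⟩
  | succ N ih =>
    intro 𝓢 hc h𝓢
    rcases 𝓢.eq_empty_or_nonempty with rfl | hne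
    · exact ⟨∅, ∅, subset_rfl, by simp, by simp, by simp⟩
    obtain ⟨S, hS, h, hh, hsimp⟩ := exists_simplicial h𝓢 hne
    have hlt : (𝓢.filter fun A => h ∉ A).card < 𝓢.card :=
      Finset.card_lt_card ⟨Finset.filter_subset _ _, fun hsub =>
        (Finset.mem_filter.1 (hsub hS)).2 hh⟩
    obtain ⟨H, F, hF, hd, hcard, hhit⟩ := ih (𝓢.filter fun A => h ∉ A) (by omega)
      fun A hA => h𝓢 A (Finset.mem_filter.1 hA).1
    have hSF : ∀ A ∈ F, Disjoint S A := by
      intro A hA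
      rw [Set.disjoint_left]
      intro v hv hvA
      have := Finset.mem_filter.1 (hF hA)
      exact this.2 (hsimp A this.1 ⟨v, hv, hvA⟩)
    have hSn : S ∉ F := fun h' => (Finset.mem_filter.1 (hF h')).2 hh
    refine ⟨insert h H, insert S F, ?_, ?_, ?_, ?_⟩
    · exact Finset.insert_subset hS (hF.trans (Finset.filter_subset _ _))
    · intro A hA B hB hAB
      rcases Finset.mem_insert.1 hA with eA | hA' <;> rcases Finset.mem_insert.1 hB with eB | hB'
      · exact absurd (eA.trans eB.symm) hAB
      · exact eA ▸ hSF B hB'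
      · exact eB ▸ (hSF A hA').symm
      · exact hd A hA' B hB' hAB
    · rw [Finset.card_insert_of_notMem hSn]
      exact (Set.ncard_insert_le h H).trans (Nat.succ_le_succ hcard)
    · intro A hA
      by_cases hhA : h ∈ A
      · exact ⟨h, Or.inl rfl, hhA⟩
      · obtain ⟨w, hw, hwA⟩ := hhit A (Finset.mem_filter.2 ⟨hA, hhA⟩)
        exact ⟨w, Or.inr hw, hwA⟩

/-- If every family of disjoint minimal co-modules has at most `2 k` members, then `k` reversals
suffice. -/
theorem decompIndex_le_of_packing [Finite V] (hV : 5 ≤ Nat.card V) {k : ℕ}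
    (h : ∀ F : Finset (Set V), (∀ A ∈ F, T.MinComod A) →
      (∀ A ∈ F, ∀ B ∈ F, A ≠ B → Disjoint A B) → F.card ≤ 2 * k) : T.decompIndex ≤ k := by
  have hfin : {S | T.MinComod S}.Finite := Set.toFinite _
  obtain ⟨H, F, hF, hd, hcard, hhit⟩ := exists_hitting_packing (T := T) _ hfin.toFinset le_rfl
    fun S hS => hfin.mem_toFinset.1 hS
  refine (near_of_hits hV k T H (fun C hC => ?_)
    (hcard.trans (h F (fun A hA => hfin.mem_toFinset.1 (hF hA)) hd))).decompIndex_le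
  obtain ⟨D, hDC, hD⟩ := hC.exists_minComod
  obtain ⟨w, hw, hwD⟩ := hhit D (hfin.mem_toFinset.2 hD)
  exact ⟨w, hw, hDC hwD⟩

theorem sum_ncard_add_ncard_sdiff [Finite V] {F : Finset (Set V)}
    (hd : ∀ A ∈ F, ∀ B ∈ F, A ≠ B → Disjoint A B) {W : Set V} (hW : ∀ A ∈ F, A ⊆ W) :
    ∑ A ∈ F, A.ncard + (W \ ⋃ A ∈ F, A).ncard = W.ncard := by
  classical
  have := Fintype.ofFinite V
  have h1 : (⋃ A ∈ F, A).ncard = ∑ A ∈ F, A.ncard := by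
    have : (⋃ A ∈ F, A) = ((F.biUnion fun A => A.toFinset : Finset V) : Set V) := by
      ext v
      simp
    rw [this, Set.ncard_coe_finset, Finset.card_biUnion]
    · exact Finset.sum_congr rfl fun A _ => (Set.ncard_eq_toFinset_card' A).symm
    · intro A hA B hB hAB
      exact Set.disjoint_toFinset.2 (hd A hA B hB hAB)
  rw [← h1, add_comm]
  exact Set.ncard_sdiff_add_ncard_of_subset (Set.iUnion₂_subset hW)

/-- At most two minimal co-modules have a single vertex. -/
theorem card_filter_subsingleton_le [Finite V] {F : Finset (Set V)}
    (hF : ∀ A ∈ F, T.MinComod A) [DecidablePred fun A : Set V => A.Nontrivial] :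
    (F.filter fun A => ¬ A.Nontrivial).card ≤ 2 := by
  classical
  by_contra hcon
  rw [not_le] at hcon
  obtain ⟨A, B, C, hA, hB, hC, hAB, hAC, hBC⟩ := Finset.two_lt_card_iff.1 hcon
  have key : ∀ D ∈ F.filter fun A => ¬ A.Nontrivial, ∃ s, D = {s} ∧
      (T.IsSource s ∨ T.dual.IsSource s) := by
    intro D hD
    obtain ⟨hDF, hDn⟩ := Finset.mem_filter.1 hD
    obtain ⟨s, hs⟩ := (hF D hDF).1.nonempty
    have he := (Set.not_nontrivial_iff.1 hDn).eq_singleton_of_mem hs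
    exact ⟨s, he, (he ▸ (hF D hDF).1 : T.Comod {s}).source_or_sink⟩
  obtain ⟨a, rfl, ha⟩ := key A hA
  obtain ⟨b, rfl, hb⟩ := key B hB
  obtain ⟨c, rfl, hc⟩ := key C hC
  have hab : a ≠ b := fun e => hAB (e ▸ rfl)
  have hac : a ≠ c := fun e => hAC (e ▸ rfl)
  have hbc : b ≠ c := fun e => hBC (e ▸ rfl)
  rcases ha with ha | ha <;> rcases hb with hb | hb <;> rcases hc with hc | hc <;>
    first
    | exact hab (ha.unique hb)
    | exact hac (ha.unique hc)
    | exact hbc (hb.unique hc)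

theorem card_packing_le [Finite V] {F : Finset (Set V)} (hF : ∀ A ∈ F, T.MinComod A)
    (hd : ∀ A ∈ F, ∀ B ∈ F, A ≠ B → Disjoint A B) : 2 * F.card ≤ Nat.card V + 2 := by
  classical
  have h1 := sum_ncard_add_ncard_sdiff hd (W := Set.univ) fun A _ => Set.subset_univ A
  rw [Set.ncard_univ] at h1
  have h2 := card_filter_subsingleton_le hF
  have h3 : 2 * F.card ≤ ∑ A ∈ F, (A.ncard + if ¬ A.Nontrivial then 1 else 0) := by
    rw [mul_comm, ← smul_eq_mul]
    refine Finset.card_nsmul_le_sum _ _ _ fun A hA => ?_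
    split_ifs with h
    · have := Set.one_lt_ncard_iff_nontrivial.2 h
      omega
    · have := (Set.ncard_pos).2 (hF A hA).1.nonempty
      omega
  rw [Finset.sum_add_distrib, ← Finset.card_filter] at h3
  omega

/-! ### Indecomposable tournaments with at most five vertices -/

/-- A search for a nontrivial module in the tournament with adjacency matrix `A`. -/
def hasModule {n : ℕ} (A : Fin n → Fin n → Bool) : Bool :=
  (List.finRange n).sublists.any fun M =>
    (M.any fun x => M.any fun y => !decide (x = y)) &&
    ((List.finRange n).any fun z => !decide (z ∈ M)) &&
    M.all fun x => M.all fun y => (List.finRange n).all fun v =>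
      decide (v ∈ M) || (A v x == A v y)

/-- The adjacency matrix of a four-vertex tournament containing the 3-cycle `0 → 1 → 2 → 0`. -/
def adj₄ (b₀ b₁ b₂ : Bool) : Fin 4 → Fin 4 → Bool :=
  ![![false, true, false, b₀], ![false, false, true, b₁], ![true, false, false, b₂],
    ![!b₀, !b₁, !b₂, false]]

/-- The adjacency matrix of a five-vertex tournament containing the 3-cycle `0 → 1 → 2 → 0`. -/
def adj₅ (b₀ b₁ b₂ b₃ b₄ b₅ b₆ : Bool) : Fin 5 → Fin 5 → Bool :=
  ![![false, true, false, b₀, b₃], ![false, false, true, b₁, b₄], ![true, false, false, b₂, b₅],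
    ![!b₀, !b₁, !b₂, false, b₆], ![!b₃, !b₄, !b₅, !b₆, false]]

/-- A backtracking search for an isomorphism from `B` onto `A`. -/
def hasIso (B A : Fin 5 → Fin 5 → Bool) : Bool :=
  let ok (p q g h : Fin 5) : Bool := (B p q == A g h) && (B q p == A h g)
  let L := List.finRange 5
  L.any fun g₀ => L.any fun g₁ => ok 0 1 g₀ g₁ && L.any fun g₂ => ok 0 2 g₀ g₂ && ok 1 2 g₁ g₂ &&
    L.any fun g₃ => ok 0 3 g₀ g₃ && ok 1 3 g₁ g₃ && ok 2 3 g₂ g₃ && L.any fun g₄ =>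
      L.all fun p => L.all fun q => B p q == A (![g₀, g₁, g₂, g₃, g₄] p) (![g₀, g₁, g₂, g₃, g₄] q)

/-- The adjacency matrix of `U₅`. -/
def adjU : Fin 5 → Fin 5 → Bool :=
  ![![false, true, true, false, false], ![false, false, true, true, false],
    ![false, false, false, true, true], ![true, false, false, false, true],
    ![true, true, false, false, false]]

/-- The adjacency matrix of `V₅`. -/
def adjV : Fin 5 → Fin 5 → Bool :=
  ![![false, true, true, false, false], ![false, false, true, true, false],
    ![false, false, false, true, true], ![true, false, false, false, false],
    ![true, true, false, true, false]]

/-- The adjacency matrix of `W₅`. -/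
def adjW : Fin 5 → Fin 5 → Bool :=
  ![![false, true, true, true, false], ![false, false, true, true, true],
    ![false, false, false, true, false], ![false, false, false, false, true],
    ![true, false, true, false, false]]

theorem hasModule_adj₄ : ∀ b₀ b₁ b₂ : Bool, hasModule (adj₄ b₀ b₁ b₂) = true := by
  decide +kernel

theorem hasModule_or_hasIso : ∀ b₀ b₁ b₂ b₃ b₄ b₅ b₆ : Bool,
    (hasModule (adj₅ b₀ b₁ b₂ b₃ b₄ b₅ b₆) || hasIso adjU (adj₅ b₀ b₁ b₂ b₃ b₄ b₅ b₆) ||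
      hasIso adjV (adj₅ b₀ b₁ b₂ b₃ b₄ b₅ b₆) || hasIso adjW (adj₅ b₀ b₁ b₂ b₃ b₄ b₅ b₆)) =
      true := by
  decide +kernel

theorem not_primeIn_of_hasModule {n : ℕ} {C : Set V} {v : Fin n → V} (hv : Function.Injective v)
    (hr : Set.range v = C) {A : Fin n → Fin n → Bool}
    (hA : ∀ i j, A i j = true ↔ T.arc (v i) (v j)) (h : hasModule A = true) : ¬ T.PrimeIn C := by
  intro hp
  simp only [hasModule, List.any_eq_true, Bool.and_eq_true, List.all_eq_true, Bool.or_eq_true,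
    Bool.not_eq_true', decide_eq_false_iff_not, decide_eq_true_eq, beq_iff_eq,
    List.mem_finRange, true_and, forall_true_left] at h
  obtain ⟨M, -, ⟨⟨x, hx, y, hy, hxy⟩, z, hz⟩, hM⟩ := h
  have hmod : T.ModIn C (v '' {i | i ∈ M}) := by
    rintro _ ⟨i, hi, rfl⟩ _ ⟨j, hj, rfl⟩ w hw hwM
    rw [← hr] at hw
    obtain ⟨k, rfl⟩ := hw
    have := (hM i hi j hj k).resolve_left fun h => hwM ⟨k, h, rfl⟩
    rw [← hA, ← hA, this]
  rcases hp _ (by rw [← hr]; exact Set.image_subset_range _ _) hmod with h | h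
  · exact hxy (hv (h ⟨x, hx, rfl⟩ ⟨y, hy, rfl⟩))
  · have : v z ∈ v '' {i | i ∈ M} := by
      rw [h, ← hr]
      exact ⟨z, rfl⟩
    obtain ⟨w, hw, he⟩ := this
    exact hz (hv he ▸ hw)

/-- The subtournament of `T` induced on `C` is isomorphic to `S`: there is an arc-preserving map
from the vertices of `S` onto `C`. Such a map between tournaments is automatically injective. -/
def IsoOn (T : Tournament V) (C : Set V) (S : BTournament) : Prop :=
  ∃ g : S.V → V, Set.range g = C ∧ ∀ a b, S.tour.arc a b → T.arc (g a) (g b)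

theorem injective_of_arc {S : BTournament} {g : S.V → V}
    (hg : ∀ a b, S.tour.arc a b → T.arc (g a) (g b)) : Function.Injective g := by
  intro a b hab
  by_contra hne
  by_cases h : S.tour.arc a b
  · exact ne_of_arc (hg a b h) hab
  · exact ne_of_arc (hg b a (arc_of_not_arc hne h)) hab.symm

theorem arc_iff_of_arc {S : BTournament} {g : S.V → V}
    (hg : ∀ a b, S.tour.arc a b → T.arc (g a) (g b)) (a b : S.V) :
    S.tour.arc a b ↔ T.arc (g a) (g b) := by
  refine ⟨hg a b, fun h => ?_⟩
  by_contra h'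
  have hne : a ≠ b := fun e => ne_of_arc h (e ▸ rfl)
  exact not_arc_of_arc h (hg b a (arc_of_not_arc hne h'))

theorem IsoOn.isoTo {S : BTournament} (h : T.IsoOn Set.univ S) : T.IsoTo S := by
  obtain ⟨g, hr, hg⟩ := h
  refine ⟨RelIso.symm ⟨Equiv.ofBijective g ⟨injective_of_arc hg, Set.range_eq_univ.1 hr⟩, ?_⟩⟩
  intro a b
  exact (arc_iff_of_arc hg a b).symm

theorem isoOn_mk {n : ℕ} {S : Tournament (Fin n)} {C : Set V} (g : Fin n → V)
    (hr : Set.range g = C) (hg : ∀ i j, S.arc i j → T.arc (g i) (g j)) :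
    T.IsoOn C ⟨Fin n, S⟩ :=
  ⟨g, hr, hg⟩

theorem isoOn_lin_one (a : V) : T.IsoOn {a} (lin 1) := by
  refine isoOn_mk ![a] (by simp) fun i j h => ?_
  have h' : i < j := h
  omega

theorem isoOn_lin_two {C : Set V} (h : C.ncard = 2) : T.IsoOn C (lin 2) := by
  have key : ∀ a b, T.arc a b → T.IsoOn {a, b} (lin 2) := by
    intro a b hab
    refine isoOn_mk ![a, b] (by simp [Set.pair_comm]) fun i j h => ?_
    have h' : i < j := h
    obtain rfl : i = 0 := by omega
    obtain rfl : j = 1 := by omega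
    exact hab
  obtain ⟨a, b, hab, rfl⟩ := Set.ncard_eq_two.1 h
  by_cases h : T.arc a b
  · exact key a b h
  · rw [Set.pair_comm]
    exact key b a (arc_of_not_arc hab h)

/-- An indecomposable tournament with at least three vertices contains a 3-cycle. -/
theorem PrimeIn.exists_three_cycle [Finite V] {C : Set V} (hp : T.PrimeIn C)
    (hc : 3 ≤ C.ncard) :
    ∃ x ∈ C, ∃ y ∈ C, ∃ z ∈ C, T.arc x y ∧ T.arc y z ∧ T.arc z x := by
  obtain ⟨a, b, c, ha, hb, hc, hab, hac, hbc⟩ := (Set.two_lt_ncard_iff (s := C)).1 hc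
  have hns : ¬ ∀ v ∈ C, ∀ w ∈ C, v ≠ a → w ≠ a → (T.arc a v ↔ T.arc a w) := by
    intro h
    rcases hp (C \ {a}) Set.sdiff_subset (fun v hv w hw u huC hu => by
      obtain rfl : u = a := by
        by_contra hne
        exact hu ⟨huC, hne⟩
      exact h v hv.1 w hw.1 hv.2 hw.2) with h' | h'
    · exact hbc (h' ⟨hb, hab.symm⟩ ⟨hc, hac.symm⟩)
    · exact (h'.ge ha).2 rfl
  have hout : ∃ v ∈ C, T.arc a v := by
    by_contra! h
    exact hns fun v hv w hw _ _ => iff_of_false (h v hv) (h w hw)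
  have hin : ∃ v ∈ C, T.arc v a := by
    by_contra! h
    exact hns fun v hv w hw h1 h2 => iff_of_true (arc_of_not_arc h1 (h v hv))
      (arc_of_not_arc h2 (h w hw))
  obtain ⟨p, hpC, hap⟩ := hout
  obtain ⟨q, hqC, hqa⟩ := hin
  by_contra! hcon
  -- otherwise `a` and its in-neighbours form a nontrivial module
  rcases hp {v ∈ C | ¬ T.arc a v} (Set.sep_subset _ _) (fun v hv w hw u huC hu => by
    have hau : T.arc a u := by
      by_contra h
      exact hu ⟨huC, h⟩
    have key : ∀ v ∈ C, ¬ T.arc a v → ¬ T.arc u v := by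
      intro v hv hav huv
      by_cases hva : v = a
      · exact not_arc_of_arc hau (hva ▸ huv)
      · exact hcon a ha u huC v hv hau huv (arc_of_not_arc (Ne.symm hva) hav)
    exact iff_of_false (key v hv.1 hv.2) (key w hw.1 hw.2)) with h | h
  · exact ne_of_arc hqa (h ⟨hqC, not_arc_of_arc hqa⟩ ⟨ha, T.irrefl a⟩)
  · exact (h.ge hpC).2 hap

theorem PrimeIn.exists_three_cycle_union [Finite V] {C : Set V} (hp : T.PrimeIn C)
    (hc : 3 ≤ C.ncard) :
    ∃ x y z D, T.arc x y ∧ T.arc y z ∧ T.arc z x ∧ C = {x, y, z} ∪ D ∧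
      (∀ d ∈ D, d ≠ x ∧ d ≠ y ∧ d ≠ z) ∧ D.ncard + 3 = C.ncard := by
  obtain ⟨x, hx, y, hy, z, hz, hxy, hyz, hzx⟩ := hp.exists_three_cycle hc
  have h3 : ({x, y, z} : Set V).ncard = 3 :=
    Set.ncard_eq_three.2 ⟨x, y, z, ne_of_arc hxy, (ne_of_arc hzx).symm, ne_of_arc hyz, rfl⟩
  have hsub : {x, y, z} ⊆ C := by
    rintro v (rfl | rfl | rfl)
    · exact hx
    · exact hy
    · exact hz
  refine ⟨x, y, z, C \ {x, y, z}, hxy, hyz, hzx, (Set.union_sdiff_cancel hsub).symm, ?_, ?_⟩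
  · intro d hd
    exact ⟨fun e => hd.2 (Or.inl e), fun e => hd.2 (Or.inr (Or.inl e)),
      fun e => hd.2 (Or.inr (Or.inr e))⟩
  · rw [← h3]
    exact Set.ncard_sdiff_add_ncard_of_subset hsub

theorem PrimeIn.isoOn_C₃ [Finite V] {C : Set V} (hp : T.PrimeIn C) (hc : C.ncard = 3) :
    T.IsoOn C C₃ := by
  obtain ⟨x, y, z, D, hxy, hyz, hzx, rfl, -, hD⟩ := hp.exists_three_cycle_union hc.ge
  obtain rfl : D = ∅ := (Set.ncard_eq_zero).1 (by omega)
  refine isoOn_mk ![x, y, z] ?_ ?_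
  · ext v
    simp
    tauto
  · intro i j hij
    change (i, j) ∈ [((0 : Fin 3), (1 : Fin 3)), (1, 2), (2, 0)] at hij
    simp only [List.mem_cons, Prod.mk.injEq, List.not_mem_nil, or_false] at hij
    rcases hij with ⟨rfl, rfl⟩ | ⟨rfl, rfl⟩ | ⟨rfl, rfl⟩
    · exact hxy
    · exact hyz
    · exact hzx

theorem PrimeIn.ncard_ne_four [Finite V] {C : Set V} (hp : T.PrimeIn C) : C.ncard ≠ 4 := by
  classical
  intro hc
  obtain ⟨x, y, z, D, hxy, hyz, hzx, rfl, hne, hD⟩ := hp.exists_three_cycle_union (by omega)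
  obtain ⟨d, rfl⟩ := Set.ncard_eq_one.1 (show D.ncard = 1 by omega)
  obtain ⟨hdx, hdy, hdz⟩ := hne d rfl
  have nxy := ne_of_arc hxy
  have nyz := ne_of_arc hyz
  have nzx := ne_of_arc hzx
  refine not_primeIn_of_hasModule (v := ![x, y, z, d]) ?_ ?_ ?_
    (hasModule_adj₄ (decide (T.arc x d)) (decide (T.arc y d)) (decide (T.arc z d))) hp
  · intro i j hij
    fin_cases i <;> fin_cases j <;> first | rfl | (simp at hij; grind)
  · ext v
    simp
    tauto
  · have e₁ := T.arc_iff d x hdx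
    have e₂ := T.arc_iff d y hdy
    have e₃ := T.arc_iff d z hdz
    intro i j
    fin_cases i <;> fin_cases j <;>
      simp [adj₄, T.irrefl, hxy, hyz, hzx, not_arc_of_arc hxy, not_arc_of_arc hyz,
        not_arc_of_arc hzx, e₁, e₂, e₃]

theorem hasIso_spec {B A : Fin 5 → Fin 5 → Bool} (h : hasIso B A = true) :
    ∃ g : Fin 5 → Fin 5, ∀ p q, B p q = A (g p) (g q) := by
  simp only [hasIso, List.any_eq_true, Bool.and_eq_true, List.all_eq_true, beq_iff_eq,
    List.mem_finRange, true_and, forall_true_left] at h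
  obtain ⟨g₀, g₁, -, g₂, -, g₃, -, g₄, h⟩ := h
  exact ⟨_, h⟩

theorem PrimeIn.isoOn_five [Finite V] {C : Set V} (hp : T.PrimeIn C) (hc : C.ncard = 5) :
    T.IsoOn C U₅ ∨ T.IsoOn C V₅ ∨ T.IsoOn C W₅ := by
  classical
  obtain ⟨x, y, z, D, hxy, hyz, hzx, rfl, hne, hD⟩ := hp.exists_three_cycle_union (by omega)
  obtain ⟨d, e, hde, rfl⟩ := Set.ncard_eq_two.1 (show D.ncard = 2 by omega)
  obtain ⟨hdx, hdy, hdz⟩ := hne d (Or.inl rfl)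
  obtain ⟨hex, hey, hez⟩ := hne e (Or.inr rfl)
  have nxy := ne_of_arc hxy
  have nyz := ne_of_arc hyz
  have nzx := ne_of_arc hzx
  have hinj : Function.Injective ![x, y, z, d, e] := by
    intro i j hij
    fin_cases i <;> fin_cases j <;> first | rfl | (simp at hij; grind)
  have hr : Set.range ![x, y, z, d, e] = {x, y, z} ∪ {d, e} := by
    ext v
    simp
    tauto
  obtain ⟨A, hA, h⟩ : ∃ A : Fin 5 → Fin 5 → Bool,
      (∀ i j, A i j = true ↔ T.arc (![x, y, z, d, e] i) (![x, y, z, d, e] j)) ∧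
      (hasModule A || hasIso adjU A || hasIso adjV A || hasIso adjW A) = true := by
    refine ⟨adj₅ (decide (T.arc x d)) (decide (T.arc y d)) (decide (T.arc z d))
      (decide (T.arc x e)) (decide (T.arc y e)) (decide (T.arc z e)) (decide (T.arc d e)), ?_,
      hasModule_or_hasIso _ _ _ _ _ _ _⟩
    have e₁ := T.arc_iff d x hdx
    have e₂ := T.arc_iff d y hdy
    have e₃ := T.arc_iff d z hdz
    have e₄ := T.arc_iff e x hex
    have e₅ := T.arc_iff e y hey
    have e₆ := T.arc_iff e z hez
    have e₇ := T.arc_iff e d hde.symm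
    intro i j
    fin_cases i <;> fin_cases j <;>
      simp [adj₅, T.irrefl, hxy, hyz, hzx, not_arc_of_arc hxy, not_arc_of_arc hyz,
        not_arc_of_arc hzx, e₁, e₂, e₃, e₄, e₅, e₆, e₇]
  have key : ∀ (S : Tournament (Fin 5)) (B : Fin 5 → Fin 5 → Bool),
      (∀ i j, S.arc i j → B i j = true) → hasIso B A = true →
      T.IsoOn ({x, y, z} ∪ {d, e}) ⟨Fin 5, S⟩ := by
    intro S B hSB hB
    obtain ⟨g, hg⟩ := hasIso_spec hB
    have harc : ∀ i j, S.arc i j → T.arc (![x, y, z, d, e] (g i)) (![x, y, z, d, e] (g j)) := by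
      intro i j hij
      rw [← hA, ← hg]
      exact hSB i j hij
    refine isoOn_mk (fun i => ![x, y, z, d, e] (g i)) ?_ harc
    have hgi : Function.Injective g := fun i j hij =>
      injective_of_arc (S := ⟨Fin 5, S⟩) harc (congrArg ![x, y, z, d, e] hij)
    rw [← hr]
    exact (Finite.injective_iff_surjective.1 hgi).range_comp ![x, y, z, d, e]
  simp only [Bool.or_eq_true] at h
  rcases h with ((h | h) | h) | h
  · exact absurd hp (not_primeIn_of_hasModule hinj hr hA h)
  · exact Or.inl (key _ adjU (by change ∀ i j, (i, j) ∈ _ → _; decide) h)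
  · exact Or.inr (Or.inl (key _ adjV (by change ∀ i j, (i, j) ∈ _ → _; decide) h))
  · exact Or.inr (Or.inr (key _ adjW (by change ∀ i j, (i, j) ∈ _ → _; decide) h))

/-! ### Lexicographic sums -/

theorem isoOn_lexSum {I : Type} {R : Tournament I} {F : I → BTournament} {q : I → Set V}
    (hq : ∀ i, T.IsoOn (q i) (F i))
    (hR : ∀ i j, R.arc i j → ∀ x ∈ q i, ∀ y ∈ q j, T.arc x y) :
    T.IsoOn (⋃ i, q i) (lexSum R F) := by
  choose g hr hg using hq
  refine ⟨fun x => g x.1 x.2, ?_, ?_⟩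
  · ext v
    simp only [Set.mem_range, Set.mem_iUnion, ← hr]
    constructor
    · rintro ⟨x, rfl⟩
      exact ⟨x.1, x.2, rfl⟩
    · rintro ⟨i, a, rfl⟩
      exact ⟨⟨i, a⟩, rfl⟩
  · rintro _ _ (⟨a, b, h⟩ | ⟨a, b, h⟩)
    · exact hR _ _ h _ (hr _ ▸ ⟨a, rfl⟩) _ (hr _ ▸ ⟨b, rfl⟩)
    · exact hg _ a b h

theorem IsoOn.exists_of_lexSum {I : Type} {R : Tournament I} {F : I → BTournament} {W : Set V}
    (h : T.IsoOn W (lexSum R F)) : ∃ q : I → Set V, (∀ i, T.IsoOn (q i) (F i)) ∧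
      (∀ i j, R.arc i j → ∀ x ∈ q i, ∀ y ∈ q j, T.arc x y) ∧ W = ⋃ i, q i := by
  obtain ⟨g, rfl, hg⟩ := h
  refine ⟨fun i => Set.range fun a => g ⟨i, a⟩, fun i => ⟨fun a => g ⟨i, a⟩, rfl,
    fun a b hab => hg _ _ (Sigma.Lex.right _ _ hab)⟩, ?_, ?_⟩
  · rintro i j hij _ ⟨a, rfl⟩ _ ⟨b, rfl⟩
    exact hg _ _ (Sigma.Lex.left _ _ hij)
  · ext v
    simp only [Set.mem_range, Set.mem_iUnion]
    constructor
    · rintro ⟨x, rfl⟩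
      exact ⟨x.1, x.2, rfl⟩
    · rintro ⟨i, a, rfl⟩
      exact ⟨⟨i, a⟩, rfl⟩

theorem disjoint_of_arc {I : Type} {R : Tournament I} {q : I → Set V}
    (hR : ∀ i j, R.arc i j → ∀ x ∈ q i, ∀ y ∈ q j, T.arc x y) {i j : I} (hij : i ≠ j) :
    Disjoint (q i) (q j) := by
  rw [Set.disjoint_left]
  intro v hi hj
  by_cases h : R.arc i j
  · exact T.irrefl v (hR i j h v hi v hj)
  · exact T.irrefl v (hR j i (arc_of_not_arc hij h) v hj v hi)

theorem IsoOn.of_isoTo {S : BTournament} (h : T.IsoTo S) : T.IsoOn Set.univ S := by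
  obtain ⟨e⟩ := h
  refine ⟨e.symm, Set.range_eq_univ.2 e.symm.surjective, fun a b hab => ?_⟩
  exact e.symm.map_rel_iff.2 hab

theorem IsoOn.ncard {S : BTournament} {W : Set V} (h : T.IsoOn W S) :
    W.ncard = Nat.card S.V := by
  obtain ⟨g, rfl, hg⟩ := h
  rw [← Nat.card_coe_set_eq, Nat.card_range_of_injective (injective_of_arc hg)]

/-- Disjoint nonempty modules `q 0, …, q (k - 1)` make up a lexicographic sum over the tournament
on their indices. -/
theorem exists_isoOn_subst {k : ℕ} {q : Fin k → Set V} (hm : ∀ i, T.IsModule (q i))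
    (hne : ∀ i, (q i).Nonempty) (hd : ∀ i j, i ≠ j → Disjoint (q i) (q j)) {L : List BTournament}
    (hL : ∀ i, T.IsoOn (q i) (L.getD i (lin 2))) :
    ∃ R : Tournament (Fin k), T.IsoOn (⋃ i, q i) (subst R L) := by
  have huni : ∀ i j, i ≠ j → ∀ x ∈ q i, ∀ y ∈ q j, ∀ x' ∈ q i, ∀ y' ∈ q j,
      T.arc x y → T.arc x' y' := by
    intro i j hij x hx y hy x' hx' y' hy' h
    have hx'j : x' ∉ q j := fun h => Set.disjoint_left.1 (hd i j hij) hx' h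
    have hyi : y ∉ q i := fun h => Set.disjoint_left.1 (hd i j hij) h hy
    exact (hm j y hy y' hy' x' hx'j).1 (((hm i).arc_to_iff hx hx' hyi).1 h)
  choose p hp using hne
  refine ⟨⟨fun i j => T.arc (p i) (p j), fun i => T.irrefl _, fun i j hij => T.arc_iff _ _
    fun e => Set.disjoint_left.1 (hd i j hij) (hp i) (e ▸ hp j)⟩, isoOn_lexSum hL ?_⟩
  intro i j hij x hx y hy
  have hne : i ≠ j := fun e => ne_of_arc (T := T) hij (e ▸ rfl)
  exact huni i j hne _ (hp i) _ (hp j) x hx y hy hij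

/-- The same for a finite family of disjoint modules, all of them pairs except for those in the
list `l`. -/
theorem exists_isoOn_subst_of_finset {P : Finset (Set V)} (hm : ∀ A ∈ P, T.IsModule A)
    (hne : ∀ A ∈ P, A.Nonempty) (hd : ∀ A ∈ P, ∀ B ∈ P, A ≠ B → Disjoint A B)
    {l : List (Set V)} (hnd : l.Nodup) (hl : ∀ A ∈ l, A ∈ P) {L : List BTournament}
    (hL : List.Forall₂ T.IsoOn l L) (h2 : ∀ A ∈ P, A ∉ l → A.ncard = 2) :
    ∃ k, ∃ R : Tournament (Fin k), L.length ≤ k ∧ T.IsoOn (⋃ A ∈ P, A) (subst R L) := by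
  classical
  set Q : List (Set V) := l ++ (P.filter fun A => A ∉ l).toList with hQ
  have hQP : ∀ A, A ∈ Q ↔ A ∈ P := by
    intro A
    simp only [hQ, List.mem_append, Finset.mem_toList, Finset.mem_filter]
    have := hl A
    tauto
  have hQn : Q.Nodup := by
    refine List.Nodup.append hnd (Finset.nodup_toList _) fun A h1 h2 => ?_
    exact (Finset.mem_filter.1 (Finset.mem_toList.1 h2)).2 h1
  have hlen := hL.length_eq
  have hQm : ∀ i : Fin Q.length, Q[i] ∈ P := fun i => (hQP _).1 (List.getElem_mem _)
  obtain ⟨R, hR⟩ := exists_isoOn_subst (T := T) (q := fun i : Fin Q.length => Q[i]) (L := L)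
    (fun i => hm _ (hQm i)) (fun i => hne _ (hQm i))
    (fun i j hij => hd _ (hQm i) _ (hQm j) fun e => hij (Fin.ext (hQn.getElem_inj_iff.1 e)))
    (fun i => by
      by_cases hi : (i : ℕ) < l.length
      · have hi' : (i : ℕ) < L.length := hlen ▸ hi
        rw [List.getD_eq_getElem _ _ hi']
        have : Q[i] = l[(i : ℕ)] := by
          simp only [hQ, Fin.getElem_fin]
          exact List.getElem_append_left hi
        rw [this]
        exact (List.forall₂_iff_get.1 hL).2 i hi hi'
      · rw [List.getD_eq_default _ _ (by omega)]
        refine isoOn_lin_two ?_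
        have : Q[i] ∈ (P.filter fun A => A ∉ l).toList := by
          have : Q[i] = (P.filter fun A => A ∉ l).toList[(i : ℕ) - l.length]'(by
              have := i.2
              simp only [hQ, List.length_append] at this
              omega) := by
            simp only [hQ, Fin.getElem_fin]
            exact List.getElem_append_right (by omega)
          rw [this]
          exact List.getElem_mem _
        have := Finset.mem_filter.1 (Finset.mem_toList.1 this)
        exact h2 _ this.1 this.2)
  refine ⟨Q.length, R, ?_, ?_⟩
  · rw [← hlen, hQ, List.length_append]
    omega
  · have : (⋃ i : Fin Q.length, Q[i]) = ⋃ A ∈ P, A := by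
      ext v
      simp only [Set.mem_iUnion]
      constructor
      · rintro ⟨i, hi⟩
        exact ⟨_, hQm i, hi⟩
      · rintro ⟨A, hA, hv⟩
        obtain ⟨i, hi, rfl⟩ := List.getElem_of_mem ((hQP A).2 hA)
        exact ⟨⟨i, hi⟩, hv⟩
    rwa [this] at hR

/-- Summation over the summands of `subst R L`. -/
theorem sum_getD (f : BTournament → ℕ) (L : List BTournament) : ∀ k, L.length ≤ k →
    ∑ i : Fin k, f (L.getD i (lin 2)) + f (lin 2) * L.length =
      f (lin 2) * k + (L.map f).sum := by
  induction L with
  | nil =>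
    intro k _
    simp [mul_comm]
  | cons S L ih =>
    intro k hk
    obtain ⟨k, rfl⟩ : ∃ k', k = k' + 1 := ⟨k - 1, by simp at hk; omega⟩
    have := ih k (by simpa using hk)
    rw [Fin.sum_univ_succ]
    simp only [Fin.val_zero, Fin.val_succ, List.getD_cons_zero, List.getD_cons_succ,
      List.length_cons, List.map_cons, List.sum_cons, mul_add]
    omega

theorem card_subst {k : ℕ} (R : Tournament (Fin k)) {L : List BTournament}
    (hf : ∀ S ∈ L, Finite S.V) (hk : L.length ≤ k) :
    Nat.card (subst R L).V + 2 * L.length = 2 * k + (L.map fun S => Nat.card S.V).sum := by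
  have hlin : Nat.card (lin 2).V = 2 := Nat.card_fin 2
  have hfin2 : Finite (lin 2).V := inferInstanceAs (Finite (Fin 2))
  have key := sum_getD (fun S => Nat.card S.V) L k hk
  simp only [hlin] at key
  rw [← key]
  congr 1
  have : ∀ i : Fin k, Finite (L.getD i (lin 2)).V := by
    intro i
    by_cases hi : (i : ℕ) < L.length
    · rw [List.getD_eq_getElem _ _ hi]
      exact hf _ (List.getElem_mem _)
    · rwa [List.getD_eq_default _ _ (by omega)]
  exact Nat.card_sigma

/-- `W` induces a lexicographic sum of the listed tournaments and otherwise of pairs. -/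
def IsSubst (T : Tournament V) (W : Set V) (L : List BTournament) : Prop :=
  ∃ k, ∃ R : Tournament (Fin k), L.length ≤ k ∧ T.IsoOn W (subst R L)

theorem finite_of_mem {S : BTournament} (h : S ∈ [lin 1, C₃, U₅, V₅, W₅]) : Finite S.V := by
  simp only [List.mem_cons, List.not_mem_nil, or_false] at h
  rcases h with rfl | rfl | rfl | rfl | rfl
  · exact inferInstanceAs (Finite (Fin 1))
  · exact inferInstanceAs (Finite (Fin 3))
  · exact inferInstanceAs (Finite (Fin 5))
  · exact inferInstanceAs (Finite (Fin 5))
  · exact inferInstanceAs (Finite (Fin 5))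

/-- Let `W` contain `m` disjoint nontrivial modules that are indecomposable, and let it have
`2 m + e` vertices, `1 ≤ e ≤ 3`. Then `W` is a lexicographic sum of pairs, of 3-cycles and single
vertices, `e` in all, or of pairs and one indecomposable tournament with five vertices. -/
theorem isSubst_of_modules [Finite V] {W : Set V} {G : Finset (Set V)}
    (hG : ∀ A ∈ G, T.IsModule A ∧ A.Nontrivial ∧ T.PrimeIn A ∧ A ⊆ W)
    (hd : ∀ A ∈ G, ∀ B ∈ G, A ≠ B → Disjoint A B) {e : ℕ} (he : e ≤ 3)
    (hc : W.ncard = 2 * G.card + e) :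
    (∃ a b, a + b = e ∧ T.IsSubst W (List.replicate a C₃ ++ List.replicate b (lin 1)) ∧
      T.IsSubst W (List.replicate b (lin 1) ++ List.replicate a C₃)) ∨
    (e = 3 ∧ (T.IsSubst W [U₅] ∨ T.IsSubst W [V₅] ∨ T.IsSubst W [W₅])) := by
  classical
  have hU : (W \ ⋃ A ∈ G, A).Finite := Set.toFinite _
  set U : Finset V := hU.toFinset with hUdef
  have hUm : ∀ v, v ∈ U ↔ v ∈ W ∧ ∀ A ∈ G, v ∉ A := by
    intro v
    simp [hUdef]
  set A₃ : Finset (Set V) := G.filter fun A => A.ncard ≠ 2 with hA₃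
  have hsum := sum_ncard_add_ncard_sdiff hd fun A hA => (hG A hA).2.2.2
  rw [Set.ncard_eq_toFinset_card _ hU, ← hUdef] at hsum
  have h2 : ∀ A ∈ G, 2 ≤ A.ncard := fun A hA => Set.one_lt_ncard_iff_nontrivial.2 (hG A hA).2.1
  -- the excess of `W` over `2 m` comes from the large modules and the remaining vertices
  have hexc : ∑ A ∈ A₃, (A.ncard - 2) + U.card = e := by
    have h3 : ∑ A ∈ G, A.ncard = 2 * G.card + ∑ A ∈ G, (A.ncard - 2) := by
      rw [mul_comm, ← smul_eq_mul, ← Finset.sum_const, ← Finset.sum_add_distrib]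
      exact Finset.sum_congr rfl fun A hA => by have := h2 A hA; omega
    have h4 : ∑ A ∈ A₃, (A.ncard - 2) = ∑ A ∈ G, (A.ncard - 2) :=
      Finset.sum_filter_of_ne fun A hA h => by omega
    omega
  have hA : ∀ A ∈ A₃, A ∈ G ∧ 3 ≤ A.ncard := fun A hA => by
    have := Finset.mem_filter.1 hA
    have := h2 A this.1
    exact ⟨‹_ ∧ _›.1, by omega⟩
  -- the parts are the modules in `G` and the remaining single vertices
  set P : Finset (Set V) := G ∪ U.image fun v => {v} with hP
  have hPm : ∀ A ∈ P, A ∈ G ∨ ∃ v ∈ U, A = {v} := by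
    intro A hA
    rcases Finset.mem_union.1 hA with h | h
    · exact Or.inl h
    · obtain ⟨v, hv, rfl⟩ := Finset.mem_image.1 h
      exact Or.inr ⟨v, hv, rfl⟩
  have hPW : (⋃ A ∈ P, A) = W := by
    ext v
    simp only [Set.mem_iUnion]
    constructor
    · rintro ⟨A, hA, hv⟩
      rcases hPm A hA with h | ⟨w, hw, rfl⟩
      · exact (hG A h).2.2.2 hv
      · rw [show v = w from hv]
        exact ((hUm w).1 hw).1
    · intro hv
      by_cases h : ∃ A ∈ G, v ∈ A
      · obtain ⟨A, hA, hvA⟩ := h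
        exact ⟨A, Finset.mem_union_left _ hA, hvA⟩
      · push Not at h
        exact ⟨{v}, Finset.mem_union_right _ (Finset.mem_image_of_mem _ ((hUm v).2 ⟨hv, h⟩)), rfl⟩
  have hPd : ∀ A ∈ P, ∀ B ∈ P, A ≠ B → Disjoint A B := by
    intro A hA B hB hAB
    rcases hPm A hA with hA | ⟨v, hv, rfl⟩ <;> rcases hPm B hB with hB | ⟨w, hw, rfl⟩
    · exact hd A hA B hB hAB
    · exact Set.disjoint_singleton_right.2 (((hUm w).1 hw).2 A hA)
    · exact Set.disjoint_singleton_left.2 (((hUm v).1 hv).2 B hB)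
    · exact Set.disjoint_singleton.2 fun h => hAB (h ▸ rfl)
  set lU : List (Set V) := U.toList.map fun v => {v} with hlU
  have hlUm : ∀ A, A ∈ lU ↔ ∃ v ∈ U, A = {v} := by
    intro A
    simp [hlU, eq_comm]
  have hlUn : lU.Nodup := (Finset.nodup_toList U).map Set.singleton_injective
  have hdis : List.Disjoint A₃.toList lU := by
    intro A h1 h2
    obtain ⟨v, hv, rfl⟩ := (hlUm A).1 h2
    have := (hA _ (Finset.mem_toList.1 h1)).2
    rw [Set.ncard_singleton] at this
    omega
  have main : ∀ (l : List (Set V)) (L : List BTournament), l.Nodup →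
      (∀ A, A ∈ l ↔ A ∈ A₃.toList ∨ A ∈ lU) → List.Forall₂ T.IsoOn l L → T.IsSubst W L := by
    intro l L hn hm hL
    obtain ⟨k, R, h3, h4⟩ := exists_isoOn_subst_of_finset (T := T) (P := P) (l := l) (L := L)
      (fun A hA => by
        rcases hPm A hA with h | ⟨v, -, rfl⟩
        · exact (hG A h).1
        · exact isModule_of_subsingleton Set.subsingleton_singleton)
      (fun A hA => by
        rcases hPm A hA with h | ⟨v, -, rfl⟩
        · exact (hG A h).2.1.nonempty
        · exact Set.singleton_nonempty v)
      hPd hn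
      (fun A hAl => by
        rcases (hm A).1 hAl with h | h
        · exact Finset.mem_union_left _ (hA A (Finset.mem_toList.1 h)).1
        · obtain ⟨v, hv, rfl⟩ := (hlUm A).1 h
          exact Finset.mem_union_right _ (Finset.mem_image_of_mem _ hv))
      hL
      (fun A hAP hAl => by
        rw [hm, not_or, Finset.mem_toList] at hAl
        rcases hPm A hAP with h | h
        · by_contra h'
          exact hAl.1 (Finset.mem_filter.2 ⟨h, h'⟩)
        · exact absurd ((hlUm A).2 h) hAl.2)
    exact ⟨k, R, h3, hPW ▸ h4⟩
  have hrep : ∀ (l : List (Set V)) (S : BTournament), (∀ A ∈ l, T.IsoOn A S) →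
      List.Forall₂ T.IsoOn l (List.replicate l.length S) := by
    intro l S h
    induction l with
    | nil => exact List.Forall₂.nil
    | cons A l ih =>
      exact List.Forall₂.cons (h A (List.mem_cons_self ..))
        (ih fun B hB => h B (List.mem_cons_of_mem _ hB))
  have hLU := hrep lU (lin 1) fun A hA => by
    obtain ⟨v, -, rfl⟩ := (hlUm A).1 hA
    exact isoOn_lin_one v
  have hlUlen : lU.length = U.card := by simp [hlU]
  by_cases hall : ∀ A ∈ A₃, A.ncard = 3
  · left
    have hLA := hrep A₃.toList C₃ fun A hA' => by
      have := Finset.mem_toList.1 hA'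
      exact (hG A (hA A this).1).2.2.1.isoOn_C₃ (hall A this)
    refine ⟨A₃.toList.length, lU.length, ?_, ?_, ?_⟩
    · rw [Finset.sum_congr rfl fun A hA => by rw [hall A hA]] at hexc
      simp only [Finset.sum_const, smul_eq_mul] at hexc
      rw [Finset.length_toList, hlUlen]
      omega
    · exact main _ _ ((Finset.nodup_toList _).append hlUn hdis) (fun A => List.mem_append)
        (List.rel_append hLA hLU)
    · exact main _ _ (hlUn.append (Finset.nodup_toList _) hdis.symm)
        (fun A => List.mem_append.trans or_comm) (List.rel_append hLU hLA)
  · right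
    push Not at hall
    obtain ⟨A, hAA, hA3⟩ := hall
    have hA4 := (hG A (hA A hAA).1).2.2.1.ncard_ne_four
    have h3 := (hA A hAA).2
    rw [← Finset.add_sum_erase _ _ hAA] at hexc
    have hrest : A₃.erase A = ∅ := by
      by_contra hne
      obtain ⟨B, hB⟩ := Finset.nonempty_iff_ne_empty.2 hne
      have h5 : B.ncard - 2 ≤ _ := Finset.single_le_sum (f := fun A : Set V => A.ncard - 2)
        (fun _ _ => Nat.zero_le _) hB
      have := (hA B (Finset.mem_of_mem_erase hB)).2
      omega
    have hA₁ : A₃ = {A} := by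
      rw [← Finset.insert_erase hAA, hrest]
      rfl
    have hU0 : U.card = 0 := by omega
    have hlU0 : lU = [] := List.length_eq_zero_iff.1 (hlUlen.trans hU0)
    have main' : ∀ S, T.IsoOn A S → T.IsSubst W [S] := fun S hS =>
      main [A] [S] (List.nodup_singleton A) (fun B => by simp [hA₁, hlU0])
        (List.Forall₂.cons hS List.Forall₂.nil)
    refine ⟨by omega, ?_⟩
    exact ((hG A (hA A hAA).1).2.2.1.isoOn_five (by omega)).imp (main' _)
      (Or.imp (main' _) (main' _))

theorem card_lin_one : Nat.card (lin 1).V = 1 := Nat.card_fin 1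

theorem card_C₃ : Nat.card C₃.V = 3 := Nat.card_fin 3

theorem card_U₅ : Nat.card U₅.V = 5 := Nat.card_fin 5

theorem card_V₅ : Nat.card V₅.V = 5 := Nat.card_fin 5

theorem card_W₅ : Nat.card W₅.V = 5 := Nat.card_fin 5

theorem IsSubst.exists_isoOn {W : Set V} {L : List BTournament} (h : T.IsSubst W L)
    (hL : ∀ S ∈ L, S ∈ [lin 1, C₃, U₅, V₅, W₅]) {m : ℕ}
    (hm : W.ncard + 2 * L.length = 2 * m + (L.map fun S => Nat.card S.V).sum) :
    L.length ≤ m ∧ ∃ R : Tournament (Fin m), T.IsoOn W (subst R L) := by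
  obtain ⟨k, R, hk, hR⟩ := h
  have := card_subst R (fun S hS => finite_of_mem (hL S hS)) hk
  rw [← hR.ncard] at this
  obtain rfl : k = m := by omega
  exact ⟨hk, R, hR⟩

theorem isoTo_dual_iff {S : BTournament} : T.IsoTo S.dual ↔ T.dual.IsoTo S :=
  ⟨fun ⟨e⟩ => ⟨⟨e.toEquiv, fun {_ _} => e.map_rel_iff⟩⟩,
    fun ⟨e⟩ => ⟨⟨e.toEquiv, fun {_ _} => e.map_rel_iff⟩⟩⟩

theorem IsoOn.eq_singleton {A : Set V} (h : T.IsoOn A (lin 1)) : ∃ a, A = {a} :=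
  Set.ncard_eq_one.1 (h.ncard.trans card_lin_one)

theorem isoTo_twoOne_iff {X : BTournament} :
    T.IsoTo (twoOne X) ↔ ∃ s, T.IsSource s ∧ T.IsoOn {s}ᶜ X := by
  constructor
  · intro h
    obtain ⟨q, hq, hR, hu⟩ := (IsoOn.of_isoTo h).exists_of_lexSum
    obtain ⟨s, hs⟩ := (hq 0 : T.IsoOn (q 0) (lin 1)).eq_singleton
    have hsW : ∀ w ∈ q 1, T.arc s w := hR 0 1 (by decide : (0 : Fin 2) < 1) s (hs.ge rfl)
    have hW : q 1 = {s}ᶜ := by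
      ext v
      constructor
      · rintro hv rfl
        exact T.irrefl v (hsW v hv)
      · intro hv
        obtain ⟨i, hi⟩ := Set.mem_iUnion.1 (hu.le (Set.mem_univ v))
        fin_cases i
        · exact absurd (hs.le hi) hv
        · exact hi
    exact ⟨s, fun v hv => hsW v (hW.ge hv), hW ▸ (hq 1 : T.IsoOn (q 1) X)⟩
  · rintro ⟨s, hs, hX⟩
    have h := isoOn_lexSum (T := T) (R := transitive 2) (F := ![lin 1, X]) (q := ![{s}, {s}ᶜ])
      (by
        intro i
        fin_cases i
        · exact isoOn_lin_one s
        · exact hX)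
      (by
        intro i j hij x hx y hy
        have hij' : i < j := hij
        obtain rfl : i = 0 := by omega
        obtain rfl : j = 1 := by omega
        obtain rfl : x = s := hx
        exact hs y hy)
    have hu : (⋃ i, (![{s}, {s}ᶜ] : Fin 2 → Set V) i) = Set.univ := by
      refine Set.eq_univ_of_forall fun v => Set.mem_iUnion.2 ?_
      by_cases hv : v = s
      · exact ⟨0, hv⟩
      · exact ⟨1, hv⟩
    rw [hu] at h
    exact h.isoTo

theorem isoTo_threeOne_iff {X : BTournament} :
    T.IsoTo (threeOne X) ↔
      ∃ s t, s ≠ t ∧ T.IsSource s ∧ T.dual.IsSource t ∧ T.IsoOn {s, t}ᶜ X := by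
  constructor
  · intro h
    obtain ⟨q, hq, hR, hu⟩ := (IsoOn.of_isoTo h).exists_of_lexSum
    obtain ⟨s, hs⟩ := (hq 0 : T.IsoOn (q 0) (lin 1)).eq_singleton
    obtain ⟨t, ht⟩ := (hq 2 : T.IsoOn (q 2) (lin 1)).eq_singleton
    have hsW : ∀ w ∈ q 1, T.arc s w := hR 0 1 (by decide : (0 : Fin 3) < 1) s (hs.ge rfl)
    have hWt : ∀ w ∈ q 1, T.arc w t := fun w hw =>
      hR 1 2 (by decide : (1 : Fin 3) < 2) w hw t (ht.ge rfl)
    have hst : T.arc s t := hR 0 2 (by decide : (0 : Fin 3) < 2) s (hs.ge rfl) t (ht.ge rfl)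
    have hcov : ∀ v, v = s ∨ v ∈ q 1 ∨ v = t := by
      intro v
      obtain ⟨i, hi⟩ := Set.mem_iUnion.1 (hu.le (Set.mem_univ v))
      fin_cases i
      · exact Or.inl (hs.le hi)
      · exact Or.inr (Or.inl hi)
      · exact Or.inr (Or.inr (ht.le hi))
    have hW : q 1 = {s, t}ᶜ := by
      ext v
      constructor
      · rintro hv (rfl | rfl)
        · exact T.irrefl v (hsW v hv)
        · exact T.irrefl v (hWt v hv)
      · intro hv
        rcases hcov v with h | h | h
        · exact absurd (Or.inl h) hv
        · exact h
        · exact absurd (Or.inr h) hv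
    refine ⟨s, t, ne_of_arc hst, fun v hv => ?_, fun v hv => ?_, hW ▸ (hq 1 : T.IsoOn (q 1) X)⟩
    · rcases hcov v with h | h | rfl
      · exact absurd h hv
      · exact hsW v h
      · exact hst
    · rcases hcov v with rfl | h | h
      · exact hst
      · exact hWt v h
      · exact absurd h hv
  · rintro ⟨s, t, hst, hs, ht, hX⟩
    have h := isoOn_lexSum (T := T) (R := transitive 3) (F := ![lin 1, X, lin 1])
      (q := ![{s}, {s, t}ᶜ, {t}])
      (by
        intro i
        fin_cases i
        · exact isoOn_lin_one s
        · exact hX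
        · exact isoOn_lin_one t)
      (by
        intro i j hij x hx y hy
        have hij' : i < j := hij
        fin_cases i <;> fin_cases j <;> first | exact absurd hij' (by decide) | skip
        · obtain rfl : x = s := hx
          exact hs y fun e => hy (Or.inl e)
        · obtain rfl : x = s := hx
          obtain rfl : y = t := hy
          exact hs y hst.symm
        · obtain rfl : y = t := hy
          exact ht x fun e => hx (Or.inr e))
    have hu : (⋃ i, (![{s}, {s, t}ᶜ, {t}] : Fin 3 → Set V) i) = Set.univ := by
      refine Set.eq_univ_of_forall fun v => Set.mem_iUnion.2 ?_
      by_cases hv : v = s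
      · exact ⟨0, hv⟩
      by_cases hv' : v = t
      · exact ⟨2, hv'⟩
      · exact ⟨1, fun h => h.elim hv hv'⟩
    rw [hu] at h
    exact h.isoTo

theorem isoTo_cycOne_iff {X : BTournament} :
    T.IsoTo (cycOne X) ↔ ∃ a b, T.arc a b ∧ (∀ w ∈ ({a, b}ᶜ : Set V), T.arc b w ∧ T.arc w a) ∧
      T.IsoOn {a, b}ᶜ X := by
  have hC : ∀ i j : Fin 3, C₃.tour.arc i j ↔ (i, j) ∈ [((0 : Fin 3), (1 : Fin 3)), (1, 2), (2, 0)] :=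
    fun _ _ => Iff.rfl
  constructor
  · intro h
    obtain ⟨q, hq, hR, hu⟩ := (IsoOn.of_isoTo h).exists_of_lexSum
    obtain ⟨a, ha⟩ := (hq 0 : T.IsoOn (q 0) (lin 1)).eq_singleton
    obtain ⟨b, hb⟩ := (hq 1 : T.IsoOn (q 1) (lin 1)).eq_singleton
    have hab : T.arc a b := hR 0 1 ((hC _ _).2 (by decide)) a (ha.ge rfl) b (hb.ge rfl)
    have hbW : ∀ w ∈ q 2, T.arc b w := hR 1 2 ((hC _ _).2 (by decide)) b (hb.ge rfl)
    have hWa : ∀ w ∈ q 2, T.arc w a := fun w hw =>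
      hR 2 0 ((hC _ _).2 (by decide)) w hw a (ha.ge rfl)
    have hW : q 2 = {a, b}ᶜ := by
      ext v
      constructor
      · rintro hv (rfl | rfl)
        · exact T.irrefl v (hWa v hv)
        · exact T.irrefl v (hbW v hv)
      · intro hv
        obtain ⟨i, hi⟩ := Set.mem_iUnion.1 (hu.le (Set.mem_univ v))
        fin_cases i
        · exact absurd (Or.inl (ha.le hi)) hv
        · exact absurd (Or.inr (hb.le hi)) hv
        · exact hi
    exact ⟨a, b, hab, fun w hw => ⟨hbW w (hW.ge hw), hWa w (hW.ge hw)⟩,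
      hW ▸ (hq 2 : T.IsoOn (q 2) X)⟩
  · rintro ⟨a, b, hab, hW, hX⟩
    have h := isoOn_lexSum (T := T) (I := Fin 3) (R := C₃.tour) (F := ![lin 1, lin 1, X])
      (q := ![{a}, {b}, {a, b}ᶜ])
      (by
        intro i
        fin_cases i
        · exact isoOn_lin_one a
        · exact isoOn_lin_one b
        · exact hX)
      (by
        intro i j hij x hx y hy
        rw [hC] at hij
        simp only [List.mem_cons, Prod.mk.injEq, List.not_mem_nil, or_false] at hij
        rcases hij with ⟨rfl, rfl⟩ | ⟨rfl, rfl⟩ | ⟨rfl, rfl⟩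
        · obtain rfl : x = a := hx
          obtain rfl : y = b := hy
          exact hab
        · obtain rfl : x = b := hx
          exact (hW y hy).1
        · obtain rfl : y = a := hy
          exact (hW x hx).2)
    have hu : (⋃ i, (![{a}, {b}, {a, b}ᶜ] : Fin 3 → Set V) i) = Set.univ := by
      refine Set.eq_univ_of_forall fun v => Set.mem_iUnion.2 ?_
      by_cases hv : v = a
      · exact ⟨0, hv⟩
      by_cases hv' : v = b
      · exact ⟨1, hv'⟩
      · exact ⟨2, fun h => h.elim hv hv'⟩
    rw [hu] at h
    exact h.isoTo

/-! ### The listed tournaments have many disjoint co-modules -/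

/-- The set `W` contains `m` disjoint nontrivial modules of the subtournament it induces. -/
def HasInnerPacking (T : Tournament V) (W : Set V) (m : ℕ) : Prop :=
  ∃ c : Fin m → Set V, (∀ i, c i ⊆ W ∧ T.ModIn W (c i) ∧ (c i).Nontrivial) ∧
    ∀ i j, i ≠ j → Disjoint (c i) (c j)

/-- The cardinality of `subst R L`, and its disjoint modules: all summands with at least two
vertices. -/
theorem IsoOn.subst_facts [Finite V] {W : Set V} {k : ℕ} {R : Tournament (Fin k)}
    {L : List BTournament} (h : T.IsoOn W (subst R L))
    (hL : ∀ S ∈ L, S ∈ [lin 1, C₃, U₅, V₅, W₅]) (hk : L.length ≤ k) {m : ℕ}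
    (hm : m + L.length = k + (L.map fun S => if 2 ≤ Nat.card S.V then 1 else 0).sum) :
    W.ncard + 2 * L.length = 2 * k + (L.map fun S => Nat.card S.V).sum ∧
      T.HasInnerPacking W m := by
  refine ⟨?_, ?_⟩
  · rw [h.ncard]
    exact card_subst R (fun S hS => finite_of_mem (hL S hS)) hk
  obtain ⟨q, hq, hR, rfl⟩ := h.exists_of_lexSum
  have hlin : Nat.card (lin 2).V = 2 := Nat.card_fin 2
  have hsum := sum_getD (fun S => if 2 ≤ Nat.card S.V then 1 else 0) L k hk
  have hcard : (Finset.univ.filter fun i : Fin k =>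
      2 ≤ Nat.card (L.getD i (lin 2)).V).card = m := by
    rw [Finset.card_filter]
    simp only [hlin, le_refl, if_true] at hsum
    omega
  set e := Finset.orderEmbOfFin _ hcard
  have he : ∀ i, 2 ≤ (q (e i)).ncard := fun i => by
    rw [(hq (e i)).ncard]
    exact (Finset.mem_filter.1 (Finset.orderEmbOfFin_mem _ hcard i)).2
  refine ⟨fun i => q (e i), fun i => ⟨Set.subset_iUnion q _, ?_, ?_⟩, fun i j hij =>
    disjoint_of_arc hR fun h => hij (e.injective h)⟩
  · intro x hx y hy v hv hvq
    obtain ⟨j, hj⟩ := Set.mem_iUnion.1 hv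
    have hne : j ≠ e i := fun h => hvq (show v ∈ q (e i) from h ▸ hj)
    by_cases hji : R.arc j (e i)
    · exact iff_of_true (hR _ _ hji v hj x hx) (hR _ _ hji v hj y hy)
    · have hij := arc_of_not_arc hne hji
      exact iff_of_false (not_arc_of_arc (hR _ _ hij x hx v hj))
        (not_arc_of_arc (hR _ _ hij y hy v hj))
  · exact Set.one_lt_ncard_iff_nontrivial.1 (he i)

theorem HasInnerPacking.hasPacking {W : Set V} {m e : ℕ} (h : T.HasInnerPacking W m)
    (hW : T.IsModule W) (hWu : W ≠ Set.univ ∨ 2 ≤ m) {d : Fin e → Set V}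
    (hd : ∀ i, T.Comod (d i)) (hdd : ∀ i j, i ≠ j → Disjoint (d i) (d j))
    (hdW : ∀ i, Disjoint W (d i)) : T.HasPacking (m + e) := by
  obtain ⟨c, hc, hcd⟩ := h
  have hcu : ∀ i, c i ≠ Set.univ := by
    intro i hi
    rcases hWu with h | h
    · exact h (Set.univ_subset_iff.1 (hi ▸ (hc i).1))
    · have : Nontrivial (Fin m) := Fin.nontrivial_iff_two_le.2 h
      obtain ⟨j, hj⟩ := exists_ne i
      obtain ⟨x, hx⟩ := (hc j).2.2.nonempty
      exact Set.disjoint_left.1 (hcd j i hj) hx (hi ▸ Set.mem_univ x)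
  have hcm : ∀ i, T.Comod (c i) := by
    intro i
    refine Or.inl ⟨fun x hx y hy v hv => ?_, (hc i).2.2, hcu i⟩
    by_cases hvW : v ∈ W
    · exact (hc i).2.1 x hx y hy v hvW hv
    · exact hW x ((hc i).1 hx) y ((hc i).1 hy) v hvW
  refine ⟨Fin.append c d, fun i => ?_, fun i j => ?_⟩
  · induction i using Fin.addCases with
    | left i => simpa using hcm i
    | right i => simpa using hd i
  · induction i using Fin.addCases with
    | left i =>
      induction j using Fin.addCases with
      | left j =>
        intro hij
        simpa using hcd i j fun h => hij (h ▸ rfl)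
      | right j =>
        intro _
        simpa using (hdW j).mono_left (hc i).1
    | right i =>
      induction j using Fin.addCases with
      | left j =>
        intro _
        simpa using ((hdW i).mono_left (hc j).1).symm
      | right j =>
        intro hij
        simpa using hdd i j fun h => hij (h ▸ rfl)

theorem hasPacking_dual {m : ℕ} : T.dual.HasPacking m ↔ T.HasPacking m := by
  simp only [HasPacking, comod_dual]

theorem IsSource.isModule_compl {s : V} (hs : T.IsSource s) : T.IsModule {s}ᶜ := by
  intro x hx y hy v hv
  obtain rfl : v = s := not_not.1 hv
  exact iff_of_true (hs x hx) (hs y hy)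

theorem IsSource.comod [Finite V] (hV : 3 ≤ Nat.card V) {s : V} (hs : T.IsSource s) :
    T.Comod {s} := by
  refine comod_of_dominates hV ⟨s, rfl⟩ (fun e => ?_) ?_
  · have := Set.ncard_univ V
    rw [← e, Set.ncard_singleton] at this
    omega
  · rintro a rfl v hv
    exact hs v hv

theorem hasPacking_of_source [Finite V] (hV : 3 ≤ Nat.card V) {s : V} (hs : T.IsSource s) {m : ℕ}
    (h : T.HasInnerPacking {s}ᶜ m) : T.HasPacking (m + 1) :=
  h.hasPacking hs.isModule_compl (Or.inl fun e => (e.ge (Set.mem_univ s)) rfl)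
    (d := fun _ : Fin 1 => {s}) (fun _ => hs.comod hV)
    (fun i j hij => absurd (Subsingleton.elim i j) hij) fun _ => disjoint_compl_left

theorem hasPacking_of_source_sink [Finite V] (hV : 3 ≤ Nat.card V) {s t : V} (hst : s ≠ t)
    (hs : T.IsSource s) (ht : T.dual.IsSource t) {m : ℕ} (h : T.HasInnerPacking {s, t}ᶜ m) :
    T.HasPacking (m + 2) := by
  have hW : T.IsModule {s, t}ᶜ := by
    rw [← Set.singleton_union, Set.compl_union]
    exact hs.isModule_compl.inter (isModule_dual.1 ht.isModule_compl)
  refine h.hasPacking hW (Or.inl fun e => e.ge (Set.mem_univ s) (Or.inl rfl))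
    (d := ![{s}, {t}]) ?_ ?_ ?_
  · intro i
    fin_cases i
    · exact hs.comod hV
    · exact comod_dual.1 (ht.comod hV)
  · intro i j hij
    fin_cases i <;> fin_cases j <;> simp_all [eq_comm]
  · intro i
    fin_cases i <;> simp

theorem hasPacking_of_cycle {a b : V}
    (hW : ∀ w ∈ ({a, b}ᶜ : Set V), T.arc b w ∧ T.arc w a) {m : ℕ}
    (hn : ({a, b}ᶜ : Set V).Nontrivial) (h : T.HasInnerPacking {a, b}ᶜ m) :
    T.HasPacking (m + 1) := by
  have hm : T.IsModule {a, b}ᶜ := by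
    intro x hx y hy v hv
    rcases not_not.1 hv with rfl | hv
    · exact iff_of_false (not_arc_of_arc (hW x hx).2) (not_arc_of_arc (hW y hy).2)
    · obtain rfl : v = b := hv
      exact iff_of_true (hW x hx).1 (hW y hy).1
  have hu : ({a, b}ᶜ : Set V) ≠ Set.univ := fun e => e.ge (Set.mem_univ a) (Or.inl rfl)
  exact h.hasPacking hm (Or.inl hu) (d := fun _ : Fin 1 => {a, b})
    (fun _ => Or.inr ⟨hm, hn, hu⟩) (fun i j hij => absurd (Subsingleton.elim i j) hij)
    fun _ => disjoint_compl_left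

theorem hasPacking_transitive (m : ℕ) (hm : 2 ≤ m) : (transitive (2 * m + 1)).HasPacking m := by
  refine ⟨fun i => {x | (x : ℕ) / 2 = i}, fun i => Or.inl ⟨?_, ?_, ?_⟩, ?_⟩
  · intro x hx y hy v hv
    change v < x ↔ v < y
    change (x : ℕ) / 2 = i at hx
    change (y : ℕ) / 2 = i at hy
    change ¬ (v : ℕ) / 2 = i at hv
    rw [Fin.lt_def, Fin.lt_def]
    omega
  · have := i.2
    refine ⟨⟨2 * i, by omega⟩, ?_, ⟨2 * i + 1, by omega⟩, ?_, ?_⟩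
    · change 2 * (i : ℕ) / 2 = i
      omega
    · change (2 * (i : ℕ) + 1) / 2 = i
      omega
    · intro h
      have := congrArg Fin.val h
      simp only at this
      omega
  · intro h
    have h1 : (0 : ℕ) / 2 = i := h.ge (Set.mem_univ (⟨0, by omega⟩ : Fin (2 * m + 1)))
    have h2 : 2 / 2 = (i : ℕ) := h.ge (Set.mem_univ (⟨2, by omega⟩ : Fin (2 * m + 1)))
    omega
  · intro i j hij
    rw [Set.disjoint_left]
    intro x hx hx'
    exact hij (Fin.ext (hx.symm.trans hx'))

/-! ### Tournaments with many disjoint co-modules -/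

/-- `T` is one of the tournaments with `4 n + 3` vertices in the list of the theorem. -/
def IsListed (n : ℕ) (T : Tournament V) : Prop :=
    -- `T_{2n+2}(1, 2, …, 2)`
    (∃ R : Tournament (Fin (2 * n + 2)), T.IsoTo (subst R [lin 1])) ∨
    -- `T_{2n+1}(C₃, 2, …, 2)`
    (∃ R : Tournament (Fin (2 * n + 1)), T.IsoTo (subst R [C₃])) ∨
    -- `C₃(1, 1, T_{2n}(C₃, 2, …, 2))`
    (∃ R : Tournament (Fin (2 * n)), T.IsoTo (cycOne (subst R [C₃]))) ∨
    -- `C₃(1, 1, T_{2n+1}(1, 2, …, 2))`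
    (∃ R : Tournament (Fin (2 * n + 1)), T.IsoTo (cycOne (subst R [lin 1]))) ∨
    -- `2(1, T_{2n+2}(1, 1, 2, …, 2))` or its dual
    (∃ R : Tournament (Fin (2 * n + 2)),
      T.IsoTo (twoOne (subst R [lin 1, lin 1])) ∨
      T.IsoTo (twoOne (subst R [lin 1, lin 1])).dual) ∨
    -- `2(1, T_{2n+1}(C₃, 1, 2, …, 2))` or its dual
    (∃ R : Tournament (Fin (2 * n + 1)),
      T.IsoTo (twoOne (subst R [C₃, lin 1])) ∨
      T.IsoTo (twoOne (subst R [C₃, lin 1])).dual) ∨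
    -- `2(1, T_{2n}(C₃, C₃, 2, …, 2))` or its dual
    (∃ R : Tournament (Fin (2 * n)),
      T.IsoTo (twoOne (subst R [C₃, C₃])) ∨
      T.IsoTo (twoOne (subst R [C₃, C₃])).dual) ∨
    -- `3(1, T_{2n-1}(S₅, 2, …, 2), 1)` with `S₅` one of `U₅`, `V₅`, `W₅`
    (∃ R : Tournament (Fin (2 * n - 1)),
      T.IsoTo (threeOne (subst R [U₅])) ∨
      T.IsoTo (threeOne (subst R [V₅])) ∨
      T.IsoTo (threeOne (subst R [W₅]))) ∨
    -- `3(1, T_{2n+2}(1, 1, 1, 2, …, 2), 1)`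
    (∃ R : Tournament (Fin (2 * n + 2)),
      T.IsoTo (threeOne (subst R [lin 1, lin 1, lin 1]))) ∨
    -- `3(1, T_{2n}(C₃, C₃, 1, 2, …, 2), 1)` when `n ≥ 2`
    (2 ≤ n ∧ ∃ R : Tournament (Fin (2 * n)),
      T.IsoTo (threeOne (subst R [C₃, C₃, lin 1]))) ∨
    -- `3(1, T_{2n+1}(1, 1, C₃, 2, …, 2), 1)`
    (∃ R : Tournament (Fin (2 * n + 1)),
      T.IsoTo (threeOne (subst R [lin 1, lin 1, C₃]))) ∨
    -- `3(1, T_{2n-1}(C₃, C₃, C₃, 2, …, 2), 1)` when `n ≥ 2`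
    (2 ≤ n ∧ ∃ R : Tournament (Fin (2 * n - 1)),
      T.IsoTo (threeOne (subst R [C₃, C₃, C₃])))

theorem two_mul_card_le_ncard [Finite V] {G : Finset (Set V)} {W : Set V}
    (hG : ∀ A ∈ G, A.Nontrivial ∧ A ⊆ W) (hd : ∀ A ∈ G, ∀ B ∈ G, A ≠ B → Disjoint A B) :
    2 * G.card ≤ W.ncard := by
  have h1 := sum_ncard_add_ncard_sdiff hd fun A hA => (hG A hA).2
  have h2 : G.card • 2 ≤ ∑ A ∈ G, A.ncard := Finset.card_nsmul_le_sum _ _ _ fun A hA =>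
    Set.one_lt_ncard_iff_nontrivial.2 (hG A hA).1
  rw [smul_eq_mul] at h2
  omega

/-- A minimal co-module with two vertices that is not a module is a pair `a → b` such that the
remaining vertices lie between `b` and `a`. -/
theorem IsPrimeCore.exists_cycle {Y : Set V} (hY : T.IsPrimeCore Y) (hc : Y.ncard = 2) :
    ∃ a b, T.arc a b ∧ Y = {a, b} ∧ ∀ w ∈ ({a, b}ᶜ : Set V), T.arc b w ∧ T.arc w a := by
  obtain ⟨a, b, hab, rfl⟩ : ∃ a b, T.arc a b ∧ Y = {a, b} := by
    obtain ⟨a, b, hab, rfl⟩ := Set.ncard_eq_two.1 hc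
    by_cases h : T.arc a b
    · exact ⟨a, b, h, rfl⟩
    · exact ⟨b, a, arc_of_not_arc hab h, Set.pair_comm a b⟩
  refine ⟨a, b, hab, rfl, fun w hw => ?_⟩
  have hne := ne_of_arc hab
  have hwa : w ≠ a := fun e => hw (Or.inl e)
  have hwb : w ≠ b := fun e => hw (Or.inr e)
  have hp := hY.primeIn_insert w hw
  -- otherwise two of the three vertices `a`, `b`, `w` form a module
  have key : ∀ p q r, p ≠ q → r ≠ p → r ≠ q → insert w {a, b} = ({p, q, r} : Set V) →
      ¬ (T.arc r p ↔ T.arc r q) := by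
    intro p q r hpq hrp hrq he h
    rw [he] at hp
    have hmod : T.ModIn {p, q, r} {p, q} := by
      intro x hx y hy v hv hvM
      obtain rfl : v = r := by
        rcases hv with hv | hv | hv
        · exact absurd (Or.inl hv) hvM
        · exact absurd (Or.inr hv) hvM
        · exact hv
      rcases hx with rfl | hx <;> rcases hy with rfl | hy
      · exact Iff.rfl
      · exact (show y = q from hy) ▸ h
      · exact (show x = q from hx) ▸ h.symm
      · rw [show x = q from hx, show y = q from hy]
    rcases hp {p, q} (by rintro v (h | h); exacts [Or.inl h, Or.inr (Or.inl h)]) hmod with h' | h'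
    · exact hpq (h' (Or.inl rfl) (Or.inr rfl))
    · rcases h'.ge (Or.inr (Or.inr rfl)) with h' | h'
      · exact hrp h'
      · exact hrq h'
  have hbw : T.arc b w := by
    by_contra h
    have hwb' := arc_of_not_arc hwb.symm h
    exact key a w b hwa.symm hne.symm hwb.symm
      (by ext v; simp only [Set.mem_insert_iff, Set.mem_singleton_iff]; tauto)
      (iff_of_false (not_arc_of_arc hab) h)
  refine ⟨hbw, ?_⟩
  by_contra h
  exact key b w a hwb.symm hne hwa.symm
    (by ext v; simp only [Set.mem_insert_iff, Set.mem_singleton_iff]; tauto)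
    (iff_of_true hab (arc_of_not_arc hwa h))

/-- A source and `2 n` disjoint indecomposable modules, among `4 n + 3` vertices: the other vertices
exceed two for each module by two. -/
theorem isoTo_twoOne_of_modules [Finite V] {n : ℕ} {s : V} (hs : T.IsSource s)
    {G : Finset (Set V)}
    (hG : ∀ A ∈ G, T.IsModule A ∧ A.Nontrivial ∧ T.PrimeIn A ∧ A ⊆ {s}ᶜ)
    (hd : ∀ A ∈ G, ∀ B ∈ G, A ≠ B → Disjoint A B) (hGc : G.card = 2 * n)
    (hc : ({s}ᶜ : Set V).ncard = 4 * n + 2) :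
    (∃ R : Tournament (Fin (2 * n + 2)), T.IsoTo (twoOne (subst R [lin 1, lin 1]))) ∨
    (∃ R : Tournament (Fin (2 * n + 1)), T.IsoTo (twoOne (subst R [C₃, lin 1]))) ∨
    (∃ R : Tournament (Fin (2 * n)), T.IsoTo (twoOne (subst R [C₃, C₃]))) := by
  have hiso : ∀ X, T.IsoOn {s}ᶜ X → T.IsoTo (twoOne X) := fun X hX =>
    isoTo_twoOne_iff.2 ⟨s, hs, hX⟩
  rcases isSubst_of_modules hG hd (e := 2) (by omega) (by omega) with ⟨i, j, hij, h, -⟩ | ⟨h, -⟩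
  · obtain ⟨rfl, rfl⟩ | ⟨rfl, rfl⟩ | ⟨rfl, rfl⟩ :
        i = 0 ∧ j = 2 ∨ i = 1 ∧ j = 1 ∨ i = 2 ∧ j = 0 := by omega
    · obtain ⟨-, R, hR⟩ := IsSubst.exists_isoOn (L := [lin 1, lin 1]) h (by simp)
        (m := 2 * n + 2) (by simp [card_lin_one, hc]; omega)
      exact Or.inl ⟨R, hiso _ hR⟩
    · obtain ⟨-, R, hR⟩ := IsSubst.exists_isoOn (L := [C₃, lin 1]) h (by simp)
        (m := 2 * n + 1) (by simp [card_lin_one, card_C₃, hc]; omega)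
      exact Or.inr (Or.inl ⟨R, hiso _ hR⟩)
    · obtain ⟨-, R, hR⟩ := IsSubst.exists_isoOn (L := [C₃, C₃]) h (by simp)
        (m := 2 * n) (by simp [card_C₃, hc]; omega)
      exact Or.inr (Or.inr ⟨R, hiso _ hR⟩)
  · omega

/-- The same with a source and a sink, and `2 n - 1` modules: now three vertices are left over. -/
theorem isListed_of_source_sink [Finite V] {n : ℕ} (hn : 1 ≤ n) {s t : V} (hst : s ≠ t)
    (hs : T.IsSource s) (ht : T.dual.IsSource t) {G : Finset (Set V)}
    (hG : ∀ A ∈ G, T.IsModule A ∧ A.Nontrivial ∧ T.PrimeIn A ∧ A ⊆ {s, t}ᶜ)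
    (hd : ∀ A ∈ G, ∀ B ∈ G, A ≠ B → Disjoint A B) (hGc : G.card = 2 * n - 1)
    (hc : ({s, t}ᶜ : Set V).ncard = 4 * n + 1) : T.IsListed n := by
  have hiso : ∀ X, T.IsoOn {s, t}ᶜ X → T.IsoTo (threeOne X) := fun X hX =>
    isoTo_threeOne_iff.2 ⟨s, t, hst, hs, ht, hX⟩
  rcases isSubst_of_modules hG hd (e := 3) (by omega) (by omega) with ⟨i, j, hij, h, h'⟩ | ⟨-, h⟩
  · obtain ⟨rfl, rfl⟩ | ⟨rfl, rfl⟩ | ⟨rfl, rfl⟩ | ⟨rfl, rfl⟩ :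
        i = 0 ∧ j = 3 ∨ i = 1 ∧ j = 2 ∨ i = 2 ∧ j = 1 ∨ i = 3 ∧ j = 0 := by omega
    · obtain ⟨-, R, hR⟩ := IsSubst.exists_isoOn (L := [lin 1, lin 1, lin 1]) h (by simp)
        (m := 2 * n + 2) (by simp [card_lin_one, hc]; omega)
      iterate 8 right
      exact Or.inl ⟨R, hiso _ hR⟩
    · obtain ⟨-, R, hR⟩ := IsSubst.exists_isoOn (L := [lin 1, lin 1, C₃]) h' (by simp)
        (m := 2 * n + 1) (by simp [card_lin_one, card_C₃, hc]; omega)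
      iterate 10 right
      exact Or.inl ⟨R, hiso _ hR⟩
    · obtain ⟨hlen, R, hR⟩ := IsSubst.exists_isoOn (L := [C₃, C₃, lin 1]) h (by simp)
        (m := 2 * n) (by simp [card_lin_one, card_C₃, hc]; omega)
      have hlen' : 3 ≤ 2 * n := hlen
      iterate 9 right
      exact Or.inl ⟨by omega, R, hiso _ hR⟩
    · obtain ⟨hlen, R, hR⟩ := IsSubst.exists_isoOn (L := [C₃, C₃, C₃]) h (by simp)
        (m := 2 * n - 1) (by simp [card_C₃, hc]; omega)
      have hlen' : 3 ≤ 2 * n - 1 := hlen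
      iterate 11 right
      exact ⟨by omega, R, hiso _ hR⟩
  · iterate 7 right
    left
    rcases h with h | h | h
    · obtain ⟨-, R, hR⟩ := IsSubst.exists_isoOn (L := [U₅]) h (by simp)
        (m := 2 * n - 1) (by simp [card_U₅, hc]; omega)
      exact ⟨R, Or.inl (hiso _ hR)⟩
    · obtain ⟨-, R, hR⟩ := IsSubst.exists_isoOn (L := [V₅]) h (by simp)
        (m := 2 * n - 1) (by simp [card_V₅, hc]; omega)
      exact ⟨R, Or.inr (Or.inl (hiso _ hR))⟩
    · obtain ⟨-, R, hR⟩ := IsSubst.exists_isoOn (L := [W₅]) h (by simp)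
        (m := 2 * n - 1) (by simp [card_W₅, hc]; omega)
      exact ⟨R, Or.inr (Or.inr (hiso _ hR))⟩

/-- A tournament with `4 n + 3` vertices and `2 n + 1` disjoint minimal co-modules is listed. -/
theorem isListed_of_packing [Finite V] {n : ℕ} (hn : 1 ≤ n) (hV : Nat.card V = 4 * n + 3)
    {F : Finset (Set V)} (hF : ∀ A ∈ F, T.MinComod A)
    (hd : ∀ A ∈ F, ∀ B ∈ F, A ≠ B → Disjoint A B) (hc : F.card = 2 * n + 1) :
    T.IsListed n := by
  classical
  by_cases hex : ∃ Y ∈ F, ¬ T.IsModule Y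
  · obtain ⟨Y, hY, hYm⟩ := hex
    have hcore := (hF Y hY).isPrimeCore hYm
    have hG : ∀ A ∈ F.erase Y, T.IsModule A ∧ A.Nontrivial ∧ T.PrimeIn A ∧ A ⊆ Yᶜ := by
      intro A hA
      obtain ⟨hAY, hAF⟩ := Finset.mem_erase.1 hA
      obtain ⟨h1, h2⟩ := (hF A hAF).isModule_of_ne (hF Y hY) hAY hYm
      exact ⟨h1, h2, (hF A hAF).primeIn h1,
        Set.disjoint_left.1 (hd A hAF Y hY hAY)⟩
    have hGd : ∀ A ∈ F.erase Y, ∀ B ∈ F.erase Y, A ≠ B → Disjoint A B := fun A hA B hB =>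
      hd A (Finset.mem_of_mem_erase hA) B (Finset.mem_of_mem_erase hB)
    have hGc : (F.erase Y).card = 2 * n := by
      rw [Finset.card_erase_of_mem hY, hc]
      omega
    have h1 := two_mul_card_le_ncard (fun A hA => ⟨(hG A hA).2.1, (hG A hA).2.2.2⟩) hGd
    have h2 := Set.ncard_add_ncard_compl Y
    have h3 : 2 ≤ Y.ncard := Set.one_lt_ncard_iff_nontrivial.2 hcore.nontrivial
    -- contracting the complement of `Y` cannot leave four vertices
    have h4 : Y.ncard ≠ 3 := by
      intro h
      obtain ⟨z, hz⟩ := hcore.compl_nontrivial.nonempty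
      refine (hcore.primeIn_insert z hz).ncard_ne_four ?_
      rw [Set.ncard_insert_of_notMem hz, h]
    have hY2 : Y.ncard = 2 := by omega
    obtain ⟨a, b, hab, rfl, hW⟩ := hcore.exists_cycle hY2
    have hWc : ({a, b}ᶜ : Set V).ncard = 4 * n + 1 := by omega
    have hcyc : ∀ X, T.IsoOn {a, b}ᶜ X → T.IsoTo (cycOne X) := fun X hX =>
      isoTo_cycOne_iff.2 ⟨a, b, hab, hW, hX⟩
    rcases isSubst_of_modules hG hGd (e := 1) (by omega) (by omega) with
      ⟨i, j, hij, h, -⟩ | ⟨h, -⟩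
    · obtain ⟨rfl, rfl⟩ | ⟨rfl, rfl⟩ : i = 0 ∧ j = 1 ∨ i = 1 ∧ j = 0 := by omega
      · obtain ⟨-, R, hR⟩ := IsSubst.exists_isoOn (L := [lin 1]) h (by simp) (m := 2 * n + 1)
          (by simp [card_lin_one, hWc]; omega)
        exact Or.inr (Or.inr (Or.inr (Or.inl ⟨R, hcyc _ hR⟩)))
      · obtain ⟨-, R, hR⟩ := IsSubst.exists_isoOn (L := [C₃]) h (by simp) (m := 2 * n)
          (by simp [card_C₃, hWc]; omega)
        exact Or.inr (Or.inr (Or.inl ⟨R, hcyc _ hR⟩))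
    · omega
  push Not at hex
  have hGS := Finset.card_filter_add_card_filter_not (s := F) (fun A : Set V => A.Nontrivial)
  have hS2 := card_filter_subsingleton_le hF
  have hsing : ∀ A ∈ F.filter fun A => ¬ A.Nontrivial, ∃ s, A = {s} ∧
      (T.IsSource s ∨ T.dual.IsSource s) := by
    intro A hA
    obtain ⟨hAF, hAn⟩ := Finset.mem_filter.1 hA
    obtain ⟨s, hs⟩ := (hF A hAF).1.nonempty
    obtain rfl := (Set.not_nontrivial_iff.1 hAn).eq_singleton_of_mem hs
    exact ⟨s, rfl, (hF _ hAF).1.source_or_sink⟩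
  have hGd : ∀ A ∈ F.filter fun A => A.Nontrivial, ∀ B ∈ F.filter fun A => A.Nontrivial,
      A ≠ B → Disjoint A B := fun A hA B hB =>
    hd A (Finset.mem_filter.1 hA).1 B (Finset.mem_filter.1 hB).1
  have hG : ∀ W : Set V, (∀ A ∈ F, A.Nontrivial → A ⊆ W) →
      ∀ A ∈ F.filter fun A => A.Nontrivial, T.IsModule A ∧ A.Nontrivial ∧ T.PrimeIn A ∧ A ⊆ W := by
    intro W hW A hA
    obtain ⟨hAF, hAn⟩ := Finset.mem_filter.1 hA
    exact ⟨hex A hAF, hAn, (hF A hAF).primeIn (hex A hAF), hW A hAF hAn⟩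
  have hnot : ∀ s, {s} ∈ F → ∀ A ∈ F, A.Nontrivial → s ∉ A := by
    intro s hs A hA hAn hsA
    refine Set.disjoint_left.1 (hd A hA {s} hs ?_) hsA rfl
    rintro rfl
    exact Set.not_nontrivial_singleton hAn
  obtain h | h | h : (F.filter fun A => ¬ A.Nontrivial).card = 0 ∨
      (F.filter fun A => ¬ A.Nontrivial).card = 1 ∨
      (F.filter fun A => ¬ A.Nontrivial).card = 2 := by omega
  · have hu := Set.ncard_univ V
    rcases isSubst_of_modules (hG Set.univ fun A _ _ => Set.subset_univ A) hGd (e := 1)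
      (by omega) (by omega) with ⟨i, j, hij, h', -⟩ | ⟨h', -⟩
    · obtain ⟨rfl, rfl⟩ | ⟨rfl, rfl⟩ : i = 0 ∧ j = 1 ∨ i = 1 ∧ j = 0 := by omega
      · obtain ⟨-, R, hR⟩ := IsSubst.exists_isoOn (L := [lin 1]) h' (by simp) (m := 2 * n + 2)
          (by rw [hu]; simp [card_lin_one]; omega)
        exact Or.inl ⟨R, hR.isoTo⟩
      · obtain ⟨-, R, hR⟩ := IsSubst.exists_isoOn (L := [C₃]) h' (by simp) (m := 2 * n + 1)
          (by rw [hu]; simp [card_C₃]; omega)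
        exact Or.inr (Or.inl ⟨R, hR.isoTo⟩)
    · omega
  · obtain ⟨A, hA⟩ := Finset.card_eq_one.1 h
    have hAm : A ∈ F.filter fun A => ¬ A.Nontrivial := hA ▸ Finset.mem_singleton_self A
    obtain ⟨s, rfl, hs⟩ := hsing A hAm
    have hW : ∀ A ∈ F, A.Nontrivial → A ⊆ {s}ᶜ := fun A hA hAn v hv hvs =>
      hnot s (Finset.mem_filter.1 hAm).1 A hA hAn ((show v = s from hvs) ▸ hv)
    have hsc := Set.ncard_add_ncard_compl ({s} : Set V)
    rw [Set.ncard_singleton] at hsc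
    iterate 4 right
    rcases hs with hs | hs
    · rcases isoTo_twoOne_of_modules (n := n) hs (hG _ hW) hGd (by omega) (by omega) with
        ⟨R, hR⟩ | ⟨R, hR⟩ | ⟨R, hR⟩
      · exact Or.inl ⟨R, Or.inl hR⟩
      · exact Or.inr (Or.inl ⟨R, Or.inl hR⟩)
      · exact Or.inr (Or.inr (Or.inl ⟨R, Or.inl hR⟩))
    · have hG' : ∀ A ∈ F.filter fun A => A.Nontrivial,
          T.dual.IsModule A ∧ A.Nontrivial ∧ T.dual.PrimeIn A ∧ A ⊆ {s}ᶜ := fun A hA =>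
        have h := hG _ hW A hA
        ⟨isModule_dual.2 h.1, h.2.1, primeIn_dual.2 h.2.2.1, h.2.2.2⟩
      rcases isoTo_twoOne_of_modules (n := n) hs hG' hGd (by omega) (by omega) with
        ⟨R, hR⟩ | ⟨R, hR⟩ | ⟨R, hR⟩
      · exact Or.inl ⟨R, Or.inr (isoTo_dual_iff.2 hR)⟩
      · exact Or.inr (Or.inl ⟨R, Or.inr (isoTo_dual_iff.2 hR)⟩)
      · exact Or.inr (Or.inr (Or.inl ⟨R, Or.inr (isoTo_dual_iff.2 hR)⟩))
  · obtain ⟨A, B, hAB, hAB'⟩ := Finset.card_eq_two.1 h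
    have hAm : A ∈ F.filter fun A => ¬ A.Nontrivial := by rw [hAB']; simp
    have hBm : B ∈ F.filter fun A => ¬ A.Nontrivial := by rw [hAB']; simp
    obtain ⟨s, rfl, hs⟩ := hsing A hAm
    obtain ⟨t, rfl, ht⟩ := hsing B hBm
    have hst : s ≠ t := fun e => hAB (e ▸ rfl)
    have key : ∀ s t, {s} ∈ F → {t} ∈ F → s ≠ t → T.IsSource s → T.dual.IsSource t →
        T.IsListed n := by
      intro s t hsF htF hst hs ht
      have hW : ∀ A ∈ F, A.Nontrivial → A ⊆ {s, t}ᶜ := by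
        rintro A hA hAn v hv (rfl | hvt)
        · exact hnot v hsF A hA hAn hv
        · exact hnot t htF A hA hAn ((show v = t from hvt) ▸ hv)
      have hsc := Set.ncard_add_ncard_compl ({s, t} : Set V)
      rw [Set.ncard_pair hst] at hsc
      exact isListed_of_source_sink hn hst hs ht (hG _ hW) hGd (by omega) (by omega)
    have hsF := (Finset.mem_filter.1 hAm).1
    have htF := (Finset.mem_filter.1 hBm).1
    rcases hs with hs | hs <;> rcases ht with ht | ht
    · exact absurd (hs.unique ht) hst
    · exact key s t hsF htF hst hs ht
    · exact key t s htF hsF hst.symm ht hs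
    · exact absurd (hs.unique ht) hst

/-- The listed tournaments have `4 n + 3` vertices and `2 n + 1` disjoint co-modules: those inside
the lexicographic sum, and the ends of the surrounding `2`, `3` or `C₃`. -/
theorem IsListed.card_and_hasPacking [Finite V] {n : ℕ} (hn : 1 ≤ n) (h : T.IsListed n) :
    Nat.card V = 4 * n + 3 ∧ T.HasPacking (2 * n + 1) := by
  have hu := Set.ncard_univ V
  have hone : ∀ {k : ℕ} {R : Tournament (Fin k)} {L : List BTournament},
      (∀ S ∈ L, S ∈ [lin 1, C₃, U₅, V₅, W₅]) → L.length ≤ k →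
      2 * n + 1 + L.length = k + (L.map fun S => if 2 ≤ Nat.card S.V then 1 else 0).sum →
      4 * n + 3 + 2 * L.length = 2 * k + (L.map fun S => Nat.card S.V).sum →
      T.IsoTo (subst R L) → Nat.card V = 4 * n + 3 ∧ T.HasPacking (2 * n + 1) := by
    intro k R L hL hk hm hc h
    obtain ⟨h1, h2⟩ := (IsoOn.of_isoTo h).subst_facts hL hk hm
    exact ⟨by omega, h2.hasPacking (e := 0) (fun _ _ _ _ _ hv => absurd trivial hv)
      (Or.inr (by omega)) (d := Fin.elim0) (fun i => i.elim0) (fun i => i.elim0)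
      fun i => i.elim0⟩
  have hcyc : ∀ {k : ℕ} {R : Tournament (Fin k)} {L : List BTournament},
      (∀ S ∈ L, S ∈ [lin 1, C₃, U₅, V₅, W₅]) → L.length ≤ k →
      2 * n + L.length = k + (L.map fun S => if 2 ≤ Nat.card S.V then 1 else 0).sum →
      4 * n + 1 + 2 * L.length = 2 * k + (L.map fun S => Nat.card S.V).sum →
      T.IsoTo (cycOne (subst R L)) → Nat.card V = 4 * n + 3 ∧ T.HasPacking (2 * n + 1) := by
    intro k R L hL hk hm hc h
    obtain ⟨a, b, hab, hW, h⟩ := isoTo_cycOne_iff.1 h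
    obtain ⟨h1, h2⟩ := h.subst_facts hL hk hm
    have h3 := Set.ncard_add_ncard_compl ({a, b} : Set V)
    rw [Set.ncard_pair (ne_of_arc hab)] at h3
    exact ⟨by omega, hasPacking_of_cycle hW
      (Set.one_lt_ncard_iff_nontrivial.1 (by omega)) h2⟩
  have htwo : ∀ {T : Tournament V} {k : ℕ} {R : Tournament (Fin k)} {L : List BTournament},
      (∀ S ∈ L, S ∈ [lin 1, C₃, U₅, V₅, W₅]) → L.length ≤ k →
      2 * n + L.length = k + (L.map fun S => if 2 ≤ Nat.card S.V then 1 else 0).sum →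
      4 * n + 2 + 2 * L.length = 2 * k + (L.map fun S => Nat.card S.V).sum →
      T.IsoTo (twoOne (subst R L)) → Nat.card V = 4 * n + 3 ∧ T.HasPacking (2 * n + 1) := by
    intro T k R L hL hk hm hc h
    obtain ⟨s, hs, h⟩ := isoTo_twoOne_iff.1 h
    obtain ⟨h1, h2⟩ := h.subst_facts hL hk hm
    have h3 := Set.ncard_add_ncard_compl ({s} : Set V)
    rw [Set.ncard_singleton] at h3
    exact ⟨by omega, hasPacking_of_source (by omega) hs h2⟩
  have htwo_dual : ∀ {k : ℕ} {R : Tournament (Fin k)} {L : List BTournament},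
      (∀ S ∈ L, S ∈ [lin 1, C₃, U₅, V₅, W₅]) → L.length ≤ k →
      2 * n + L.length = k + (L.map fun S => if 2 ≤ Nat.card S.V then 1 else 0).sum →
      4 * n + 2 + 2 * L.length = 2 * k + (L.map fun S => Nat.card S.V).sum →
      T.IsoTo (twoOne (subst R L)) ∨ T.IsoTo (twoOne (subst R L)).dual →
      Nat.card V = 4 * n + 3 ∧ T.HasPacking (2 * n + 1) := by
    intro k R L hL hk hm hc h
    rcases h with h | h
    · exact htwo hL hk hm hc h
    · obtain ⟨h1, h2⟩ := htwo hL hk hm hc (isoTo_dual_iff.1 h)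
      exact ⟨h1, hasPacking_dual.1 h2⟩
  have hthree : ∀ {k : ℕ} {R : Tournament (Fin k)} {L : List BTournament},
      (∀ S ∈ L, S ∈ [lin 1, C₃, U₅, V₅, W₅]) → L.length ≤ k →
      2 * n - 1 + L.length = k + (L.map fun S => if 2 ≤ Nat.card S.V then 1 else 0).sum →
      4 * n + 1 + 2 * L.length = 2 * k + (L.map fun S => Nat.card S.V).sum →
      T.IsoTo (threeOne (subst R L)) → Nat.card V = 4 * n + 3 ∧ T.HasPacking (2 * n + 1) := by
    intro k R L hL hk hm hc h
    obtain ⟨s, t, hst, hs, ht, h⟩ := isoTo_threeOne_iff.1 h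
    obtain ⟨h1, h2⟩ := h.subst_facts hL hk hm
    have h3 := Set.ncard_add_ncard_compl ({s, t} : Set V)
    rw [Set.ncard_pair hst] at h3
    have h4 := hasPacking_of_source_sink (by omega) hst hs ht h2
    rw [show 2 * n - 1 + 2 = 2 * n + 1 by omega] at h4
    exact ⟨by omega, h4⟩
  rcases h with ⟨R, h⟩ | ⟨R, h⟩ | ⟨R, h⟩ | ⟨R, h⟩ | ⟨R, h⟩ | ⟨R, h⟩ | ⟨R, h⟩ | ⟨R, h | h | h⟩ |
    ⟨R, h⟩ | ⟨hn2, R, h⟩ | ⟨R, h⟩ | ⟨hn2, R, h⟩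
  · refine hone ?_ ?_ ?_ ?_ h <;> simp [card_lin_one] <;> omega
  · refine hone ?_ ?_ ?_ ?_ h <;> simp [card_C₃] <;> omega
  · refine hcyc ?_ ?_ ?_ ?_ h <;> simp [card_C₃] <;> omega
  · refine hcyc ?_ ?_ ?_ ?_ h <;> simp [card_lin_one] <;> omega
  · refine htwo_dual ?_ ?_ ?_ ?_ h <;> simp [card_lin_one] <;> omega
  · refine htwo_dual ?_ ?_ ?_ ?_ h <;> simp [card_lin_one, card_C₃] <;> omega
  · refine htwo_dual ?_ ?_ ?_ ?_ h <;> simp [card_C₃] <;> omega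
  · refine hthree ?_ ?_ ?_ ?_ h <;> simp [card_U₅] <;> omega
  · refine hthree ?_ ?_ ?_ ?_ h <;> simp [card_V₅] <;> omega
  · refine hthree ?_ ?_ ?_ ?_ h <;> simp [card_W₅] <;> omega
  · refine hthree ?_ ?_ ?_ ?_ h <;> simp [card_lin_one] <;> omega
  · refine hthree ?_ ?_ ?_ ?_ h <;> simp [card_lin_one, card_C₃] <;> omega
  · refine hthree ?_ ?_ ?_ ?_ h <;> simp [card_lin_one, card_C₃] <;> omega
  · refine hthree ?_ ?_ ?_ ?_ h <;> simp [card_C₃] <;> omega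

theorem decompIndex_le_succ [Finite V] {n : ℕ} (hn : 1 ≤ n) (hV : Nat.card V = 4 * n + 3) :
    T.decompIndex ≤ n + 1 := by
  refine decompIndex_le_of_packing (by omega) fun F hF hd => ?_
  have := card_packing_le hF hd
  omega

theorem maxDecompIndex_eq {n : ℕ} (hn : 1 ≤ n) : maxDecompIndex (4 * n + 3) = n + 1 := by
  obtain ⟨⟨T, hT⟩, hmax⟩ := maxDecompIndex_isGreatest (4 * n + 3)
  refine le_antisymm (hT ▸ decompIndex_le_succ hn (Nat.card_fin _)) ?_
  have h1 := hasPacking_transitive (2 * n + 1) (by omega)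
  rw [show 2 * (2 * n + 1) + 1 = 4 * n + 3 by ring] at h1
  have h2 := h1.le_two_mul_decompIndex (by rw [Nat.card_fin]; omega)
  have h3 := hmax ⟨transitive (4 * n + 3), rfl⟩
  simp only at h3
  omega

theorem isListed_iff [Finite V] {n : ℕ} (hn : 1 ≤ n) :
    (Nat.card V = 4 * n + 3 ∧ T.decompIndex = n + 1) ↔ T.IsListed n := by
  constructor
  · rintro ⟨hV, hT⟩
    by_contra hcon
    -- without `2 n + 1` disjoint minimal co-modules, `n` reversals are enough
    have : T.decompIndex ≤ n := by
      refine decompIndex_le_of_packing (by omega) fun F hF hd => ?_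
      by_contra hc
      obtain ⟨F', hF', hc'⟩ := Finset.exists_subset_card_eq
        (show 2 * n + 1 ≤ F.card by omega)
      exact hcon (isListed_of_packing hn hV (fun A hA => hF A (hF' hA))
        (fun A hA B hB => hd A (hF' hA) B (hF' hB)) hc')
    omega
  · intro h
    obtain ⟨hV, hp⟩ := h.card_and_hasPacking hn
    have h1 := hp.le_two_mul_decompIndex (by omega)
    have h2 := decompIndex_le_succ (T := T) hn hV
    exact ⟨hV, by omega⟩

end Tournament

theorem theorem6p4 (n : ℕ) (hn : 1 ≤ n) :
    maxDecompIndex (4 * n + 3) = n + 1 ∧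
    ∀ (V : Type u) [Fintype V] (T : Tournament V),
      (Fintype.card V = 4 * n + 3 ∧ T.decompIndex = maxDecompIndex (4 * n + 3)) ↔
        -- `T_{2n+2}(1, 2, …, 2)`
        (∃ R : Tournament (Fin (2 * n + 2)), T.IsoTo (subst R [lin 1])) ∨
        -- `T_{2n+1}(C₃, 2, …, 2)`
        (∃ R : Tournament (Fin (2 * n + 1)), T.IsoTo (subst R [C₃])) ∨
        -- `C₃(1, 1, T_{2n}(C₃, 2, …, 2))`
        (∃ R : Tournament (Fin (2 * n)), T.IsoTo (cycOne (subst R [C₃]))) ∨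
        -- `C₃(1, 1, T_{2n+1}(1, 2, …, 2))`
        (∃ R : Tournament (Fin (2 * n + 1)), T.IsoTo (cycOne (subst R [lin 1]))) ∨
        -- `2(1, T_{2n+2}(1, 1, 2, …, 2))` or its dual
        (∃ R : Tournament (Fin (2 * n + 2)),
          T.IsoTo (twoOne (subst R [lin 1, lin 1])) ∨
          T.IsoTo (twoOne (subst R [lin 1, lin 1])).dual) ∨
        -- `2(1, T_{2n+1}(C₃, 1, 2, …, 2))` or its dual
        (∃ R : Tournament (Fin (2 * n + 1)),
          T.IsoTo (twoOne (subst R [C₃, lin 1])) ∨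
          T.IsoTo (twoOne (subst R [C₃, lin 1])).dual) ∨
        -- `2(1, T_{2n}(C₃, C₃, 2, …, 2))` or its dual
        (∃ R : Tournament (Fin (2 * n)),
          T.IsoTo (twoOne (subst R [C₃, C₃])) ∨
          T.IsoTo (twoOne (subst R [C₃, C₃])).dual) ∨
        -- `3(1, T_{2n-1}(S₅, 2, …, 2), 1)` with `S₅` one of `U₅`, `V₅`, `W₅`
        (∃ R : Tournament (Fin (2 * n - 1)),
          T.IsoTo (threeOne (subst R [U₅])) ∨
          T.IsoTo (threeOne (subst R [V₅])) ∨
          T.IsoTo (threeOne (subst R [W₅]))) ∨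
        -- `3(1, T_{2n+2}(1, 1, 1, 2, …, 2), 1)`
        (∃ R : Tournament (Fin (2 * n + 2)),
          T.IsoTo (threeOne (subst R [lin 1, lin 1, lin 1]))) ∨
        -- `3(1, T_{2n}(C₃, C₃, 1, 2, …, 2), 1)` when `n ≥ 2`
        (2 ≤ n ∧ ∃ R : Tournament (Fin (2 * n)),
          T.IsoTo (threeOne (subst R [C₃, C₃, lin 1]))) ∨
        -- `3(1, T_{2n+1}(1, 1, C₃, 2, …, 2), 1)`
        (∃ R : Tournament (Fin (2 * n + 1)),
          T.IsoTo (threeOne (subst R [lin 1, lin 1, C₃]))) ∨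
        -- `3(1, T_{2n-1}(C₃, C₃, C₃, 2, …, 2), 1)` when `n ≥ 2`
        (2 ≤ n ∧ ∃ R : Tournament (Fin (2 * n - 1)),
          T.IsoTo (threeOne (subst R [C₃, C₃, C₃]))) := by
  refine ⟨Tournament.maxDecompIndex_eq hn, fun V _ T => ?_⟩
  rw [Tournament.maxDecompIndex_eq hn, ← Nat.card_eq_fintype_card]
  exact Tournament.isListed_iff hn
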